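/- **Setting.** Let $\Xi$ be a finite $D$-dimensional lattice, $D\ge 1$: an $L_1\times\dots\times L_D$ block of unit cells of $\mathbb Z^D$ (arbitrary side lengths, each direction with open or periodic boundary conditions) with $m$ sites per cell. Two distinct sites are nearest neighbours if they lie in the same cell, or have the same position inside two adjacent cells; $\Xi$ carries a metric $d$ such that (number of nearest-neighbour steps from $x$ to $y$) $\le\kappa\, d(x,y)$ for all $x,y$, and $B_i(r)$ is the closed $d$-ball of radius $r$ around $i$. Each site carries a qudit of dimension $d_0\ge 2$. The Hamiltonian is $H=\sum_{i\in\Xi,\,r\in\mathbb N}h_i(r)$, with Hermitian $h_i(r)$ such that $\mathrm{supp}[h_i(r)]\subset B_i(r)$ and, if $r\ge1$ and $h_i(r)\ne0$, $\mathrm{supp}[h_i(r)]\not\subset B_i(r-1)$. For a subset $A\subset\Xi$ with complement $\bar A$, let $|\partial A|$ be the number of nearest-neighbour bonds joining $A$ to $\bar A$. For an arbitrary density matrix $\rho$ let $\rho(t)=e^{-iHt}\rho\, e^{iHt}$, $\rho_A(t)=\mathrm{Tr}_{\bar A}\,\rho(t)$, $S_1(t)=-\mathrm{Tr}\,\rho_A(t)\log\rho_A(t)$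 and $S_\alpha(t)=\frac1{1-\alpha}\log\mathrm{Tr}\,\rho_A(t)^\alpha$ for $\alpha\neq1$. Norms of operators are operator norms. **Theorem.** There are positive constants $c_1,c',C_1,C_2$ depending only on the lattice structure $(D,m,\kappa)$ such that the following holds for all lattices as above, all $d_0$, $H$, $A$, $\rho$ and all $t\in\mathbb R$; in each case the entropy in question is differentiable in $t$. 1. (Power-law local.) For every $w>2D+1$ there is a constant $c$ depending only on $w$ and $(D,m,\kappa)$ such that, if $\|h_i(r)\|\le\bar h\,r^{-w}$ for all $i$ and all $r\ge1$, then $$|S_1'(t)|\le c\,|\partial A|\,\bar h\,\log d_0 .$$ 2. ((Super)exponentially local.) If $\|h_i(r)\|\le\bar h\,e^{-(r/\xi)^{D}}$ for all $i,r$, with $0<\xi<\xi_c=\left(\frac{1}{c_1\log d_0}\right)^{1/D}$, then for every $\alpha>1$ $$|S_\alpha'(t)|\le \frac{\alpha}{\alpha-1}\,c'\,|\partial A|\,\bar h .$$ 3. (Finite range.) Suppose $h_i(r)=0$ for $r>R$, and that the interaction terms at any site have norm at most $\bar h$, in the sense that either for every site $x$ the sum of all terms $h_i(r)$ acting nontrivially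 on $x$ has norm at most $\bar h$, or for every site $x$ the sum $\sum_r h_x(r)$ of all terms centred at $x$ has norm at most $\bar h$. Then, for $\alpha=1$ and for every $\alpha>1$, $$|S_\alpha'(t)|\le b_\alpha(R)\,|\partial A|\,\bar h\,\log d_0,\qquad b_1(R)=C_1R^{D+1},\qquad b_\alpha(R)=C_2\,\frac{\alpha}{\alpha-1}\,R\,d_0^{\,2c_1R^D}\quad(\alpha>1).$$ -/

import Mathlib

open scoped BigOperators ComplexOrder

noncomputable section

/-! ### Finite `D`-dimensional lattices -/

/-- A finite patch of a `D`-dimensional lattice with `m` sites per unit cell: the unit cells form a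
`size 0 × ⋯ × size (D-1)` block, each direction having open or periodic boundary conditions. -/
structure LatticePatch (D m : ℕ) where
  size : Fin D → ℕ
  periodic : Fin D → Bool

namespace LatticePatch

variable {D m : ℕ}

/-- A site: the coordinates of its unit cell, and its position inside the cell. -/
def Site (Λ : LatticePatch D m) : Type := (∀ k : Fin D, Fin (Λ.size k)) × Fin m

instance (Λ : LatticePatch D m) : Fintype Λ.Site :=
  inferInstanceAs (Fintype ((∀ k : Fin D, Fin (Λ.size k)) × Fin m))

instance (Λ : LatticePatch D m) : DecidableEq Λ.Site :=
  inferInstanceAs (DecidableEq ((∀ k : Fin D, Fin (Λ.size k)) × Fin m))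

/-- Distance between two positions along one axis of length `L` (a path, or a cycle if periodic). -/
def axisDist (periodic : Bool) {L : ℕ} (a b : Fin L) : ℕ :=
  if periodic then min (Nat.dist a b) (L - Nat.dist a b) else Nat.dist a b

/-- The number of nearest-neighbour steps between two sites, a step being either a move to an
adjacent unit cell or a change of position inside the cell. -/
def gridDist (Λ : LatticePatch D m) (x y : Λ.Site) : ℕ :=
  (∑ k, axisDist (Λ.periodic k) (x.1 k) (y.1 k)) + if x.2 = y.2 then 0 else 1

/-- The area `|∂A|`: the number of nearest-neighbour bonds joining `A` to its complement. -/
def boundaryArea (Λ : LatticePatch D m) (A : Finset Λ.Site) : ℕ :=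
  ((A ×ˢ Aᶜ).filter fun p => Λ.gridDist p.1 p.2 = 1).card

end LatticePatch

/-! ### Operators on the qudit Hilbert space `(ℂ^d)^{⊗ V}` -/

/-- Operators on `(ℂ^d)^{⊗ V}`, as matrices in the product basis indexed by `V → Fin d`. -/
abbrev QuditOp (V : Type) (d : ℕ) : Type := Matrix (V → Fin d) (V → Fin d) ℂ

section Qudits

variable {V : Type} [Fintype V] [DecidableEq V] {d : ℕ}

/-- `supp M ⊆ S`: the operator `M` has the form `K ⊗ 1`, with `K` acting on the sites in `S`. -/
def SupportedOn (S : Set V) (M : QuditOp V d) : Prop :=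
  ∃ K : QuditOp S d,
    (∀ σ τ : V → Fin d, (∀ x, x ∉ S → σ x = τ x) → M σ τ = K (S.domRestrict σ) (S.domRestrict τ)) ∧
    (∀ σ τ : V → Fin d, ¬ (∀ x, x ∉ S → σ x = τ x) → M σ τ = 0)

/-- `M` acts nontrivially on the site `x`, i.e. `x ∈ supp M`. -/
def ActsOn (x : V) (M : QuditOp V d) : Prop := ¬ SupportedOn {x}ᶜ M

/-- The operator norm with respect to the Hilbert space norm. -/
def opNorm (M : QuditOp V d) : ℝ := ‖Matrix.toEuclideanCLM (𝕜 := ℂ) M‖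

/-- Density matrices. -/
def IsDensityMatrix (ρ : QuditOp V d) : Prop := ρ.PosSemidef ∧ ρ.trace = 1

/-- Join a configuration on `A` and a configuration on its complement. -/
def glue (A : Finset V) (a : {x // x ∈ A} → Fin d) (b : {x // x ∉ A} → Fin d) : V → Fin d :=
  fun x => if h : x ∈ A then a ⟨x, h⟩ else b ⟨x, h⟩

/-- The reduced density matrix `ρ_A`, the partial trace of `ρ` over the complement of `A`. -/
def reduced (A : Finset V) (ρ : QuditOp V d) : QuditOp {x // x ∈ A} d :=
  Matrix.of fun a a' => ∑ b : {x // x ∉ A} → Fin d, ρ (glue A a b) (glue A a' b)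

/-- The `α`-Renyi entropy `log (Tr ρ ^ α) / (1 - α)`; for `α = 1`, the von Neumann entropy
`- Tr (ρ log ρ)`. -/
def renyiEntropy (α : ℝ) (ρ : QuditOp V d) : ℝ :=
  if α = 1 then - (cfc (fun x : ℝ => x * Real.log x) ρ).trace.re
  else 1 / (1 - α) * Real.log (cfc (fun x : ℝ => x ^ α) ρ).trace.re

/-- The evolved state `ρ(t) = exp (-iHt) ρ exp (iHt)`. -/
def evolve (H ρ : QuditOp V d) (t : ℝ) : QuditOp V d :=
  NormedSpace.exp ((-(Complex.I * t)) • H) * ρ * NormedSpace.exp ((Complex.I * t) • H)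

/-- The entropy `S_α(t)` of the subsystem `A` at time `t`. -/
def entropyAt (H ρ : QuditOp V d) (A : Finset V) (α t : ℝ) : ℝ :=
  renyiEntropy α (reduced A (evolve H ρ t))

/-- `S_α(t)` is differentiable and `|S_α'(t)| ≤ B`, at all times. -/
def EntropyRateLE (H ρ : QuditOp V d) (A : Finset V) (α B : ℝ) : Prop :=
  ∀ t : ℝ, DifferentiableAt ℝ (entropyAt H ρ A α) t ∧ |deriv (entropyAt H ρ A α) t| ≤ B

end Qudits

/-! ### Hamiltonians with geometric locality -/

/-- The terms `h_i(r)` of a Hamiltonian: `supp h_i(r)` is contained in the ball of radius `r`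
around `i` and, unless the term is absent, not in the ball of radius `r - 1`. -/
structure Interaction (V : Type) [Fintype V] [DecidableEq V] [MetricSpace V] (d : ℕ) where
  term : V → ℕ → QuditOp V d
  isHermitian : ∀ (i : V) (r : ℕ), (term i r).IsHermitian
  supportedOn : ∀ (i : V) (r : ℕ), SupportedOn (Metric.closedBall i (r : ℝ)) (term i r)
  not_supportedOn : ∀ (i : V) (r : ℕ), term i (r + 1) ≠ 0 →
    ¬ SupportedOn (Metric.closedBall i (r : ℝ)) (term i (r + 1))

namespace Interaction

variable {V : Type} [Fintype V] [DecidableEq V] [MetricSpace V] {d : ℕ}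

/-- On a finite lattice only finitely many terms are present, so the sums over `r` below are
finite sums. -/
theorem finite_support (h : Interaction V d) (i : V) :
    (Function.support (h.term i)).Finite := by
  obtain ⟨N, hN⟩ := exists_nat_gt (∑ j : V, dist j i)
  refine (Set.finite_Iic N).subset fun r hr => ?_
  by_contra hlt
  have hlt : N < r := by simpa using hlt
  obtain ⟨s, rfl⟩ : ∃ s, r = s + 1 := ⟨r - 1, by omega⟩
  refine h.not_supportedOn i s hr ?_
  have hball : Metric.closedBall i (s : ℝ) = Metric.closedBall i ((s + 1 : ℕ) : ℝ) := by
    ext j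
    have h1 : dist j i ≤ ∑ j : V, dist j i :=
      Finset.single_le_sum (f := fun j => dist j i) (fun _ _ => dist_nonneg) (Finset.mem_univ j)
    have h2 : (N : ℝ) ≤ s := by exact_mod_cast Nat.lt_succ_iff.mp hlt
    simp only [Metric.mem_closedBall, Nat.cast_add, Nat.cast_one]
    constructor <;> intro <;> linarith
  rw [hball]
  exact h.supportedOn i (s + 1)

/-- The Hamiltonian `H = ∑_{i, r} h_i(r)`. -/
def hamiltonian (h : Interaction V d) : QuditOp V d := ∑ i, ∑ᶠ r, h.term i r

/-- Power-law locality `‖h_i(r)‖ ≤ hbar / r ^ w` (which says nothing about on-site terms). -/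
def PowerLawLocal (h : Interaction V d) (w hbar : ℝ) : Prop :=
  ∀ i, ∀ r : ℕ, 1 ≤ r → opNorm (h.term i r) ≤ hbar / (r : ℝ) ^ w

/-- Stretched-exponential locality `‖h_i(r)‖ ≤ hbar * exp (-(r / ξ) ^ w)`. -/
def StretchedExpLocal (h : Interaction V d) (w ξ hbar : ℝ) : Prop :=
  ∀ i, ∀ r : ℕ, opNorm (h.term i r) ≤ hbar * Real.exp (-((r : ℝ) / ξ) ^ w)

/-- Range at most `R`. -/
def FiniteRange (h : Interaction V d) (R : ℕ) : Prop := ∀ i, ∀ r : ℕ, R < r → h.term i r = 0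

open Classical in
/-- The sum of all terms that act nontrivially on the site `x`. -/
def actingOn (h : Interaction V d) (x : V) : QuditOp V d :=
  ∑ i, ∑ᶠ r, if ActsOn x (h.term i r) then h.term i r else 0

/-- The sum of all terms centred at the site `x`. -/
def centredAt (h : Interaction V d) (x : V) : QuditOp V d := ∑ᶠ r, h.term x r

/-- At every site, the interaction terms have norm at most `hbar`, where the terms are assigned
to sites either by their supports or by their centres. -/
def SiteNormLE (h : Interaction V d) (hbar : ℝ) : Prop :=
  (∀ x, opNorm (h.actingOn x) ≤ hbar) ∨ (∀ x, opNorm (h.centredAt x) ≤ hbar)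

end Interaction

end

/-! Write `H` as a sum of operators `k j` supported on sets `S j`. The derivative of `Tr f(ρ_A)` is
the pairing of `-i f'(ρ_A)` with the partial trace of `[H, ρ]`. It is linear in `H`, so the pieces
can be estimated one at a time, and a piece on one side of the cut contributes nothing. What is
needed is a bound for one piece, a count of the pieces that straddle the boundary, and, for finite
range, a good choice of pieces.

One piece, von Neumann entropy. The rate is at most `36 ‖k‖` times the logarithm of the dimension of
the smaller side of the support (`norm_commPairing_log_le`, small incremental entangling). Suppose
first that the smaller side lies outside `A` and has dimension `d`. The rest of the environment can
be traced out, and the remaining state is dominated by `d` times `ρ_A ⊗ 1`. In an eigenbasis of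
`ρ_A`, commuting with `log ρ_A` multiplies matrix entries by differences of logarithms of
eigenvalues. Cut the logarithmic scale into steps of length `2 log d`: the rounding error is
bounded, and the part of the interaction that jumps `k` steps has expectation of order `2 ^ (-k)` by
Cauchy-Schwarz and the domination (`norm_trace_levelPart_mul_le`). Summing gives
`norm_sum_log_sub_log_le`. If the smaller side lies inside `A`, a purification exchanges `A` with
its environment (`norm_trace_log_commutator_le_left`).

One piece, Renyi entropy. The logarithm is replaced by the power `α - 1`; Cauchy-Schwarz, the same
domination and Young's inequality give a bound proportional to the dimension itself instead of its
logarithm (`norm_sum_rpow_mul_le`). A ball of radius `r` thus costs `d₀` to a power of order `r ^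
D`, which is what the decay `exp (-(r / ξ) ^ D)` below the critical `ξ` has to beat.

Counting. Bounding the cut of a ball by the sites of the ball across from its centre turns the sum
over centres into a count of pairs within distance `r` separated by `A`. A lattice path between such
a pair crosses the boundary, and shifts are injective, so there are at most a constant times `r ^ (D
+ 1) |∂A|` of them (`sepCount_gridDist_le`).

Finite range. When only the sum of the terms acting on a site is controlled, single terms may be
large. Making `H` trivial at one site after another telescopes it into one local operator per site,
of norm at most `2 hbar`, plus a multiple of the identity (`exists_sum_of_compressAt`).

Differentiability. The functions `x log x` and `x ^ α` need not be smooth at `0`, and eigenvalues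
may reach `0`. In `hasDerivAt_trace_cfc` a Hermite interpolating polynomial stands in for the
function; the error is controlled by the trace of a nonnegative polynomial that has a minimum at the
given time. -/

/-! ### Counting separated pairs of sites -/

section SeparatedPairs

open Classical in
/-- The number of ordered pairs related by `r` of which exactly one member lies in `A`. -/
noncomputable def sepCount {V : Type*} [Fintype V] (A : Finset V) (r : V → V → Prop) : ℕ :=
  (Finset.univ.filter fun p : V × V => r p.1 p.2 ∧ ¬ (p.1 ∈ A ↔ p.2 ∈ A)).card

open Classical in
/-- The number of elements that `x` is related to. -/
noncomputable def outDeg {V : Type*} [Fintype V] (r : V → V → Prop) (x : V) : ℕ :=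
  (Finset.univ.filter fun y => r x y).card

variable {V : Type*} [Fintype V] {A : Finset V}

theorem outDeg_mono {r s : V → V → Prop} (x : V) (h : ∀ y, r x y → s x y) :
    outDeg r x ≤ outDeg s x := by
  classical
  exact Finset.card_le_card fun y => by simpa using h y

theorem sepCount_mono {r s : V → V → Prop} (h : ∀ x y, r x y → s x y) :
    sepCount A r ≤ sepCount A s := by
  classical
  refine Finset.card_le_card fun p => ?_
  simp only [Finset.mem_filter, Finset.mem_univ, true_and]
  exact fun hp => ⟨h _ _ hp.1, hp.2⟩

theorem sepCount_eq_zero {r : V → V → Prop} (h : ∀ x y, r x y → x = y) : sepCount A r = 0 := by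
  classical
  rw [sepCount, Finset.card_eq_zero, Finset.filter_eq_empty_iff]
  rintro ⟨x, y⟩ - ⟨h1, h2⟩
  exact h2 (by rw [h x y h1])

theorem sepCount_flip (r : V → V → Prop) : sepCount A (flip r) = sepCount A r := by
  classical
  refine Finset.card_bij (fun p _ => (p.2, p.1)) ?_ ?_ ?_
  · rintro ⟨x, y⟩ h
    simp only [Finset.mem_filter, Finset.mem_univ, true_and] at h ⊢
    exact ⟨h.1, fun h' => h.2 h'.symm⟩
  · rintro ⟨x, y⟩ _ ⟨x', y'⟩ _ h
    simp_all
  · rintro ⟨x, y⟩ h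
    refine ⟨(y, x), ?_, rfl⟩
    simp only [Finset.mem_filter, Finset.mem_univ, true_and] at h ⊢
    exact ⟨h.1, fun h' => h.2 h'.symm⟩

theorem sepCount_exists_le {ι : Type*} (s : Finset ι) (r : ι → V → V → Prop) :
    sepCount A (fun x y => ∃ e ∈ s, r e x y) ≤ ∑ e ∈ s, sepCount A (r e) := by
  classical
  unfold sepCount
  refine le_trans (Finset.card_le_card ?_) Finset.card_biUnion_le
  intro p
  simp only [Finset.mem_filter, Finset.mem_univ, true_and, Finset.mem_biUnion]
  rintro ⟨⟨e, he, h⟩, h'⟩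
  exact ⟨e, he, h, h'⟩

theorem sepCount_or_le (r s : V → V → Prop) :
    sepCount A (fun x y => r x y ∨ s x y) ≤ sepCount A r + sepCount A s := by
  classical
  unfold sepCount
  refine le_trans (Finset.card_le_card ?_) (Finset.card_union_le _ _)
  intro p
  simp only [Finset.mem_filter, Finset.mem_univ, true_and, Finset.mem_union]
  tauto

theorem outDeg_exists_le {ι : Type*} (s : Finset ι) (r : ι → V → V → Prop) (x : V) :
    outDeg (fun x y => ∃ e ∈ s, r e x y) x ≤ ∑ e ∈ s, outDeg (r e) x := by
  classical
  unfold outDeg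
  refine le_trans (Finset.card_le_card ?_) Finset.card_biUnion_le
  intro p
  simp

theorem outDeg_or_le (r s : V → V → Prop) (x : V) :
    outDeg (fun x y => r x y ∨ s x y) x ≤ outDeg r x + outDeg s x := by
  classical
  unfold outDeg
  refine le_trans (Finset.card_le_card ?_) (Finset.card_union_le _ _)
  intro p
  simp

/-- Degrees multiply under composition. -/
theorem outDeg_comp_le {r s : V → V → Prop} {a b : ℕ} (x : V) (hr : outDeg r x ≤ a)
    (hs : ∀ z, outDeg s z ≤ b) : outDeg (fun x y => ∃ z, r x z ∧ s z y) x ≤ a * b := by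
  classical
  unfold outDeg at *
  calc _ ≤ ((Finset.univ.filter fun z => r x z).biUnion
        fun z => Finset.univ.filter fun y => s z y).card := by
        refine Finset.card_le_card fun y => ?_
        simp
    _ ≤ (Finset.univ.filter fun z => r x z).card * b :=
        Finset.card_biUnion_le_card_mul _ _ _ fun z _ => hs z
    _ ≤ a * b := Nat.mul_le_mul_right _ hr

/-- A separated pair of a composition passes through a separated pair of one of the factors. -/
theorem sepCount_comp_le {r s : V → V → Prop} {a b : ℕ} (hr : ∀ z, outDeg (flip r) z ≤ a)
    (hs : ∀ z, outDeg s z ≤ b) :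
    sepCount A (fun x y => ∃ z, r x z ∧ s z y) ≤ b * sepCount A r + a * sepCount A s := by
  classical
  unfold sepCount outDeg at *
  set R := Finset.univ.filter fun p : V × V => r p.1 p.2 ∧ ¬ (p.1 ∈ A ↔ p.2 ∈ A)
  set S := Finset.univ.filter fun p : V × V => s p.1 p.2 ∧ ¬ (p.1 ∈ A ↔ p.2 ∈ A)
  calc _ ≤ ((R.biUnion fun p => (Finset.univ.filter fun y => s p.2 y).image fun y => (p.1, y)) ∪
        (S.biUnion fun p => (Finset.univ.filter fun x => flip r p.1 x).image
          fun x => (x, p.2))).card := by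
        refine Finset.card_le_card ?_
        rintro ⟨x, y⟩
        simp only [Finset.mem_filter, Finset.mem_univ, true_and, Finset.mem_union,
          Finset.mem_biUnion, Finset.mem_image, Prod.mk.injEq, Prod.exists, R, S]
        rintro ⟨⟨z, h1, h2⟩, h3⟩
        by_cases hz : x ∈ A ↔ z ∈ A
        · exact Or.inr ⟨z, y, ⟨h2, by rwa [← hz]⟩, x, h1, rfl, rfl⟩
        · exact Or.inl ⟨x, z, ⟨h1, hz⟩, y, h2, rfl, rfl⟩
    _ ≤ _ := by
        refine le_trans (Finset.card_union_le _ _) (add_le_add ?_ ?_)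
        · rw [mul_comm]
          exact Finset.card_biUnion_le_card_mul _ _ _ fun p _ =>
            Finset.card_image_le.trans (hs _)
        · rw [mul_comm]
          exact Finset.card_biUnion_le_card_mul _ _ _ fun p _ =>
            Finset.card_image_le.trans (hr _)

end SeparatedPairs

/-! ### Volume and boundary counts on the lattice -/

namespace LatticePatch

variable {D m : ℕ} {Λ : LatticePatch D m}

theorem axisDist_comm (p : Bool) {L : ℕ} (a b : Fin L) : axisDist p a b = axisDist p b a := by
  unfold axisDist; rw [Nat.dist_comm]

theorem axisDist_eq_zero (p : Bool) {L : ℕ} {a b : Fin L} (h : axisDist p a b = 0) : a = b := by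
  have := a.2; have := b.2
  unfold axisDist Nat.dist at h
  ext
  split at h <;> omega

theorem axisDist_self (p : Bool) {L : ℕ} (a : Fin L) : axisDist p a a = 0 := by
  simp [axisDist]

theorem gridDist_comm (x y : Λ.Site) : Λ.gridDist x y = Λ.gridDist y x := by
  unfold gridDist
  simp_rw [axisDist_comm, eq_comm]

theorem eq_of_gridDist_eq_zero {x y : Λ.Site} (h : Λ.gridDist x y = 0) : x = y := by
  unfold gridDist at h
  rw [Nat.add_eq_zero_iff, Finset.sum_eq_zero_iff] at h
  refine Prod.ext (funext fun k => axisDist_eq_zero _ (h.1 k (Finset.mem_univ _))) ?_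
  by_contra h'
  simp [h'] at h

/-- The factor `2` is for orientation: the area lists a bond only as a pair leading from `A` to its
complement. -/
theorem sepCount_le_of_gridDist_le_one {A : Finset Λ.Site} {r : Λ.Site → Λ.Site → Prop}
    (hr : ∀ x y, r x y → Λ.gridDist x y ≤ 1) : sepCount A r ≤ 2 * Λ.boundaryArea A := by
  classical
  unfold sepCount boundaryArea
  set S := (A ×ˢ Aᶜ).filter fun p => Λ.gridDist p.1 p.2 = 1
  calc _ ≤ (S ∪ S.image Prod.swap).card := by
        refine Finset.card_le_card ?_
        rintro ⟨x, y⟩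
        simp only [Finset.mem_filter, Finset.mem_univ, true_and, Finset.mem_union, S,
          Finset.mem_image, Finset.mem_product, Finset.mem_compl, Prod.exists, Prod.swap_prod_mk,
          Prod.mk.injEq]
        rintro ⟨h1, h2⟩
        have h3 : Λ.gridDist x y = 1 := by
          have := hr _ _ h1
          have h0 : Λ.gridDist x y ≠ 0 := fun h => h2 (by rw [eq_of_gridDist_eq_zero h])
          omega
        by_cases hx : x ∈ A
        · exact Or.inl ⟨⟨hx, by tauto⟩, h3⟩
        · exact Or.inr ⟨y, x, ⟨⟨by tauto, hx⟩, by rw [gridDist_comm, h3]⟩, rfl, rfl⟩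
    _ ≤ S.card + S.card := (Finset.card_union_le _ _).trans
        (add_le_add le_rfl Finset.card_image_le)
    _ = _ := by ring

/-- `y` is the translate of `x` by `e` steps in the positive direction of axis `k`. -/
def Shift (k : Fin D) (e : ℕ) (x y : Λ.Site) : Prop :=
  y.2 = x.2 ∧ (∀ j, j ≠ k → y.1 j = x.1 j) ∧
    if Λ.periodic k then (y.1 k : ℕ) = (x.1 k + e) % Λ.size k else (y.1 k : ℕ) = x.1 k + e

theorem Shift.right_unique {k : Fin D} {e : ℕ} {x y y' : Λ.Site} (h : Shift k e x y)
    (h' : Shift k e x y') : y = y' := by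
  obtain ⟨h1, h2, h3⟩ := h
  obtain ⟨h1', h2', h3'⟩ := h'
  refine Prod.ext (funext fun j => ?_) (h1.trans h1'.symm)
  by_cases hj : j = k
  · subst hj
    ext
    split_ifs at h3 h3' <;> omega
  · rw [h2 j hj, h2' j hj]

theorem Shift.left_unique {k : Fin D} {e : ℕ} {x x' y : Λ.Site} (h : Shift k e x y)
    (h' : Shift k e x' y) : x = x' := by
  obtain ⟨h1, h2, h3⟩ := h
  obtain ⟨h1', h2', h3'⟩ := h'
  refine Prod.ext (funext fun j => ?_) (h1.symm.trans h1')
  by_cases hj : j = k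
  · subst hj
    ext
    have hx := (x.1 j).2
    have hx' := (x'.1 j).2
    split_ifs at h3 h3'
    · have : (x.1 j + e : ℕ) ≡ x'.1 j + e [MOD Λ.size j] := by
        unfold Nat.ModEq; omega
      have := Nat.ModEq.add_right_cancel' e this
      exact Nat.ModEq.eq_of_lt_of_lt this hx hx'
    · omega
  · rw [← h2 j hj, ← h2' j hj]

theorem outDeg_shift_le (k : Fin D) (e : ℕ) (x : Λ.Site) : outDeg (Shift k e) x ≤ 1 := by
  classical
  refine Finset.card_le_one.2 fun y hy y' hy' => ?_
  simp only [Finset.mem_filter, Finset.mem_univ, true_and] at hy hy'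
  exact hy.right_unique hy'

theorem outDeg_flip_shift_le (k : Fin D) (e : ℕ) (x : Λ.Site) :
    outDeg (flip (Shift k e)) x ≤ 1 := by
  classical
  refine Finset.card_le_one.2 fun y hy y' hy' => ?_
  simp only [Finset.mem_filter, Finset.mem_univ, true_and] at hy hy'
  exact Shift.left_unique hy hy'

theorem Shift.exists_mid {k : Fin D} {e : ℕ} {x y : Λ.Site} (h : Shift k (e + 1) x y) :
    ∃ z, Shift k e x z ∧ Shift k 1 z y := by
  obtain ⟨h1, h2, h3⟩ := h
  have hL : 0 < Λ.size k := (Nat.zero_le _).trans_lt (x.1 k).2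
  have hy := (y.1 k).2
  by_cases hp : Λ.periodic k
  · rw [if_pos hp] at h3
    refine ⟨(Function.update x.1 k ⟨(x.1 k + e) % Λ.size k, Nat.mod_lt _ hL⟩, x.2),
      ⟨rfl, fun j hj => ?_, ?_⟩, ⟨h1, fun j hj => ?_, ?_⟩⟩
    · simp [hj]
    · simp [hp]
    · simp [hj, h2 j hj]
    · rw [if_pos hp, h3]
      simp [add_assoc]
  · rw [if_neg hp] at h3
    refine ⟨(Function.update x.1 k ⟨x.1 k + e, by omega⟩, x.2),
      ⟨rfl, fun j hj => ?_, ?_⟩, ⟨h1, fun j hj => ?_, ?_⟩⟩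
    · simp [hj]
    · simp [hp]
    · simp [hj, h2 j hj]
    · rw [if_neg hp, h3]
      simp [add_assoc]

theorem Shift.gridDist_le_one {k : Fin D} {x y : Λ.Site} (h : Shift k 1 x y) :
    Λ.gridDist x y ≤ 1 := by
  obtain ⟨h1, h2, h3⟩ := h
  unfold gridDist
  rw [if_pos h1.symm, add_zero, Finset.sum_eq_single_of_mem k (Finset.mem_univ _)]
  · have hx := (x.1 k).2
    have hy := (y.1 k).2
    unfold axisDist Nat.dist
    split_ifs at h3 ⊢
    -- In the wrap-around case `x` has the last coordinate and `y` has coordinate `0`, at cyclic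
    -- distance at most `1`.
    · rcases Nat.lt_or_ge (x.1 k + 1) (Λ.size k) with hlt | hge
      · rw [Nat.mod_eq_of_lt hlt] at h3
        omega
      · have : (x.1 k : ℕ) + 1 = Λ.size k := by omega
        rw [this, Nat.mod_self] at h3
        omega
    · omega
  · intro j _ hj
    rw [h2 j hj, axisDist_self]

/-- A shift is an injective partial map, so all degrees in `sepCount_comp_le` are `1`, and each
further unit step adds at most the separated pairs of a single unit shift. The growth in `e` is
therefore linear. -/
theorem sepCount_shift_le (A : Finset Λ.Site) (k : Fin D) (e : ℕ) :
    sepCount A (Shift k e) ≤ e * (2 * Λ.boundaryArea A) := by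
  induction e with
  | zero =>
    refine le_of_eq ?_
    rw [zero_mul]
    refine sepCount_eq_zero fun x y h => ?_
    obtain ⟨h1, h2, h3⟩ := h
    refine Prod.ext (funext fun j => ?_) h1.symm
    by_cases hj : j = k
    · subst hj
      ext
      have := Nat.mod_eq_of_lt (x.1 j).2
      simp only [add_zero, this, ite_self] at h3
      exact h3.symm
    · exact (h2 j hj).symm
  | succ e ih =>
    calc sepCount A (Shift k (e + 1))
        ≤ sepCount A (fun x y => ∃ z, Shift k e x z ∧ Shift k 1 z y) :=
          sepCount_mono fun _ _ h => h.exists_mid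
      _ ≤ 1 * sepCount A (Shift k e) + 1 * sepCount A (Shift k 1) :=
          sepCount_comp_le (outDeg_flip_shift_le k e) (outDeg_shift_le k 1)
      _ ≤ 1 * (e * (2 * Λ.boundaryArea A)) + 1 * (2 * Λ.boundaryArea A) := by
          gcongr
          exact sepCount_le_of_gridDist_le_one fun _ _ h => h.gridDist_le_one
      _ = _ := by ring

/-- Sites that differ only in the coordinates in `s`, by at most `n` along each axis. -/
def NearOn (s : Finset (Fin D)) (n : ℕ) (x y : Λ.Site) : Prop :=
  y.2 = x.2 ∧ (∀ j, j ∉ s → y.1 j = x.1 j) ∧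
    ∀ j ∈ s, axisDist (Λ.periodic j) (x.1 j) (y.1 j) ≤ n

theorem NearOn.symm {s : Finset (Fin D)} {n : ℕ} {x y : Λ.Site} (h : NearOn s n x y) :
    NearOn s n y x :=
  ⟨h.1.symm, fun j hj => (h.2.1 j hj).symm, fun j hj => by
    rw [axisDist_comm]; exact h.2.2 j hj⟩

/-- If the shorter arc passes through the wrap-around, it is the larger coordinate that moves
forward, by `L` minus the difference. -/
theorem exists_shift_mod {a b L n : ℕ} (ha : a < L) (hb : b < L)
    (h : min (a - b + (b - a)) (L - (a - b + (b - a))) ≤ n) :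
    ∃ e ≤ n, b = (a + e) % L ∨ a = (b + e) % L := by
  rcases le_total a b with hab | hab
  · rcases le_or_gt (b - a) n with hn | hn
    · exact ⟨b - a, hn, Or.inl (by rw [Nat.add_sub_cancel' hab, Nat.mod_eq_of_lt hb])⟩
    · refine ⟨L - (b - a), by omega, Or.inr ?_⟩
      rw [show b + (L - (b - a)) = a + L by omega, Nat.add_mod_right, Nat.mod_eq_of_lt ha]
  · rcases le_or_gt (a - b) n with hn | hn
    · exact ⟨a - b, hn, Or.inr (by rw [Nat.add_sub_cancel' hab, Nat.mod_eq_of_lt ha])⟩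
    · refine ⟨L - (a - b), by omega, Or.inl ?_⟩
      rw [show a + (L - (a - b)) = b + L by omega, Nat.add_mod_right, Nat.mod_eq_of_lt hb]

theorem NearOn.exists_shift {k : Fin D} {n : ℕ} {x y : Λ.Site} (h : NearOn {k} n x y) :
    ∃ e ∈ Finset.range (n + 1), Shift k e x y ∨ Shift k e y x := by
  obtain ⟨h1, h2, h3⟩ := h
  have h3 := h3 k (by simp)
  simp only [Finset.mem_singleton] at h2
  have hx := (x.1 k).2
  have hy := (y.1 k).2
  have key : ∃ e ≤ n, (if Λ.periodic k then (y.1 k : ℕ) = (x.1 k + e) % Λ.size k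
      else (y.1 k : ℕ) = x.1 k + e) ∨ (if Λ.periodic k then (x.1 k : ℕ) = (y.1 k + e) % Λ.size k
      else (x.1 k : ℕ) = y.1 k + e) := by
    unfold axisDist Nat.dist at h3
    by_cases hp : Λ.periodic k
    · simp only [hp, if_true] at h3 ⊢
      exact exists_shift_mod hx hy h3
    · simp only [hp] at h3 ⊢
      rcases le_total (x.1 k : ℕ) (y.1 k) with hab | hab
      · exact ⟨y.1 k - x.1 k, by simp at h3; omega, Or.inl (by simp; omega)⟩
      · exact ⟨x.1 k - y.1 k, by simp at h3; omega, Or.inr (by simp; omega)⟩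
  obtain ⟨e, he, h⟩ := key
  refine ⟨e, Finset.mem_range.2 (by omega), h.imp (fun h => ⟨h1, h2, h⟩) fun h =>
    ⟨h1.symm, fun j hj => (h2 j hj).symm, h⟩⟩

theorem outDeg_nearOn_singleton_le (k : Fin D) (n : ℕ) (x : Λ.Site) :
    outDeg (NearOn {k} n) x ≤ 2 * n + 2 := by
  calc outDeg (NearOn {k} n) x
      ≤ outDeg (fun x y => ∃ e ∈ Finset.range (n + 1), Shift k e x y ∨ flip (Shift k e) x y) x :=
        outDeg_mono x fun _ h => h.exists_shift
    _ ≤ ∑ e ∈ Finset.range (n + 1), outDeg (fun x y => Shift k e x y ∨ flip (Shift k e) x y) x :=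
        outDeg_exists_le _ _ x
    _ ≤ ∑ e ∈ Finset.range (n + 1), (1 + 1) := Finset.sum_le_sum fun e _ =>
        (outDeg_or_le _ _ x).trans
          (add_le_add (outDeg_shift_le k e x) (outDeg_flip_shift_le k e x))
    _ = 2 * n + 2 := by simp; ring

theorem sepCount_nearOn_singleton_le (A : Finset Λ.Site) (k : Fin D) (n : ℕ) :
    sepCount A (NearOn {k} n) ≤ (2 * n + 2) ^ 2 * Λ.boundaryArea A := by
  calc sepCount A (NearOn {k} n)
      ≤ sepCount A (fun x y => ∃ e ∈ Finset.range (n + 1), Shift k e x y ∨ flip (Shift k e) x y) :=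
        sepCount_mono fun _ _ h => h.exists_shift
    _ ≤ ∑ e ∈ Finset.range (n + 1), sepCount A (fun x y => Shift k e x y ∨ flip (Shift k e) x y) :=
        sepCount_exists_le _ _
    _ ≤ ∑ e ∈ Finset.range (n + 1), (4 * n * Λ.boundaryArea A) := by
        refine Finset.sum_le_sum fun e he => (sepCount_or_le _ _).trans ?_
        rw [sepCount_flip]
        have h1 := sepCount_shift_le A k e
        have h2 : e * (2 * Λ.boundaryArea A) ≤ n * (2 * Λ.boundaryArea A) :=
          Nat.mul_le_mul_right _ (by simpa [Nat.lt_succ_iff] using he)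
        calc _ ≤ n * (2 * Λ.boundaryArea A) + n * (2 * Λ.boundaryArea A) :=
              add_le_add (h1.trans h2) (h1.trans h2)
          _ = _ := by ring
    _ = (n + 1) * (4 * n) * Λ.boundaryArea A := by simp; ring
    _ ≤ _ := by gcongr; nlinarith

/-- Splits off one axis, so that bounds for a set of axes follow by induction from those for a
single axis. -/
theorem NearOn.exists_mid {k : Fin D} {s : Finset (Fin D)} (hk : k ∉ s) {n : ℕ} {x y : Λ.Site}
    (h : NearOn (insert k s) n x y) : ∃ z, NearOn {k} n x z ∧ NearOn s n z y := by
  obtain ⟨h1, h2, h3⟩ := h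
  refine ⟨(Function.update x.1 k (y.1 k), x.2), ⟨rfl, fun j hj => ?_, fun j hj => ?_⟩,
    h1, fun j hj => ?_, fun j hj => ?_⟩
  · simp only [Finset.mem_singleton] at hj
    simp [hj]
  · simp only [Finset.mem_singleton] at hj
    subst hj
    simpa using h3 j (by simp)
  · by_cases hjk : j = k
    · subst hjk; simp
    · simpa [hjk] using h2 j (by simp [hjk, hj])
  · have hjk : j ≠ k := fun h => hk (h ▸ hj)
    simpa [hjk] using h3 j (by simp [hj])

theorem outDeg_nearOn_le (s : Finset (Fin D)) (n : ℕ) (x : Λ.Site) :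
    outDeg (NearOn s n) x ≤ (2 * n + 2) ^ s.card := by
  classical
  induction s using Finset.induction_on generalizing x with
  | empty =>
    rw [Finset.card_empty, pow_zero]
    refine Finset.card_le_one.2 fun y hy y' hy' => ?_
    simp only [Finset.mem_filter, Finset.mem_univ, true_and] at hy hy'
    exact Prod.ext (funext fun j => (hy.2.1 j (by simp)).trans (hy'.2.1 j (by simp)).symm)
      (hy.1.trans hy'.1.symm)
  | insert k s hk ih =>
    rw [Finset.card_insert_of_notMem hk, pow_succ']
    exact (outDeg_mono x fun y h => h.exists_mid hk).trans
      (outDeg_comp_le x (outDeg_nearOn_singleton_le k n x) ih)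

/-- The cut is crossed along one of the axes: that axis costs `(2 * n + 2) ^ 2`, the others only
their volume factors `2 * n + 2`. Hence the exponent exceeds the number of axes by just one. -/
theorem sepCount_nearOn_le (A : Finset Λ.Site) (s : Finset (Fin D)) (n : ℕ) :
    sepCount A (NearOn s n) ≤ s.card * (2 * n + 2) ^ (s.card + 1) * Λ.boundaryArea A := by
  classical
  induction s using Finset.induction_on with
  | empty =>
    rw [Finset.card_empty, zero_mul, zero_mul]
    exact (sepCount_eq_zero fun x y h =>
      Prod.ext (funext fun j => (h.2.1 j (by simp)).symm) h.1.symm).le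
  | insert k s hk ih =>
    rw [Finset.card_insert_of_notMem hk]
    calc sepCount A (NearOn (insert k s) n)
        ≤ sepCount A (fun x y => ∃ z, NearOn {k} n x z ∧ NearOn s n z y) :=
          sepCount_mono fun _ _ h => h.exists_mid hk
      _ ≤ (2 * n + 2) ^ s.card * sepCount A (NearOn {k} n) +
          (2 * n + 2) * sepCount A (NearOn s n) :=
          sepCount_comp_le (fun z => (outDeg_mono z fun y (h : NearOn {k} n y z) => h.symm).trans
            (outDeg_nearOn_singleton_le k n z)) (outDeg_nearOn_le s n)
      _ ≤ (2 * n + 2) ^ s.card * ((2 * n + 2) ^ 2 * Λ.boundaryArea A) +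
          (2 * n + 2) * (s.card * (2 * n + 2) ^ (s.card + 1) * Λ.boundaryArea A) := by
          gcongr
          exact sepCount_nearOn_singleton_le A k n
      _ = _ := by ring

theorem exists_mid_of_gridDist_le {n : ℕ} {x y : Λ.Site} (h : Λ.gridDist x y ≤ n) :
    ∃ z, NearOn Finset.univ n x z ∧ z.1 = y.1 := by
  refine ⟨(y.1, x.2), ⟨rfl, fun j hj => absurd (Finset.mem_univ j) hj, fun j _ => ?_⟩, rfl⟩
  refine le_trans ?_ h
  unfold gridDist
  exact (Finset.single_le_sum (f := fun k => axisDist (Λ.periodic k) (x.1 k) (y.1 k))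
    (fun _ _ => Nat.zero_le _) (Finset.mem_univ j)).trans (Nat.le_add_right _ _)

theorem outDeg_sameCell_le (x : Λ.Site) : outDeg (fun x y : Λ.Site => x.1 = y.1) x ≤ m := by
  classical
  calc _ ≤ (Finset.univ.image fun p : Fin m => ((x.1, p) : Λ.Site)).card := by
        refine Finset.card_le_card fun y hy => ?_
        refine Finset.mem_image.2 ⟨y.2, Finset.mem_univ _, Prod.ext ?_ rfl⟩
        simpa using hy
    _ ≤ _ := Finset.card_image_le.trans (by simp)

/-- The number of sites within `n` steps of a given site. -/
theorem outDeg_gridDist_le (n : ℕ) (x : Λ.Site) :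
    outDeg (fun x y => Λ.gridDist x y ≤ n) x ≤ (2 * n + 2) ^ D * m := by
  refine (outDeg_mono x fun y h => exists_mid_of_gridDist_le h).trans
    (outDeg_comp_le x ?_ outDeg_sameCell_le)
  simpa using outDeg_nearOn_le (Λ := Λ) Finset.univ n x

/-- The number of pairs of sites within `n` steps of each other that are separated by `A`. -/
theorem sepCount_gridDist_le (A : Finset Λ.Site) (n : ℕ) :
    sepCount A (fun x y => Λ.gridDist x y ≤ n) ≤
      (D * m + 2) * (2 * n + 2) ^ (D + 1) * Λ.boundaryArea A := by
  calc _ ≤ sepCount A (fun x y => ∃ z, NearOn Finset.univ n x z ∧ z.1 = y.1) :=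
        sepCount_mono fun _ _ h => exists_mid_of_gridDist_le h
    _ ≤ m * sepCount A (NearOn Finset.univ n) +
        (2 * n + 2) ^ D * sepCount A (fun x y : Λ.Site => x.1 = y.1) := by
        refine sepCount_comp_le (fun z => ?_) outDeg_sameCell_le
        refine (outDeg_mono z fun y (h : NearOn _ n y z) => h.symm).trans ?_
        simpa using outDeg_nearOn_le (Λ := Λ) Finset.univ n z
    _ ≤ m * (D * (2 * n + 2) ^ (D + 1) * Λ.boundaryArea A) +
        (2 * n + 2) ^ D * (2 * Λ.boundaryArea A) := by
        gcongr
        · simpa using sepCount_nearOn_le A Finset.univ n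
        · refine sepCount_le_of_gridDist_le_one fun x y h => ?_
          unfold gridDist
          simp only [h, axisDist_self, Finset.sum_const_zero, zero_add]
          split_ifs <;> simp
    _ ≤ m * (D * (2 * n + 2) ^ (D + 1) * Λ.boundaryArea A) +
        (2 * n + 2) ^ (D + 1) * (2 * Λ.boundaryArea A) := by
        gcongr <;> omega
    _ = _ := by ring

end LatticePatch

/-! ### Trace inequalities -/

section TraceInequalities

open scoped Matrix.Norms.L2Operator
open Matrix

variable {n : Type*} [Fintype n]

/-- The Cauchy-Schwarz inequality for the Hilbert-Schmidt inner product. -/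
theorem Matrix.norm_trace_conjTranspose_mul_sq_le (X Y : Matrix n n ℂ) :
    ‖(Xᴴ * Y).trace‖ ^ 2 ≤ (∑ i, ∑ j, ‖X i j‖ ^ 2) * ∑ i, ∑ j, ‖Y i j‖ ^ 2 := by
  have h := norm_inner_le_norm (𝕜 := ℂ) (WithLp.toLp 2 fun p : n × n => X p.1 p.2)
    (WithLp.toLp 2 fun p : n × n => Y p.1 p.2)
  have h2 := pow_le_pow_left₀ (norm_nonneg _) h 2
  rw [mul_pow, EuclideanSpace.norm_sq_eq, EuclideanSpace.norm_sq_eq] at h2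
  simp only [Fintype.sum_prod_type] at h2
  refine le_trans (le_of_eq ?_) h2
  congr 2
  simp only [PiLp.inner_apply, Matrix.trace, Matrix.diag, Matrix.mul_apply,
    Fintype.sum_prod_type, Matrix.conjTranspose_apply]
  rw [Finset.sum_comm]
  simp [mul_comm]

theorem Matrix.trace_conjTranspose_mul_self_re (X : Matrix n n ℂ) :
    (Xᴴ * X).trace.re = ∑ i, ∑ j, ‖X i j‖ ^ 2 := by
  simp only [Matrix.trace, Matrix.diag, Matrix.mul_apply, Matrix.conjTranspose_apply,
    Complex.re_sum]
  rw [Finset.sum_comm]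
  refine Finset.sum_congr rfl fun i _ => Finset.sum_congr rfl fun j _ => ?_
  rw [Complex.star_def, ← Complex.normSq_eq_conj_mul_self, Complex.ofReal_re,
    Complex.normSq_eq_norm_sq]

theorem Matrix.PosSemidef.trace_re_nonneg {ρ : Matrix n n ℂ} (hρ : ρ.PosSemidef) :
    0 ≤ ρ.trace.re := (Complex.le_def.1 hρ.trace_nonneg).1

theorem Matrix.trace_mul_eq_sum (M ρ : Matrix n n ℂ) :
    (M * ρ).trace = ∑ i, ∑ j, M i j * ρ j i := by
  simp [Matrix.trace, Matrix.mul_apply]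

variable [DecidableEq n]

theorem Matrix.sum_norm_sq_mulVec_le (M : Matrix n n ℂ) (v : n → ℂ) :
    ∑ i, ‖(M *ᵥ v) i‖ ^ 2 ≤ ‖M‖ ^ 2 * ∑ i, ‖v i‖ ^ 2 := by
  have h := Matrix.l2_opNorm_mulVec M (WithLp.toLp 2 v)
  have h2 := pow_le_pow_left₀ (norm_nonneg _) h 2
  rw [mul_pow, EuclideanSpace.norm_sq_eq, EuclideanSpace.norm_sq_eq] at h2
  simpa using h2

theorem Matrix.l2_opNorm_le_of_sum_norm_sq_le {M : Matrix n n ℂ} {c : ℝ} (hc : 0 ≤ c)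
    (h : ∀ v : n → ℂ, ∑ i, ‖(M *ᵥ v) i‖ ^ 2 ≤ c ^ 2 * ∑ i, ‖v i‖ ^ 2) : ‖M‖ ≤ c := by
  rw [Matrix.cstar_norm_def]
  refine ContinuousLinearMap.opNorm_le_bound _ hc fun v => ?_
  refine le_of_sq_le_sq ?_ (by positivity)
  rw [mul_pow, EuclideanSpace.norm_sq_eq, EuclideanSpace.norm_sq_eq]
  simpa using h v

theorem Matrix.sum_norm_sq_col_le (M : Matrix n n ℂ) (j : n) :
    ∑ i, ‖M i j‖ ^ 2 ≤ ‖M‖ ^ 2 := by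
  have h := Matrix.sum_norm_sq_mulVec_le M (Pi.single j 1)
  simpa [Pi.single_apply, apply_ite] using h

theorem Matrix.sum_norm_sq_row_le (M : Matrix n n ℂ) (i : n) :
    ∑ j, ‖M i j‖ ^ 2 ≤ ‖M‖ ^ 2 := by
  have h := Matrix.sum_norm_sq_col_le Mᴴ i
  simpa [Matrix.l2_opNorm_conjTranspose] using h

theorem Matrix.PosSemidef.exists_eq_mul_conjTranspose {ρ : Matrix n n ℂ} (hρ : ρ.PosSemidef) :
    ∃ C : Matrix n n ℂ, ρ = C * Cᴴ := by
  open scoped MatrixOrder in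
  obtain ⟨B, hB⟩ := CStarAlgebra.nonneg_iff_eq_star_mul_self.1 hρ.nonneg
  exact ⟨Bᴴ, by simpa [Matrix.star_eq_conjTranspose] using hB⟩

/-- The Cauchy-Schwarz inequality for the inner product defined by a positive matrix. -/
theorem Matrix.PosSemidef.norm_trace_sq_le {ρ : Matrix n n ℂ} (hρ : ρ.PosSemidef)
    (X Y : Matrix n n ℂ) :
    ‖(Xᴴ * Y * ρ).trace‖ ^ 2 ≤ (Xᴴ * X * ρ).trace.re * (Yᴴ * Y * ρ).trace.re := by
  obtain ⟨C, rfl⟩ := hρ.exists_eq_mul_conjTranspose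
  have key : ∀ X Y : Matrix n n ℂ, (Xᴴ * Y * (C * Cᴴ)).trace = ((X * C)ᴴ * (Y * C)).trace := by
    intro X Y
    rw [Matrix.conjTranspose_mul, ← Matrix.mul_assoc, Matrix.trace_mul_comm]
    simp only [Matrix.mul_assoc]
  rw [key, key, key, Matrix.trace_conjTranspose_mul_self_re, Matrix.trace_conjTranspose_mul_self_re]
  exact Matrix.norm_trace_conjTranspose_mul_sq_le _ _

theorem Matrix.PosSemidef.trace_conjTranspose_mul_self_mul_le {ρ : Matrix n n ℂ}
    (hρ : ρ.PosSemidef) (M : Matrix n n ℂ) :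
    (Mᴴ * M * ρ).trace.re ≤ ‖M‖ ^ 2 * ρ.trace.re := by
  obtain ⟨C, rfl⟩ := hρ.exists_eq_mul_conjTranspose
  have key : (Mᴴ * M * (C * Cᴴ)).trace = ((M * C)ᴴ * (M * C)).trace := by
    rw [Matrix.conjTranspose_mul, ← Matrix.mul_assoc, Matrix.trace_mul_comm]
    simp only [Matrix.mul_assoc]
  rw [key, Matrix.trace_mul_comm C, Matrix.trace_conjTranspose_mul_self_re,
    Matrix.trace_conjTranspose_mul_self_re, Finset.sum_comm,
    Finset.sum_comm (f := fun i j => ‖C i j‖ ^ 2), Finset.mul_sum]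
  exact Finset.sum_le_sum fun j _ => Matrix.sum_norm_sq_mulVec_le M fun i => C i j

/-- A positive matrix defines a functional of norm equal to its trace. -/
theorem Matrix.PosSemidef.norm_trace_mul_le {ρ : Matrix n n ℂ} (hρ : ρ.PosSemidef)
    (M : Matrix n n ℂ) : ‖(M * ρ).trace‖ ≤ ‖M‖ * ρ.trace.re := by
  have h0 := hρ.trace_re_nonneg
  refine le_of_sq_le_sq ?_ (by positivity)
  have h := hρ.norm_trace_sq_le 1 M
  simp only [Matrix.conjTranspose_one, Matrix.one_mul] at h
  calc _ ≤ _ := h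
    _ ≤ ρ.trace.re * (‖M‖ ^ 2 * ρ.trace.re) := by
      gcongr; exact hρ.trace_conjTranspose_mul_self_mul_le M
    _ = _ := by ring

/-- The left side is the trace of `Xᴴ ρ X`, which is monotone in `ρ`; for a diagonal matrix it is an
explicit weighted sum of squared entries. This is how domination by a multiple of `ρ_A ⊗ 1` enters
the estimates. -/
theorem Matrix.PosSemidef.trace_conj_mono {ρ : Matrix n n ℂ} {s : n → ℝ}
    (h : (Matrix.diagonal (fun i => (s i : ℂ)) - ρ).PosSemidef) (X : Matrix n n ℂ) :
    (X * Xᴴ * ρ).trace.re ≤ ∑ i, ∑ j, s i * ‖X i j‖ ^ 2 := by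
  have h1 := (h.conjTranspose_mul_mul_same X).trace_re_nonneg
  rw [Matrix.mul_sub, Matrix.sub_mul, Matrix.trace_sub, Complex.sub_re, sub_nonneg] at h1
  have h2 : (Xᴴ * ρ * X).trace = (X * Xᴴ * ρ).trace := by
    rw [Matrix.trace_mul_comm, Matrix.mul_assoc]
  rw [← h2]
  refine h1.trans (le_of_eq ?_)
  rw [Matrix.trace, Complex.re_sum]
  simp only [Matrix.diag]
  simp only [Matrix.mul_apply (N := X), Matrix.mul_diagonal, Matrix.conjTranspose_apply,
    Complex.re_sum]
  rw [Finset.sum_comm]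
  refine Finset.sum_congr rfl fun i _ => Finset.sum_congr rfl fun j _ => ?_
  rw [mul_right_comm, Complex.star_def, ← Complex.normSq_eq_conj_mul_self,
    Complex.normSq_eq_norm_sq, mul_comm, ← Complex.ofReal_mul, Complex.ofReal_re]

/-- Pinching: keeping only the entries whose row and column labels agree does not increase the
norm. -/
theorem Matrix.l2_opNorm_pinching_le {β : Type*} [DecidableEq β] (a b : n → β) (M : Matrix n n ℂ) :
    ‖(Matrix.of fun i j => if a i = b j then M i j else 0 : Matrix n n ℂ)‖ ≤ ‖M‖ := by
  refine Matrix.l2_opNorm_le_of_sum_norm_sq_le (norm_nonneg _) fun v => ?_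
  -- Row `i` only sees the part of `v` on the columns with label `a i`. The parts for different
  -- labels have disjoint supports, so their squared norms add up to at most that of `v`.
  set w : β → n → ℂ := fun c j => if c = b j then v j else 0 with hw
  have h1 : ∀ i, ((Matrix.of fun i j => if a i = b j then M i j else 0 : Matrix n n ℂ) *ᵥ v) i
      = (M *ᵥ w (a i)) i := by
    intro i
    simp only [Matrix.mulVec, dotProduct, Matrix.of_apply, hw]
    refine Finset.sum_congr rfl fun j _ => ?_
    split_ifs <;> simp
  simp only [h1]
  calc ∑ i, ‖(M *ᵥ w (a i)) i‖ ^ 2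
      = ∑ c ∈ Finset.univ.image a, ∑ i ∈ Finset.univ.filter (fun i => a i = c),
          ‖(M *ᵥ w (a i)) i‖ ^ 2 :=
        (Finset.sum_fiberwise_of_maps_to (fun i _ => Finset.mem_image_of_mem a (Finset.mem_univ i))
          _).symm
    _ = ∑ c ∈ Finset.univ.image a, ∑ i ∈ Finset.univ.filter (fun i => a i = c),
          ‖(M *ᵥ w c) i‖ ^ 2 := by
        refine Finset.sum_congr rfl fun c _ => Finset.sum_congr rfl fun i hi => ?_
        rw [(Finset.mem_filter.1 hi).2]
    _ ≤ ∑ c ∈ Finset.univ.image a, ∑ i, ‖(M *ᵥ w c) i‖ ^ 2 := by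
        refine Finset.sum_le_sum fun c _ => Finset.sum_le_sum_of_subset_of_nonneg
          (Finset.filter_subset _ _) fun i _ _ => by positivity
    _ ≤ ∑ c ∈ Finset.univ.image a, ‖M‖ ^ 2 * ∑ j, ‖w c j‖ ^ 2 :=
        Finset.sum_le_sum fun c _ => Matrix.sum_norm_sq_mulVec_le M _
    _ = ‖M‖ ^ 2 * ∑ j, ∑ c ∈ Finset.univ.image a, ‖w c j‖ ^ 2 := by
        rw [← Finset.mul_sum, Finset.sum_comm]
    _ ≤ ‖M‖ ^ 2 * ∑ j, ‖v j‖ ^ 2 := by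
        gcongr with j
        have : ∀ c, ‖w c j‖ ^ 2 = if c = b j then ‖v j‖ ^ 2 else 0 := by
          intro c
          simp only [hw]
          split_ifs <;> simp
        simp only [this]
        rw [Finset.sum_ite_eq']
        split_ifs
        · exact le_rfl
        · positivity

/-! ### Commutators with the logarithm, and products with a power, of a dominating diagonal matrix
-/

theorem sum_range_mul_inv_two_pow_le (N : ℕ) : ∑ k ∈ Finset.range N, (k : ℝ) * (1 / 2) ^ k ≤ 2 := by
  have h : ∑ k ∈ Finset.range N, (k : ℝ) * (1 / 2) ^ k = 2 - 2 * (N + 1) * (1 / 2) ^ N := by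
    induction N with
    | zero => simp
    | succ N ih => rw [Finset.sum_range_succ, ih, pow_succ]; push_cast; ring
  rw [h]
  have : (0 : ℝ) ≤ 2 * (N + 1) * (1 / 2) ^ N := by positivity
  linarith

/-- The level of an eigenvalue on the logarithmic scale with steps of length `L`. -/
noncomputable def logLevel (L x : ℝ) : ℤ := ⌊-Real.log x / L⌋

theorem logLevel_bounds {L : ℝ} (hL : 0 < L) (x : ℝ) :
    0 ≤ -Real.log x - L * logLevel L x ∧ -Real.log x - L * logLevel L x ≤ L := by
  have h1 : (logLevel L x : ℝ) ≤ -Real.log x / L := Int.floor_le _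
  have h2 : -Real.log x / L < logLevel L x + 1 := Int.lt_floor_add_one _
  rw [le_div_iff₀ hL] at h1
  rw [div_lt_iff₀ hL] at h2
  constructor <;> linarith

/-- The part of `M` that raises the level by `q`, on the support of `s`. -/
noncomputable def levelPart {ι : Type*} (L : ℝ) (s : ι → ℝ) (M : Matrix ι ι ℂ) (q : ℤ) :
    Matrix ι ι ℂ :=
  Matrix.of fun i j =>
    if logLevel L (s i) - logLevel L (s j) = q ∧ s i ≠ 0 ∧ s j ≠ 0 then M i j else 0

theorem levelPart_conjTranspose {ι : Type*} (L : ℝ) (s : ι → ℝ) (M : Matrix ι ι ℂ) (q : ℤ) :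
    (levelPart L s M q)ᴴ = levelPart L s Mᴴ (-q) := by
  ext i j
  simp only [levelPart, Matrix.conjTranspose_apply, Matrix.of_apply, apply_ite star, star_zero]
  have : (logLevel L (s j) - logLevel L (s i) = q ∧ s j ≠ 0 ∧ s i ≠ 0) ↔
      (logLevel L (s i) - logLevel L (s j) = -q ∧ s i ≠ 0 ∧ s j ≠ 0) := by
    constructor <;> rintro ⟨h1, h2, h3⟩ <;> exact ⟨by omega, h3, h2⟩
  simp only [this]

/-- Write `X` for the level part. Cauchy-Schwarz bounds the squared trace by `Tr (X Xᴴ ρ)`, and the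
domination turns this into a sum of `d * s i * ‖X i j‖ ^ 2`. A rise of `k` levels forces `s i ≤ d ^
(-2 * (k - 1)) * s j`, and the weights `s j` sum to at most `d`; the result is `d ^ (4 - 2 * k) *
‖M‖ ^ 2`. This is effective for `k ≥ 2`; for `k = 1` the norm of `X` is enough. -/
theorem norm_trace_levelPart_mul_le {d : ℝ} (hd : 2 ≤ d) {s : n → ℝ} (hs : ∀ i, 0 ≤ s i)
    (hsum : ∑ i, s i ≤ d) {ρ : Matrix n n ℂ} (hρ : ρ.PosSemidef) (htr : ρ.trace.re = 1)
    (hle : (Matrix.diagonal (fun i => ((d * s i : ℝ) : ℂ)) - ρ).PosSemidef) (M : Matrix n n ℂ)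
    (k : ℕ) (hk : 1 ≤ k) :
    ‖(levelPart (2 * Real.log d) s M k * ρ).trace‖ ≤ 4 * (1 / 2) ^ k * ‖M‖ := by
  set L := 2 * Real.log d with hLdef
  have hlog : 0 < Real.log d := Real.log_pos (by linarith)
  have hL : 0 < L := by positivity
  have hM := norm_nonneg M
  rcases hk.eq_or_lt with rfl | hk
  · have h1 : ‖levelPart L s M (1 : ℕ)‖ ≤ ‖M‖ := by
      -- The flags `1` and `2` differ, so second components agree only if `s i` and `s j` are both
      -- nonzero; the support condition thus becomes part of the pinching.
      refine le_trans (le_of_eq ?_) (Matrix.l2_opNorm_pinching_le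
        (fun i => (logLevel L (s i), if s i = 0 then 1 else 0))
        (fun j => (logLevel L (s j) + 1, if s j = 0 then 2 else 0)) M)
      congr 1
      ext i j
      simp only [levelPart, Matrix.of_apply, Prod.mk.injEq]
      refine if_congr ?_ rfl rfl
      by_cases hi : s i = 0 <;> by_cases hj : s j = 0 <;> simp [hi, hj]
      omega
    have h2 := hρ.norm_trace_mul_le (levelPart L s M (1 : ℕ))
    rw [htr, mul_one] at h2
    calc _ ≤ ‖M‖ := h2.trans h1
      _ ≤ _ := by linarith
  · set X := levelPart L s M k with hX
    have hcs := hρ.norm_trace_sq_le Xᴴ 1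
    simp only [Matrix.conjTranspose_conjTranspose, Matrix.mul_one, Matrix.conjTranspose_one,
      Matrix.one_mul, htr] at hcs
    have hdec : ∀ i j, d * s i * ‖X i j‖ ^ 2 ≤
        d * (Real.exp (-(L * (k - 1))) * s j) * ‖M i j‖ ^ 2 := by
      intro i j
      simp only [hX, levelPart, Matrix.of_apply]
      split_ifs with h
      · obtain ⟨h1, h2, h3⟩ := h
        have hi := (hs i).lt_of_ne' h2
        have hj := (hs j).lt_of_ne' h3
        have hlev : (logLevel L (s i) : ℝ) - logLevel L (s j) = k := by exact_mod_cast h1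
        -- The two roundings together cost at most one level, hence `k - 1`.
        have bi := (logLevel_bounds hL (s i)).1
        have bj := (logLevel_bounds hL (s j)).2
        have : s i ≤ Real.exp (-(L * (k - 1))) * s j := by
          rw [← Real.log_le_log_iff hi (by positivity), Real.log_mul (Real.exp_pos _).ne' h3,
            Real.log_exp, ← hlev]
          linarith
        gcongr
      · have := hs j
        rw [norm_zero, sq, mul_zero, mul_zero]
        positivity
    have hfar : (X * Xᴴ * ρ).trace.re ≤ d ^ 2 * Real.exp (-(L * (k - 1))) * ‖M‖ ^ 2 := by
      calc (X * Xᴴ * ρ).trace.re ≤ ∑ i, ∑ j, d * s i * ‖X i j‖ ^ 2 :=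
            Matrix.PosSemidef.trace_conj_mono hle X
        _ ≤ ∑ i, ∑ j, d * (Real.exp (-(L * (k - 1))) * s j) * ‖M i j‖ ^ 2 :=
            Finset.sum_le_sum fun i _ => Finset.sum_le_sum fun j _ => hdec i j
        _ = d * Real.exp (-(L * (k - 1))) * ∑ j, s j * ∑ i, ‖M i j‖ ^ 2 := by
            rw [Finset.sum_comm]
            simp only [Finset.mul_sum]
            refine Finset.sum_congr rfl fun i _ => Finset.sum_congr rfl fun j _ => by ring
        _ ≤ d * Real.exp (-(L * (k - 1))) * ∑ j, s j * ‖M‖ ^ 2 := by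
            gcongr with j
            · exact hs j
            · exact Matrix.sum_norm_sq_col_le M j
        _ ≤ d * Real.exp (-(L * (k - 1))) * (d * ‖M‖ ^ 2) := by
            rw [← Finset.sum_mul]
            gcongr
        _ = _ := by ring
    have hexp : d ^ 2 * Real.exp (-(L * (k - 1))) ≤ (4 * (1 / 2) ^ k) ^ 2 := by
      obtain ⟨j, rfl⟩ : ∃ j, k = j + 2 := ⟨k - 2, by omega⟩
      have hd2 : d ^ 2 = Real.exp L := by
        rw [hLdef, two_mul, Real.exp_add, Real.exp_log (by linarith), sq]
      have : d ^ 2 * Real.exp (-(L * ((j + 2 : ℕ) - 1))) = ((d ^ 2) ^ j)⁻¹ := by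
        rw [hd2, ← Real.exp_add, ← Real.exp_nat_mul, ← Real.exp_neg]
        congr 1
        push_cast
        ring
      rw [this]
      have h4 : ((4 : ℝ) * (1 / 2) ^ (j + 2)) ^ 2 = (4 ^ j)⁻¹ := by
        rw [pow_add, mul_pow, mul_pow, ← pow_mul, mul_comm j 2, pow_mul, ← inv_pow]
        norm_num
        ring
      rw [h4]
      have : (4 : ℝ) ≤ d ^ 2 := by nlinarith
      gcongr
    refine le_of_sq_le_sq ?_ (by positivity)
    rw [mul_pow]
    calc _ ≤ _ := hcs
      _ ≤ _ := by
        rw [mul_one]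
        exact hfar.trans (by gcongr)

/-- The diagonal entry is squeezed to `0`. Writing the matrix as `C * Cᴴ`, this entry is the squared
norm of row `i` of `C`, so the row vanishes. -/
theorem Matrix.PosSemidef.apply_eq_zero_of_le_diagonal {ρ : Matrix n n ℂ} {s : n → ℝ}
    (hρ : ρ.PosSemidef) (h : (Matrix.diagonal (fun i => (s i : ℂ)) - ρ).PosSemidef) {i : n}
    (hi : s i = 0) (j : n) : ρ i j = 0 := by
  have h1 : 0 ≤ -ρ i i := by simpa [hi] using h.diag_nonneg (i := i)
  have h2 : ρ i i = 0 := le_antisymm (by simpa using h1) hρ.diag_nonneg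
  obtain ⟨C, rfl⟩ := hρ.exists_eq_mul_conjTranspose
  have h3 : ∑ l, ‖C i l‖ ^ 2 = 0 := by
    have := congrArg Complex.re h2
    simp only [Matrix.mul_apply, Matrix.conjTranspose_apply, Complex.re_sum, Complex.star_def,
      Complex.mul_conj, Complex.ofReal_re, Complex.normSq_eq_norm_sq, Complex.zero_re] at this
    exact this
  rw [Finset.sum_eq_zero_iff_of_nonneg fun _ _ => by positivity] at h3
  rw [Matrix.mul_apply]
  refine Finset.sum_eq_zero fun l hl => ?_
  have := h3 l hl
  simp only [ne_eq, OfNat.ofNat_ne_zero, not_false_eq_true, pow_eq_zero_iff, norm_eq_zero] at this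
  simp [this]

/-- The commutator of a positive matrix with the logarithm of a matrix that dominates it. -/
theorem norm_sum_log_sub_log_le {d : ℝ} (hd : 2 ≤ d) {s : n → ℝ} (hs : ∀ i, 0 ≤ s i)
    (hsum : ∑ i, s i ≤ d) {ρ : Matrix n n ℂ} (hρ : ρ.PosSemidef) (htr : ρ.trace.re = 1)
    (hle : (Matrix.diagonal (fun i => ((d * s i : ℝ) : ℂ)) - ρ).PosSemidef) (M : Matrix n n ℂ) :
    ‖∑ i, ∑ j, ((Real.log (s i) - Real.log (s j) : ℝ) : ℂ) * (M i j * ρ j i)‖ ≤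
      36 * ‖M‖ * Real.log d := by
  set L := 2 * Real.log d with hLdef
  have hlog : 0 < Real.log d := Real.log_pos (by linarith)
  have hL : 0 < L := by positivity
  have hM := norm_nonneg M
  -- The rounding error of the logarithm, with values in `[-L, 0]`: `log s` is `e` minus `L` times
  -- the level. The part `e` can be bounded crudely by its norm.
  set e : n → ℝ := fun i => Real.log (s i) + L * logLevel L (s i) with he
  have he1 : ‖(Matrix.diagonal (fun i => (e i : ℂ)) : Matrix n n ℂ)‖ ≤ L := by
    rw [Matrix.l2_opNorm_diagonal, pi_norm_le_iff_of_nonneg hL.le]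
    intro i
    have := logLevel_bounds hL (s i)
    rw [Complex.norm_real, Real.norm_eq_abs, abs_le]
    constructor <;> simp only [he] <;> linarith
  obtain ⟨N, hN⟩ : ∃ N : ℕ, ∀ i j, (logLevel L (s i) - logLevel L (s j)).natAbs < N := by
    obtain ⟨N, hN⟩ := (Set.finite_range fun p : n × n =>
      (logLevel L (s p.1) - logLevel L (s p.2)).natAbs).bddAbove
    exact ⟨N + 1, fun i j => Nat.lt_succ_of_le (hN ⟨(i, j), rfl⟩)⟩
  have hzero : ∀ i j, s i = 0 ∨ s j = 0 → ρ j i = 0 := by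
    rintro i j (h | h)
    · rw [← hρ.1.apply, hρ.apply_eq_zero_of_le_diagonal hle (by simp [h]), star_zero]
    · exact hρ.apply_eq_zero_of_le_diagonal hle (by simp [h]) i
  -- A level difference `q` is seen only by `k = |q|`, in the raising or the lowering part according
  -- to its sign. Pairs outside the support of `s` drop out because `ρ` vanishes there.
  have hlev : ∀ i j, ((logLevel L (s i) - logLevel L (s j) : ℤ) : ℂ) * (M i j * ρ j i) =
      ∑ k ∈ Finset.range N, (k : ℂ) * (levelPart L s M k i j * ρ j i -
        levelPart L s M (-k) i j * ρ j i) := by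
    intro i j
    by_cases h0 : s i = 0 ∨ s j = 0
    · simp [hzero i j h0]
    push Not at h0
    simp only [levelPart, Matrix.of_apply, h0.1, h0.2, ne_eq, not_false_eq_true, and_true]
    have hlt := hN i j
    generalize logLevel L (s i) - logLevel L (s j) = q at hlt
    rw [Finset.sum_eq_single_of_mem q.natAbs (Finset.mem_range.2 hlt)]
    · rcases Int.natAbs_eq q with h | h
      · rcases eq_or_ne q 0 with rfl | hq
        · simp
        · have h' : ¬ q = -(q.natAbs : ℤ) := by omega
          rw [if_pos h, if_neg h', zero_mul, sub_zero]
          congr 1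
          have : ((q.natAbs : ℤ) : ℂ) = (q : ℂ) := by rw [← h]
          rw [← this, Int.cast_natCast]
      · rcases eq_or_ne q 0 with rfl | hq
        · simp
        · have h' : ¬ q = (q.natAbs : ℤ) := by omega
          rw [if_neg h', if_pos h, zero_mul, zero_sub, mul_neg, ← neg_mul]
          congr 1
          have : ((-(q.natAbs : ℤ) : ℤ) : ℂ) = (q : ℂ) := by rw [← h]
          rw [← this, Int.cast_neg, Int.cast_natCast]
    · intro k _ hk
      rw [if_neg (by omega), if_neg (by omega)]
      simp
  have hsplit : ∑ i, ∑ j, ((Real.log (s i) - Real.log (s j) : ℝ) : ℂ) * (M i j * ρ j i) =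
      (Matrix.diagonal (fun i => (e i : ℂ)) * M * ρ).trace -
      (M * Matrix.diagonal (fun i => (e i : ℂ)) * ρ).trace -
      (L : ℂ) * ∑ k ∈ Finset.range N, (k : ℂ) * ((levelPart L s M k * ρ).trace -
        (levelPart L s M (-k) * ρ).trace) := by
    have h3 : ∑ k ∈ Finset.range N, (k : ℂ) * ((levelPart L s M k * ρ).trace -
        (levelPart L s M (-k) * ρ).trace) =
        ∑ i, ∑ j, ((logLevel L (s i) - logLevel L (s j) : ℤ) : ℂ) * (M i j * ρ j i) := by
      simp only [hlev, Matrix.trace_mul_eq_sum, ← Finset.sum_sub_distrib, Finset.mul_sum]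
      rw [Finset.sum_comm]
      refine Finset.sum_congr rfl fun i _ => ?_
      rw [Finset.sum_comm]
    rw [h3, Matrix.trace_mul_eq_sum, Matrix.trace_mul_eq_sum, Finset.mul_sum,
      ← Finset.sum_sub_distrib, ← Finset.sum_sub_distrib]
    refine Finset.sum_congr rfl fun i _ => ?_
    rw [Finset.mul_sum, ← Finset.sum_sub_distrib, ← Finset.sum_sub_distrib]
    refine Finset.sum_congr rfl fun j _ => ?_
    rw [Matrix.diagonal_mul, Matrix.mul_diagonal]
    simp only [he]
    push_cast
    ring
  rw [hsplit]
  have t1 : ‖(Matrix.diagonal (fun i => (e i : ℂ)) * M * ρ).trace‖ ≤ L * ‖M‖ := by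
    refine (hρ.norm_trace_mul_le _).trans ?_
    rw [htr, mul_one]
    exact (Matrix.l2_opNorm_mul _ _).trans (by gcongr)
  have t2 : ‖(M * Matrix.diagonal (fun i => (e i : ℂ)) * ρ).trace‖ ≤ L * ‖M‖ := by
    refine (hρ.norm_trace_mul_le _).trans ?_
    rw [htr, mul_one, mul_comm L]
    exact (Matrix.l2_opNorm_mul _ _).trans (by gcongr)
  have t3 : ‖∑ k ∈ Finset.range N, (k : ℂ) * ((levelPart L s M k * ρ).trace -
        (levelPart L s M (-k) * ρ).trace)‖ ≤ 16 * ‖M‖ := by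
    calc _ ≤ ∑ k ∈ Finset.range N, (8 * ‖M‖) * ((k : ℝ) * (1 / 2) ^ k) := by
          refine norm_sum_le_of_le _ fun k _ => ?_
          rcases Nat.eq_zero_or_pos k with rfl | hk
          · simp
          have b1 := norm_trace_levelPart_mul_le hd hs hsum hρ htr hle M k hk
          -- Lowering parts of `M` are adjoints of raising parts of `Mᴴ`.
          have b2 : ‖(levelPart L s M (-k) * ρ).trace‖ ≤ 4 * (1 / 2) ^ k * ‖M‖ := by
            have b := norm_trace_levelPart_mul_le hd hs hsum hρ htr hle Mᴴ k hk
            rw [Matrix.l2_opNorm_conjTranspose] at b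
            refine le_trans (le_of_eq ?_) b
            rw [← norm_star, ← Matrix.trace_conjTranspose, Matrix.conjTranspose_mul,
              levelPart_conjTranspose, neg_neg, hρ.1.eq, Matrix.trace_mul_comm]
          rw [norm_mul, Complex.norm_natCast]
          calc _ ≤ (k : ℝ) * (4 * (1 / 2) ^ k * ‖M‖ + 4 * (1 / 2) ^ k * ‖M‖) := by
                gcongr
                exact (norm_sub_le _ _).trans (add_le_add b1 b2)
            _ = _ := by ring
      _ ≤ 8 * ‖M‖ * 2 := by
          rw [← Finset.mul_sum]
          gcongr
          exact sum_range_mul_inv_two_pow_le N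
      _ = _ := by ring
  -- Two rounding terms and the sum over levels: `18 * L`, which is `36 * log d`.
  calc _ ≤ L * ‖M‖ + L * ‖M‖ + L * (16 * ‖M‖) := by
        refine (norm_sub_le _ _).trans (add_le_add ((norm_sub_le _ _).trans (add_le_add t1 t2)) ?_)
        rw [norm_mul, Complex.norm_real, Real.norm_of_nonneg hL.le]
        gcongr
    _ = _ := by rw [hLdef]; ring

/-- Young's inequality with exponents `α` and `α / (α - 1)`; it separates row weights from column
weights. -/
theorem mul_rpow_sub_one_le {α x y : ℝ} (hα : 1 < α) (hx : 0 ≤ x) (hy : 0 ≤ y) :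
    x * y ^ (α - 1) ≤ 1 / α * x ^ α + (1 - 1 / α) * y ^ α := by
  have h0 : 0 < α := by linarith
  have h1 : 1 / α ≤ 1 := by rw [div_le_one h0]; exact hα.le
  have h := Real.geom_mean_le_arith_mean2_weighted (w₁ := 1 / α) (w₂ := 1 - 1 / α)
    (by positivity) (by linarith) (Real.rpow_nonneg hx α) (Real.rpow_nonneg hy α) (by ring)
  rw [← Real.rpow_mul hx, ← Real.rpow_mul hy, mul_one_div_cancel h0.ne', Real.rpow_one] at h
  convert h using 3
  field_simp

/-- Powers of a matrix that dominates a positive matrix. -/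
theorem norm_sum_rpow_mul_le {α d T : ℝ} (hα : 1 < α) (hd : 0 ≤ d) (hT : 0 ≤ T) {s : n → ℝ}
    (hs : ∀ i, 0 ≤ s i) {ρ : Matrix n n ℂ} (hρ : ρ.PosSemidef)
    (hle : (Matrix.diagonal (fun i => ((d * s i : ℝ) : ℂ)) - ρ).PosSemidef)
    (hsum : ∑ i, s i ^ α ≤ d * T) (hT' : ∑ i, s i ^ (α - 1) * (ρ i i).re ≤ T) (M : Matrix n n ℂ) :
    ‖∑ i, ∑ j, ((s i ^ (α - 1) : ℝ) : ℂ) * (M i j * ρ j i)‖ ≤ d * T * ‖M‖ := by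
  have hα0 : 0 < α := by linarith
  -- The weight is split as a square, so that Cauchy-Schwarz leaves `Tr (W ^ 2 ρ) ≤ T` in one
  -- factor, while the other has a weight on either side of `M`, accessible to the domination and
  -- Young's inequality.
  set w : n → ℝ := fun i => √(s i ^ (α - 1)) with hw
  have hw2 : ∀ i, w i * w i = s i ^ (α - 1) :=
    fun i => Real.mul_self_sqrt (Real.rpow_nonneg (hs i) _)
  set W : Matrix n n ℂ := Matrix.diagonal fun i => (w i : ℂ) with hW
  have hWW : Wᴴ * W = Matrix.diagonal fun i => ((s i ^ (α - 1) : ℝ) : ℂ) := by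
    rw [hW, Matrix.diagonal_conjTranspose, Matrix.diagonal_mul_diagonal]
    congr 1
    ext i
    simp only [Pi.star_apply, Complex.star_def, Complex.conj_ofReal]
    rw [← Complex.ofReal_mul, hw2]
  have h := hρ.norm_trace_sq_le W (W * M)
  rw [← Matrix.mul_assoc, hWW] at h
  have e1 : (Matrix.diagonal (fun i => ((s i ^ (α - 1) : ℝ) : ℂ)) * M * ρ).trace =
      ∑ i, ∑ j, ((s i ^ (α - 1) : ℝ) : ℂ) * (M i j * ρ j i) := by
    rw [Matrix.trace_mul_eq_sum]
    simp only [Matrix.diagonal_mul, mul_assoc]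
  have e2 : (Matrix.diagonal (fun i => ((s i ^ (α - 1) : ℝ) : ℂ)) * ρ).trace.re =
      ∑ i, s i ^ (α - 1) * (ρ i i).re := by
    simp [Matrix.trace, Matrix.diagonal_mul]
  have e3 : ((W * M)ᴴ * (W * M) * ρ).trace.re ≤ d * (d * T) * ‖M‖ ^ 2 := by
    have := Matrix.PosSemidef.trace_conj_mono hle (W * M)ᴴ
    rw [Matrix.conjTranspose_conjTranspose] at this
    refine this.trans ?_
    calc _ = ∑ i, ∑ j, d * (s i * s j ^ (α - 1)) * ‖M j i‖ ^ 2 := by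
          refine Finset.sum_congr rfl fun i _ => Finset.sum_congr rfl fun j _ => ?_
          rw [Matrix.conjTranspose_apply, norm_star, hW, Matrix.diagonal_mul, norm_mul, mul_pow,
            Complex.norm_real, Real.norm_eq_abs, sq_abs, sq (w j), hw2]
          ring
      _ ≤ ∑ i, ∑ j, d * (1 / α * s i ^ α + (1 - 1 / α) * s j ^ α) * ‖M j i‖ ^ 2 := by
          gcongr with i _ j _
          exact mul_rpow_sub_one_le hα (hs i) (hs j)
      _ = d * (1 / α * ∑ i, s i ^ α * ∑ j, ‖M j i‖ ^ 2 +
            (1 - 1 / α) * ∑ j, s j ^ α * ∑ i, ‖M j i‖ ^ 2) := by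
          have : ∑ j, s j ^ α * ∑ i, ‖M j i‖ ^ 2 = ∑ i, ∑ j, s j ^ α * ‖M j i‖ ^ 2 := by
            simp only [Finset.mul_sum]
            rw [Finset.sum_comm]
          rw [this]
          simp only [Finset.mul_sum, ← Finset.sum_add_distrib]
          refine Finset.sum_congr rfl fun i _ => Finset.sum_congr rfl fun j _ => by ring
      _ ≤ d * (1 / α * ∑ i, s i ^ α * ‖M‖ ^ 2 + (1 - 1 / α) * ∑ j, s j ^ α * ‖M‖ ^ 2) := by
          have h1 : 1 / α ≤ 1 := by rw [div_le_one hα0]; exact hα.le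
          have h2 : 0 ≤ 1 - 1 / α := by linarith
          gcongr with i _ i _
          · exact Real.rpow_nonneg (hs i) _
          · exact Matrix.sum_norm_sq_col_le M i
          · exact Real.rpow_nonneg (hs i) _
          · exact Matrix.sum_norm_sq_row_le M i
      _ = d * (∑ i, s i ^ α) * ‖M‖ ^ 2 := by
          rw [← Finset.sum_mul]; ring
      _ ≤ _ := by gcongr
  rw [e1, e2] at h
  have hn : 0 ≤ ((W * M)ᴴ * (W * M) * ρ).trace.re := by
    have := (hρ.mul_mul_conjTranspose_same (W * M)).trace_re_nonneg
    rwa [Matrix.mul_assoc, Matrix.trace_mul_comm, Matrix.mul_assoc, Matrix.trace_mul_comm] at this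
  refine le_of_sq_le_sq ?_ (by positivity)
  calc _ ≤ _ := h
    _ ≤ T * (d * (d * T) * ‖M‖ ^ 2) := by gcongr
    _ = _ := by ring

end TraceInequalities

/-! ### Partial traces -/

section PartialTrace

open scoped Matrix.Norms.L2Operator Kronecker
open Matrix

variable {P b : Type*} [Fintype P] [Fintype b] [DecidableEq b]

/-- The partial trace over the second factor. -/
def ptr {P b : Type*} [Fintype b] (M : Matrix (P × b) (P × b) ℂ) : Matrix P P ℂ :=
  Matrix.of fun p q => ∑ β, M (p, β) (q, β)

theorem trace_ptr {P b : Type*} [Fintype P] [Fintype b] (M : Matrix (P × b) (P × b) ℂ) :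
    (ptr M).trace = M.trace := by
  simp [ptr, Matrix.trace, Fintype.sum_prod_type]

theorem ptr_sub {P b : Type*} [Fintype b] (M N : Matrix (P × b) (P × b) ℂ) :
    ptr (M - N) = ptr M - ptr N := by
  ext; simp [ptr]

theorem ptr_kronecker_one_mul (K : Matrix P P ℂ) (M : Matrix (P × b) (P × b) ℂ) :
    ptr (K ⊗ₖ (1 : Matrix b b ℂ) * M) = K * ptr M := by
  ext p q
  simp only [ptr, Matrix.of_apply, Matrix.mul_apply, Fintype.sum_prod_type,
    Matrix.kroneckerMap_apply, Matrix.one_apply, mul_ite, mul_one, mul_zero, ite_mul, zero_mul,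
    Finset.sum_ite_eq, Finset.mem_univ, if_true, Finset.mul_sum]
  rw [Finset.sum_comm]

theorem ptr_mul_kronecker_one (K : Matrix P P ℂ) (M : Matrix (P × b) (P × b) ℂ) :
    ptr (M * K ⊗ₖ (1 : Matrix b b ℂ)) = ptr M * K := by
  ext p q
  simp only [ptr, Matrix.of_apply, Matrix.mul_apply, Fintype.sum_prod_type,
    Matrix.kroneckerMap_apply, Matrix.one_apply, mul_ite, mul_one, mul_zero,
    Finset.sum_ite_eq', Finset.mem_univ, if_true, Finset.sum_mul]
  rw [Finset.sum_comm]

theorem trace_kronecker_one_mul (K : Matrix P P ℂ) (M : Matrix (P × b) (P × b) ℂ) :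
    (K ⊗ₖ (1 : Matrix b b ℂ) * M).trace = (K * ptr M).trace := by
  rw [← ptr_kronecker_one_mul, trace_ptr]

theorem Matrix.PosSemidef.ptr {P b : Type*} [Fintype b] {ρ : Matrix (P × b) (P × b) ℂ}
    (hρ : ρ.PosSemidef) :
    (ptr ρ).PosSemidef := by
  have : _root_.ptr ρ = ∑ β, ρ.submatrix (fun p => (p, β)) (fun p => (p, β)) := by
    ext p q
    simp [_root_.ptr, Matrix.sum_apply]
  rw [this]
  exact Matrix.posSemidef_sum _ fun β _ => hρ.submatrix _

variable [DecidableEq P]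

/-- A positive matrix is dominated by its partial trace times the dimension. -/
theorem Matrix.PosSemidef.card_smul_ptr_kronecker_one_sub {ρ : Matrix (P × b) (P × b) ℂ}
    (hρ : ρ.PosSemidef) :
    (((Fintype.card b : ℝ) : ℂ) • (_root_.ptr ρ ⊗ₖ (1 : Matrix b b ℂ)) - ρ).PosSemidef := by
  -- An explicit decomposition into positive matrices. `N γ` places the diagonal block of `ρ` at `γ`
  -- in all other diagonal positions. What remains is `card b` times the block diagonal part of `ρ`,
  -- minus `ρ`; this is half the sum of all `E β γ * ρ * (E β γ)ᴴ`, where `E β γ` is the difference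
  -- of two block projections.
  set N : b → Matrix (P × b) (P × b) ℂ := fun γ =>
    ρ.submatrix (fun p : P => (p, γ)) (fun p => (p, γ)) ⊗ₖ
      Matrix.diagonal (fun x => if x = γ then (0 : ℂ) else 1) with hN
  set E : b → b → Matrix (P × b) (P × b) ℂ := fun β γ => Matrix.diagonal
    fun i => (if i.2 = β then (1 : ℂ) else 0) - if i.2 = γ then (1 : ℂ) else 0 with hE
  have key : ((Fintype.card b : ℝ) : ℂ) • (_root_.ptr ρ ⊗ₖ (1 : Matrix b b ℂ)) - ρ =
      ((Fintype.card b : ℝ) : ℂ) • ∑ γ, N γ +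
        ((1 / 2 : ℝ) : ℂ) • ∑ β, ∑ γ, E β γ * ρ * (E β γ)ᴴ := by
    ext ⟨p, x⟩ ⟨q, y⟩
    have h1 : ∀ β γ, (E β γ * ρ * (E β γ)ᴴ) (p, x) (q, y) =
        ((if x = β then (1 : ℂ) else 0) - if x = γ then (1 : ℂ) else 0) *
        ((if y = β then (1 : ℂ) else 0) - if y = γ then (1 : ℂ) else 0) * ρ (p, x) (q, y) := by
      intro β γ
      simp only [hE, Matrix.diagonal_conjTranspose, Matrix.mul_diagonal, Matrix.diagonal_mul,
        Pi.star_apply, star_sub, apply_ite (star : ℂ → ℂ), star_one, star_zero]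
      ring
    have h2 : ∀ γ, N γ (p, x) (q, y) =
        if x = y then ρ (p, γ) (q, γ) - (if x = γ then ρ (p, x) (q, x) else 0) else 0 := by
      intro γ
      simp only [hN, Matrix.kroneckerMap_apply, Matrix.submatrix_apply, Matrix.diagonal_apply]
      by_cases hxy : x = y <;> by_cases hx : x = γ <;> simp [hxy, hx]
      · subst hxy; subst hx; simp
      · subst hxy; simp [hx]
    have h3 : (∑ β, ∑ γ, ((if x = β then (1 : ℂ) else 0) - if x = γ then (1 : ℂ) else 0) *
        ((if y = β then (1 : ℂ) else 0) - if y = γ then (1 : ℂ) else 0)) =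
        2 * (if x = y then (Fintype.card b : ℂ) else 0) - 2 := by
      simp only [mul_sub, Finset.sum_sub_distrib, mul_ite, mul_one, mul_zero,
        Finset.sum_ite_eq, Finset.mem_univ, if_true, Finset.sum_const,
        Finset.card_univ, smul_ite, smul_zero, nsmul_eq_mul]
      simp only [eq_comm (a := y)]
      by_cases hxy : x = y <;> simp [hxy] <;> ring
    simp only [Matrix.sub_apply, Matrix.smul_apply, Matrix.add_apply, Matrix.sum_apply, h1, h2,
      smul_eq_mul, ← Finset.sum_mul, h3, Matrix.kroneckerMap_apply, _root_.ptr, Matrix.of_apply,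
      Matrix.one_apply]
    by_cases hxy : x = y
    · subst hxy
      simp only [if_true, Finset.sum_sub_distrib, Finset.sum_ite_eq, Finset.mem_univ]
      push_cast
      ring
    · simp only [hxy, if_false, Finset.sum_const_zero]
      push_cast
      ring
  rw [key]
  refine Matrix.PosSemidef.add (Matrix.PosSemidef.smul (Matrix.posSemidef_sum _ fun γ _ => ?_) ?_)
    (Matrix.PosSemidef.smul (Matrix.posSemidef_sum _ fun β _ => Matrix.posSemidef_sum _
      fun γ _ => hρ.mul_mul_conjTranspose_same _) ?_)
  · refine (hρ.submatrix _).kronecker (Matrix.posSemidef_diagonal_iff.2 fun x => ?_)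
    split_ifs <;> simp
  · exact_mod_cast Nat.cast_nonneg (α := ℝ) (Fintype.card b)
  · rw [Complex.zero_le_real]; norm_num

theorem Matrix.IsHermitian.cfc_eq_conj {n : Type*} [Fintype n] [DecidableEq n]
    {M : Matrix n n ℂ} (hM : M.IsHermitian) (f : ℝ → ℝ) :
    _root_.cfc f M = (hM.eigenvectorUnitary : Matrix n n ℂ) *
      Matrix.diagonal (fun i => ((f (hM.eigenvalues i) : ℝ) : ℂ)) *
      (hM.eigenvectorUnitary : Matrix n n ℂ)ᴴ := by
  rw [hM.cfc_eq, Matrix.IsHermitian.cfc]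
  rfl

theorem Matrix.IsHermitian.trace_cfc {n : Type*} [Fintype n] [DecidableEq n]
    {M : Matrix n n ℂ} (hM : M.IsHermitian) (f : ℝ → ℝ) :
    (_root_.cfc f M).trace = ((∑ i, f (hM.eigenvalues i) : ℝ) : ℂ) := by
  have hU : (hM.eigenvectorUnitary : Matrix n n ℂ)ᴴ * (hM.eigenvectorUnitary : Matrix n n ℂ) = 1 :=
    Unitary.coe_star_mul_self _
  rw [hM.cfc_eq_conj, Matrix.trace_mul_comm, ← Matrix.mul_assoc, hU, Matrix.one_mul]
  simp [Matrix.trace]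

/-- In an eigenbasis of the reduced matrix `ptr ρ`. -/
theorem Matrix.PosSemidef.exists_eigenbasis_ptr {ρ : Matrix (P × b) (P × b) ℂ}
    (hρ : ρ.PosSemidef) :
    ∃ (s : P → ℝ) (V : Matrix (P × b) (P × b) ℂ), Vᴴ * V = 1 ∧ V * Vᴴ = 1 ∧ (∀ p, 0 ≤ s p) ∧
      (∀ f : ℝ → ℝ, _root_.cfc f (_root_.ptr ρ) ⊗ₖ (1 : Matrix b b ℂ) =
        V * Matrix.diagonal (fun i => ((f (s i.1) : ℝ) : ℂ)) * Vᴴ) ∧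
      (∀ f : ℝ → ℝ, (_root_.cfc f (_root_.ptr ρ)).trace = ((∑ p, f (s p) : ℝ) : ℂ)) ∧
      (∀ p, ∑ β, (Vᴴ * ρ * V) (p, β) (p, β) = s p) ∧ ∑ p, s p = ρ.trace.re ∧
      (Matrix.diagonal (fun i : P × b => ((Fintype.card b * s i.1 : ℝ) : ℂ)) -
        Vᴴ * ρ * V).PosSemidef := by
  have hσ := hρ.ptr
  set σ := _root_.ptr ρ with hσdef
  set U : Matrix P P ℂ := (hσ.1.eigenvectorUnitary : Matrix P P ℂ) with hU
  have hU1 : Uᴴ * U = 1 := Unitary.coe_star_mul_self _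
  have hU2 : U * Uᴴ = 1 := Unitary.coe_mul_star_self _
  have hspec : σ = U * Matrix.diagonal (fun i => ((hσ.1.eigenvalues i : ℝ) : ℂ)) * Uᴴ := by
    conv_lhs => rw [hσ.1.spectral_theorem]
    rfl
  set V : Matrix (P × b) (P × b) ℂ := U ⊗ₖ (1 : Matrix b b ℂ) with hV
  have hVH : Vᴴ = Uᴴ ⊗ₖ (1 : Matrix b b ℂ) := by
    rw [hV, Matrix.conjTranspose_kronecker, Matrix.conjTranspose_one]
  have hV1 : Vᴴ * V = 1 := by
    rw [hVH, hV, ← Matrix.mul_kronecker_mul, hU1, Matrix.one_mul, Matrix.one_kronecker_one]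
  have hV2 : V * Vᴴ = 1 := by
    rw [hVH, hV, ← Matrix.mul_kronecker_mul, hU2, Matrix.one_mul, Matrix.one_kronecker_one]
  have hdiag : ∀ g : P → ℂ, Matrix.diagonal g ⊗ₖ (1 : Matrix b b ℂ) =
      Matrix.diagonal fun i => g i.1 := by
    intro g
    rw [← Matrix.diagonal_one, Matrix.diagonal_kronecker_diagonal]
    simp
  have hptr : _root_.ptr (Vᴴ * ρ * V) =
      Matrix.diagonal (fun i => ((hσ.1.eigenvalues i : ℝ) : ℂ)) := by
    rw [hVH, hV, ptr_mul_kronecker_one, ptr_kronecker_one_mul, ← hσdef]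
    refine (congrArg (fun X => Uᴴ * X * U) hspec).trans ?_
    simp only [Matrix.mul_assoc, hU1, Matrix.mul_one]
    rw [← Matrix.mul_assoc, hU1, Matrix.one_mul]
  refine ⟨hσ.1.eigenvalues, V, hV1, hV2, hσ.eigenvalues_nonneg, fun f => ?_,
    fun f => hσ.1.trace_cfc f, fun p => ?_, ?_, ?_⟩
  · rw [hσ.1.cfc_eq_conj, hVH, ← hdiag (fun p => ((f (hσ.1.eigenvalues p) : ℝ) : ℂ)), hV,
      ← Matrix.mul_kronecker_mul, ← Matrix.mul_kronecker_mul,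
      Matrix.one_mul, Matrix.one_mul]
  · have := congrFun (congrFun hptr p) p
    simpa [_root_.ptr] using this
  · rw [← trace_ptr ρ, ← hσdef, hσ.1.trace_eq_sum_eigenvalues]
    simp
  · have h := (hρ.conjTranspose_mul_mul_same V).card_smul_ptr_kronecker_one_sub
    rw [hptr, hdiag] at h
    convert h using 2
    ext i j
    simp [Matrix.diagonal_apply]

theorem Matrix.l2_opNorm_le_one_of_conjTranspose_mul_self {n : Type*} [Fintype n] [DecidableEq n]
    {V : Matrix n n ℂ} (hV : Vᴴ * V = 1) : ‖V‖ ≤ 1 := by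
  have h := Matrix.l2_opNorm_conjTranspose_mul_self V
  have h1 : ‖(1 : Matrix n n ℂ)‖ ≤ 1 := by
    rw [← Matrix.diagonal_one, Matrix.l2_opNorm_diagonal]
    exact (pi_norm_le_iff_of_nonneg zero_le_one).2 fun i => by simp
  rw [hV] at h
  nlinarith [norm_nonneg V]

theorem Matrix.l2_opNorm_unitary_conj_le {n : Type*} [Fintype n] [DecidableEq n]
    {V : Matrix n n ℂ} (hV : Vᴴ * V = 1) (M : Matrix n n ℂ) : ‖Vᴴ * M * V‖ ≤ ‖M‖ := by
  have h1 := Matrix.l2_opNorm_le_one_of_conjTranspose_mul_self hV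
  have h2 : ‖Vᴴ‖ ≤ 1 := by rwa [Matrix.l2_opNorm_conjTranspose]
  calc ‖Vᴴ * M * V‖ ≤ ‖Vᴴ‖ * ‖M‖ * ‖V‖ :=
        (Matrix.l2_opNorm_mul _ _).trans (by gcongr; exact Matrix.l2_opNorm_mul _ _)
    _ ≤ 1 * ‖M‖ * 1 := by gcongr
    _ = ‖M‖ := by ring

theorem trace_conj_diagonal_mul {n : Type*} [Fintype n] [DecidableEq n]
    {V : Matrix n n ℂ} (hV : V * Vᴴ = 1) (g : n → ℂ) (M ρ : Matrix n n ℂ) :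
    (V * Matrix.diagonal g * Vᴴ * (M * ρ)).trace =
      ∑ i, ∑ j, g i * ((Vᴴ * M * V) i j * (Vᴴ * ρ * V) j i) := by
  have : (V * Matrix.diagonal g * Vᴴ * (M * ρ)).trace =
      (Matrix.diagonal g * (Vᴴ * M * V) * (Vᴴ * ρ * V)).trace := by
    calc _ = (V * (Matrix.diagonal g * (Vᴴ * M * (V * Vᴴ) * ρ))).trace := by
          rw [hV]; simp only [Matrix.mul_assoc, Matrix.one_mul]
      _ = _ := by rw [Matrix.trace_mul_comm]; simp only [Matrix.mul_assoc]
  rw [this, Matrix.trace_mul_eq_sum]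
  simp only [Matrix.diagonal_mul, mul_assoc]

theorem trace_conj_diagonal_mul' {n : Type*} [Fintype n] [DecidableEq n]
    {V : Matrix n n ℂ} (hV : V * Vᴴ = 1) (g : n → ℂ) (M ρ : Matrix n n ℂ) :
    (V * Matrix.diagonal g * Vᴴ * (ρ * M)).trace =
      ∑ i, ∑ j, g j * ((Vᴴ * M * V) i j * (Vᴴ * ρ * V) j i) := by
  rw [trace_conj_diagonal_mul hV, Finset.sum_comm]
  refine Finset.sum_congr rfl fun i _ => Finset.sum_congr rfl fun j _ => by ring

/-- The entangling rate of an interaction that acts on a factor of dimension `card b` outside of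
the subsystem. -/
theorem norm_trace_log_ptr_mul_commutator_le {ρ : Matrix (P × b) (P × b) ℂ} (hρ : ρ.PosSemidef)
    (htr : ρ.trace = 1) (M : Matrix (P × b) (P × b) ℂ) :
    ‖(cfc Real.log (ptr ρ) ⊗ₖ (1 : Matrix b b ℂ) * (M * ρ - ρ * M)).trace‖ ≤
      36 * ‖M‖ * Real.log (Fintype.card b) := by
  obtain ⟨s, V, hV1, hV2, hs, hcfc, -, hdiag, hsum, hle⟩ := hρ.exists_eigenbasis_ptr
  have hM := norm_nonneg M
  have eq1 : (cfc Real.log (ptr ρ) ⊗ₖ (1 : Matrix b b ℂ) * (M * ρ - ρ * M)).trace =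
      ∑ i, ∑ j, ((Real.log (s i.1) - Real.log (s j.1) : ℝ) : ℂ) *
        ((Vᴴ * M * V) i j * (Vᴴ * ρ * V) j i) := by
    rw [Matrix.mul_sub, Matrix.trace_sub, hcfc, trace_conj_diagonal_mul hV2,
      trace_conj_diagonal_mul' hV2, ← Finset.sum_sub_distrib]
    refine Finset.sum_congr rfl fun i _ => ?_
    rw [← Finset.sum_sub_distrib]
    refine Finset.sum_congr rfl fun j _ => ?_
    push_cast
    ring
  -- The level argument needs dimension at least `2`. In dimension `1` the dominating matrix has the
  -- same diagonal as `ρ`, so the positive difference is zero, `ρ` is diagonal in this basis and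
  -- every term vanishes.
  rcases lt_or_ge (Fintype.card b) 2 with hb | hb
  · have hsub : Subsingleton b := Fintype.card_le_one_iff_subsingleton.1 (by omega)
    have hzero : ∀ i j : P × b, ((Real.log (s i.1) - Real.log (s j.1) : ℝ) : ℂ) *
        ((Vᴴ * M * V) i j * (Vᴴ * ρ * V) j i) = 0 := by
      rintro ⟨p, β⟩ ⟨q, γ⟩
      obtain rfl := Subsingleton.elim β γ
      have hcard : Fintype.card b = 1 := by
        have : 0 < Fintype.card b := Fintype.card_pos_iff.2 ⟨β⟩
        omega
      by_cases hpq : p = q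
      · simp [hpq]
      · have hd0 : ∀ i : P × b, ((Matrix.diagonal (fun i : P × b =>
            ((Fintype.card b * s i.1 : ℝ) : ℂ)) - Vᴴ * ρ * V) i i) = 0 := by
          rintro ⟨p, β⟩
          have := hdiag p
          rw [Fintype.sum_subsingleton _ β] at this
          simp [hcard, this]
        have hz : (Matrix.diagonal (fun i : P × b =>
            ((Fintype.card b * s i.1 : ℝ) : ℂ)) - Vᴴ * ρ * V) = 0 := by
          rw [← hle.trace_eq_zero_iff, Matrix.trace]
          exact Finset.sum_eq_zero fun i _ => hd0 i
        have hz' := congrFun (congrFun hz (q, β)) (p, β)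
        have hne : ((q, β) : P × b) ≠ (p, β) := fun h => hpq (Prod.ext_iff.1 h).1.symm
        rw [Matrix.sub_apply, Matrix.diagonal_apply_ne _ hne, Matrix.zero_apply, zero_sub,
          neg_eq_zero] at hz'
        rw [hz', mul_zero, mul_zero]
    rw [eq1, Finset.sum_eq_zero fun i _ => Finset.sum_eq_zero fun j _ => hzero i j, norm_zero]
    have : 0 ≤ Real.log (Fintype.card b) := Real.log_natCast_nonneg _
    positivity
  · rw [eq1]
    have htr' : (Vᴴ * ρ * V).trace = 1 := by
      rw [Matrix.trace_mul_comm, ← Matrix.mul_assoc, hV2, Matrix.one_mul, htr]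
    have hsum' : ∑ i : P × b, s i.1 ≤ (Fintype.card b : ℝ) := by
      rw [Fintype.sum_prod_type]
      simp [← Finset.mul_sum, hsum, htr]
    have h := norm_sum_log_sub_log_le (d := (Fintype.card b : ℝ)) (by exact_mod_cast hb)
      (s := fun i : P × b => s i.1) (fun i => hs i.1) hsum' (hρ.conjTranspose_mul_mul_same V)
      (by rw [htr']; rfl) hle (Vᴴ * M * V)
    refine h.trans ?_
    have : 0 ≤ Real.log (Fintype.card b) := Real.log_natCast_nonneg _
    gcongr
    exact Matrix.l2_opNorm_unitary_conj_le hV1 M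

/-- Each eigenvalue of `ptr ρ` occurs `card b` times in `ptr ρ ⊗ 1`, which accounts for the
dimension in the bound, and the diagonal of `ρ` over an eigenvector sums to the eigenvalue, which
makes the weighted trace of `ρ` at most `Tr (ptr ρ) ^ α`. -/
theorem norm_trace_rpow_ptr_mul_le {α : ℝ} (hα : 1 < α) {ρ : Matrix (P × b) (P × b) ℂ}
    (hρ : ρ.PosSemidef) (M : Matrix (P × b) (P × b) ℂ) :
    ‖(cfc (fun x : ℝ => x ^ (α - 1)) (ptr ρ) ⊗ₖ (1 : Matrix b b ℂ) * (M * ρ)).trace‖ ≤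
      Fintype.card b * (cfc (fun x : ℝ => x ^ α) (ptr ρ)).trace.re * ‖M‖ := by
  obtain ⟨s, V, hV1, hV2, hs, hcfc, htr, hdiag, hsum, hle⟩ := hρ.exists_eigenbasis_ptr
  rw [hcfc, trace_conj_diagonal_mul hV2, htr, Complex.ofReal_re]
  have hT : 0 ≤ ∑ p, s p ^ α := Finset.sum_nonneg fun p _ => Real.rpow_nonneg (hs p) _
  refine (norm_sum_rpow_mul_le hα (Nat.cast_nonneg _) hT (s := fun i : P × b => s i.1)
    (fun i => hs i.1) (hρ.conjTranspose_mul_mul_same V) hle ?_ ?_ (Vᴴ * M * V)).trans ?_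
  · rw [Fintype.sum_prod_type]
    simp [← Finset.mul_sum]
  · rw [Fintype.sum_prod_type]
    refine Finset.sum_le_sum fun p _ => ?_
    simp only
    rw [← Finset.mul_sum]
    have := congrArg Complex.re (hdiag p)
    rw [Complex.re_sum, Complex.ofReal_re] at this
    rw [this]
    rcases (hs p).eq_or_lt with h0 | h0
    · rw [← h0, mul_zero]; exact Real.rpow_nonneg le_rfl _
    · rw [← Real.rpow_add_one h0.ne', sub_add_cancel]
  · gcongr
    exact Matrix.l2_opNorm_unitary_conj_le hV1 M

theorem norm_trace_rpow_ptr_mul_commutator_le {α : ℝ} (hα : 1 < α) {ρ : Matrix (P × b) (P × b) ℂ}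
    (hρ : ρ.PosSemidef) (M : Matrix (P × b) (P × b) ℂ) :
    ‖(cfc (fun x : ℝ => x ^ (α - 1)) (ptr ρ) ⊗ₖ (1 : Matrix b b ℂ) * (M * ρ - ρ * M)).trace‖ ≤
      2 * Fintype.card b * (cfc (fun x : ℝ => x ^ α) (ptr ρ)).trace.re * ‖M‖ := by
  rw [Matrix.mul_sub, Matrix.trace_sub]
  have h1 := norm_trace_rpow_ptr_mul_le hα hρ M
  have h2 := norm_trace_rpow_ptr_mul_le hα hρ Mᴴ
  rw [Matrix.l2_opNorm_conjTranspose] at h2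
  set F := cfc (fun x : ℝ => x ^ (α - 1)) (ptr ρ) ⊗ₖ (1 : Matrix b b ℂ) with hF
  have hFH : Fᴴ = F := by
    rw [hF, Matrix.conjTranspose_kronecker, Matrix.conjTranspose_one]
    congr 1
    exact (cfc_predicate (fun x : ℝ => x ^ (α - 1)) (ptr ρ)).star_eq
  -- The second half of the commutator is the conjugate of the first half for `Mᴴ`; `M` itself need
  -- not be Hermitian.
  have h3 : ‖(F * (ρ * M)).trace‖ = ‖(F * (Mᴴ * ρ)).trace‖ := by
    rw [← norm_star, ← Matrix.trace_conjTranspose]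
    simp only [Matrix.conjTranspose_mul, hFH, hρ.1.eq]
    rw [Matrix.trace_mul_comm]
  rw [← h3] at h2
  calc _ ≤ _ := norm_sub_le _ _
    _ ≤ _ := add_le_add h1 h2
    _ = _ := by ring

end PartialTrace

/-! ### Entangling rates of bipartite states -/

section Bipartite

open scoped Matrix.Norms.L2Operator Kronecker
open Matrix

/-- A submatrix acts by extending a vector by zero, which is isometric, applying `M`, and discarding
coordinates. -/
theorem Matrix.l2_opNorm_submatrix_injective_le {n k : Type*} [Fintype n] [DecidableEq n]
    [Fintype k] [DecidableEq k] {e : k → n} (he : Function.Injective e) (M : Matrix n n ℂ) :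
    ‖M.submatrix e e‖ ≤ ‖M‖ := by
  refine Matrix.l2_opNorm_le_of_sum_norm_sq_le (norm_nonneg _) fun v => ?_
  have h0 : ∀ φ : n → ℂ → ℂ, (∀ j, φ j 0 = 0) →
      ∑ j, φ j (Function.extend e v 0 j) = ∑ i, φ (e i) (v i) := by
    intro φ hφ
    rw [← Finset.sum_subset (Finset.subset_univ (Finset.univ.map ⟨e, he⟩)), Finset.sum_map]
    · simp [he.extend_apply]
    · intro j _ hj
      rw [Function.extend_apply' _ _ _ fun ⟨i, hi⟩ => hj (by simp [← hi])]
      exact hφ j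
  have h1 : ∀ i, (M.submatrix e e *ᵥ v) i = (M *ᵥ Function.extend e v 0) (e i) := by
    intro i
    exact (h0 (fun j z => M (e i) j * z) fun j => mul_zero _).symm
  have h2 : ∑ j, ‖Function.extend e v 0 j‖ ^ 2 = ∑ i, ‖v i‖ ^ 2 := by
    have := h0 (fun _ z => ((‖z‖ ^ 2 : ℝ) : ℂ)) (by simp)
    exact_mod_cast this
  have h3 := Matrix.sum_norm_sq_mulVec_le M (Function.extend e v 0)
  rw [h2] at h3
  refine le_trans ?_ h3
  simp only [h1]
  have := Finset.sum_le_sum_of_subset_of_nonneg (Finset.subset_univ (Finset.univ.map ⟨e, he⟩))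
    (f := fun j => ‖(M *ᵥ Function.extend e v 0) j‖ ^ 2) fun _ _ _ => by positivity
  rwa [Finset.sum_map] at this

variable {n k : Type*} [Fintype n] [DecidableEq n] [Fintype k] [DecidableEq k]

theorem Matrix.kronecker_one_mulVec {n k : Type*} [Fintype n] [Fintype k] [DecidableEq k]
    (M : Matrix n n ℂ) (v : n × k → ℂ) (i : n) (x : k) :
    ((M ⊗ₖ (1 : Matrix k k ℂ)) *ᵥ v) (i, x) = (M *ᵥ fun j => v (j, x)) i := by
  simp [Matrix.mulVec, dotProduct, Fintype.sum_prod_type, Matrix.one_apply]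

theorem Matrix.l2_opNorm_kronecker_one_le (M : Matrix n n ℂ) :
    ‖M ⊗ₖ (1 : Matrix k k ℂ)‖ ≤ ‖M‖ := by
  refine Matrix.l2_opNorm_le_of_sum_norm_sq_le (norm_nonneg _) fun v => ?_
  rw [Fintype.sum_prod_type_right, Fintype.sum_prod_type_right, Finset.mul_sum]
  refine Finset.sum_le_sum fun x _ => ?_
  simp only [Matrix.kronecker_one_mulVec]
  exact Matrix.sum_norm_sq_mulVec_le M _

theorem Matrix.trace_submatrix_equiv {ι κ : Type*} [Fintype ι] [Fintype κ] (e : κ ≃ ι)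
    (M : Matrix ι ι ℂ) : (M.submatrix e e).trace = M.trace := by
  simp only [Matrix.trace, Matrix.diag, Matrix.submatrix_apply]
  exact e.sum_comp fun i => M i i

variable {I Q a b c : Type*} [Fintype I] [DecidableEq I] [Fintype Q] [DecidableEq Q]
  [Fintype a] [DecidableEq a] [Fintype b] [DecidableEq b] [Fintype c] [DecidableEq c]

/-- Reduction of a commutator with an operator that acts trivially on the factor `c` of the
environment `Q ≃ b × c`. -/
theorem trace_kronecker_mul_commutator_eq {I : Type*} [Fintype I] (e : Q ≃ b × c)
    (M : Matrix (I × b) (I × b) ℂ)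
    (h : Matrix (I × Q) (I × Q) ℂ)
    (hM : ∀ i q i' q', h (i, q) (i', q') =
      if (e q).2 = (e q').2 then M (i, (e q).1) (i', (e q').1) else 0)
    {ρ : Matrix (I × Q) (I × Q) ℂ} (hρ : ρ.PosSemidef) :
    ∃ ρ' : Matrix (I × b) (I × b) ℂ, ρ'.PosSemidef ∧ ptr ρ' = ptr ρ ∧
      ∀ F : Matrix I I ℂ, (F ⊗ₖ (1 : Matrix Q Q ℂ) * (h * ρ - ρ * h)).trace =
        (F ⊗ₖ (1 : Matrix b b ℂ) * (M * ρ' - ρ' * M)).trace := by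
  let E : (I × b) × c ≃ I × Q := (Equiv.prodAssoc I b c).trans ((Equiv.refl I).prodCongr e.symm)
  have hE : ∀ i β γ, E ((i, β), γ) = (i, e.symm (β, γ)) := fun _ _ _ => rfl
  have hh : h.submatrix E E = M ⊗ₖ (1 : Matrix c c ℂ) := by
    ext ⟨⟨i, β⟩, γ⟩ ⟨⟨i', β'⟩, γ'⟩
    rw [Matrix.submatrix_apply, hE, hE, hM]
    simp [Matrix.one_apply]
  refine ⟨ptr (ρ.submatrix E E), (hρ.submatrix E).ptr, ?_, fun F => ?_⟩
  · ext i i'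
    simp only [ptr, Matrix.of_apply, Matrix.submatrix_apply, hE]
    rw [← e.symm.sum_comp, Fintype.sum_prod_type]
  · have hF : (F ⊗ₖ (1 : Matrix Q Q ℂ)).submatrix E E =
        (F ⊗ₖ (1 : Matrix b b ℂ)) ⊗ₖ (1 : Matrix c c ℂ) := by
      ext ⟨⟨i, β⟩, γ⟩ ⟨⟨i', β'⟩, γ'⟩
      rw [Matrix.submatrix_apply, hE, hE]
      simp only [Matrix.kroneckerMap_apply, Matrix.one_apply, EmbeddingLike.apply_eq_iff_eq,
        Prod.mk.injEq, ite_and]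
      split_ifs <;> simp
    have hsub : (h * ρ - ρ * h).submatrix E E =
        h.submatrix E E * ρ.submatrix E E - ρ.submatrix E E * h.submatrix E E := by
      rw [Matrix.submatrix_mul_equiv, Matrix.submatrix_mul_equiv]
      rfl
    rw [← Matrix.trace_submatrix_equiv E, ← Matrix.submatrix_mul_equiv _ _ _ E, hF,
      trace_kronecker_one_mul, hsub, hh, ptr_sub, ptr_kronecker_one_mul, ptr_mul_kronecker_one]

theorem norm_trace_log_commutator_le_right (e : Q ≃ b × c) (M : Matrix (I × b) (I × b) ℂ)
    (h : Matrix (I × Q) (I × Q) ℂ)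
    (hM : ∀ i q i' q', h (i, q) (i', q') =
      if (e q).2 = (e q').2 then M (i, (e q).1) (i', (e q').1) else 0)
    {ρ : Matrix (I × Q) (I × Q) ℂ} (hρ : ρ.PosSemidef) (htr : ρ.trace = 1) :
    ‖(cfc Real.log (ptr ρ) ⊗ₖ (1 : Matrix Q Q ℂ) * (h * ρ - ρ * h)).trace‖ ≤
      36 * ‖M‖ * Real.log (Fintype.card b) := by
  obtain ⟨ρ', hρ', hptr, heq⟩ := trace_kronecker_mul_commutator_eq e M h hM hρ
  rw [heq, ← hptr]
  refine norm_trace_log_ptr_mul_commutator_le hρ' ?_ M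
  rw [← trace_ptr, hptr, trace_ptr, htr]

theorem norm_trace_rpow_commutator_le_right {α : ℝ} (hα : 1 < α) (e : Q ≃ b × c)
    (M : Matrix (I × b) (I × b) ℂ) (h : Matrix (I × Q) (I × Q) ℂ)
    (hM : ∀ i q i' q', h (i, q) (i', q') =
      if (e q).2 = (e q').2 then M (i, (e q).1) (i', (e q').1) else 0)
    {ρ : Matrix (I × Q) (I × Q) ℂ} (hρ : ρ.PosSemidef) :
    ‖(cfc (fun x : ℝ => x ^ (α - 1)) (ptr ρ) ⊗ₖ (1 : Matrix Q Q ℂ) * (h * ρ - ρ * h)).trace‖ ≤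
      2 * Fintype.card b * (cfc (fun x : ℝ => x ^ α) (ptr ρ)).trace.re * ‖M‖ := by
  obtain ⟨ρ', hρ', hptr, heq⟩ := trace_kronecker_mul_commutator_eq e M h hM hρ
  rw [heq, ← hptr]
  exact norm_trace_rpow_ptr_mul_commutator_le hα hρ' M

/-- A function of a Hermitian matrix is a polynomial in it, and the polynomial may be chosen to be
the same for two matrices. -/
theorem exists_polynomial_cfc_eq {A : Matrix n n ℂ} {B : Matrix k k ℂ} (hA : A.IsHermitian)
    (hB : B.IsHermitian) (f : ℝ → ℝ) :
    ∃ p : Polynomial ℝ, cfc f A = Polynomial.aeval A p ∧ cfc f B = Polynomial.aeval B p := by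
  classical
  set S : Finset ℝ := Finset.univ.image hA.eigenvalues ∪ Finset.univ.image hB.eigenvalues with hS
  have hp : ∀ x ∈ S, (Lagrange.interpolate S id f).eval x = f x := fun x hx =>
    Lagrange.eval_interpolate_at_node f Function.injective_id.injOn hx
  refine ⟨Lagrange.interpolate S id f, ?_, ?_⟩
  · rw [← cfc_polynomial (R := ℝ) _ A hA.isSelfAdjoint]
    refine cfc_congr fun x hx => ?_
    rw [hA.spectrum_real_eq_range_eigenvalues] at hx
    obtain ⟨i, rfl⟩ := hx
    exact (hp _ (by simp [hS])).symm
  · rw [← cfc_polynomial (R := ℝ) _ B hB.isSelfAdjoint]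
    refine cfc_congr fun x hx => ?_
    rw [hB.spectrum_real_eq_range_eigenvalues] at hx
    obtain ⟨i, rfl⟩ := hx
    exact (hp _ (by simp [hS])).symm

/-- Functional calculus respects intertwiners. -/
theorem cfc_mul_eq_mul_cfc_transpose {A : Matrix n n ℂ} {B : Matrix k k ℂ} (hA : A.IsHermitian)
    (hB : B.IsHermitian) {Ψ : Matrix n k ℂ} (h : A * Ψ = Ψ * Bᵀ) (f : ℝ → ℝ) :
    cfc f A * Ψ = Ψ * (cfc f B)ᵀ := by
  obtain ⟨p, hpA, hpB⟩ := exists_polynomial_cfc_eq hA hB f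
  have hpow : ∀ j : ℕ, A ^ j * Ψ = Ψ * (B ^ j)ᵀ := by
    intro j
    induction j with
    | zero => simp
    | succ j ih =>
      rw [pow_succ, Matrix.mul_assoc, h, ← Matrix.mul_assoc, ih, Matrix.mul_assoc,
        ← Matrix.transpose_mul, ← pow_succ']
  rw [hpA, hpB, Polynomial.aeval_eq_sum_range, Polynomial.aeval_eq_sum_range, Matrix.sum_mul,
    Matrix.transpose_sum, Matrix.mul_sum]
  refine Finset.sum_congr rfl fun j _ => ?_
  rw [Matrix.smul_mul, hpow, Matrix.transpose_smul, Matrix.mul_smul]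

theorem Matrix.isHermitian_cfc (A : Matrix n n ℂ) (f : ℝ → ℝ) : (cfc f A).IsHermitian :=
  (cfc_predicate f A).star_eq

/-- The entangling rate of an interaction that acts on a factor of dimension `card a` inside of
the subsystem. -/
theorem norm_trace_log_commutator_le_left (e : I ≃ c × a) (M : Matrix (Q × a) (Q × a) ℂ)
    (h : Matrix (I × Q) (I × Q) ℂ)
    (hM : ∀ i q i' q', h (i, q) (i', q') =
      if (e i).1 = (e i').1 then M (q, (e i).2) (q', (e i').2) else 0)
    {ρ : Matrix (I × Q) (I × Q) ℂ} (hρ : ρ.PosSemidef) (htr : ρ.trace = 1) :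
    ‖(cfc Real.log (ptr ρ) ⊗ₖ (1 : Matrix Q Q ℂ) * (h * ρ - ρ * h)).trace‖ ≤
      36 * ‖M‖ * Real.log (Fintype.card a) := by
  obtain ⟨C, hC⟩ := hρ.exists_eq_mul_conjTranspose
  -- the purification, with the environment enlarged by a copy of `I × Q`
  let vec : Matrix (I × Q) (I × Q) ℂ → (Q × (I × Q)) × I → ℂ := fun Y x => Y (x.2, x.1.1) x.1.2
  have hvec : ∀ X Y : Matrix (I × Q) (I × Q) ℂ, (Xᴴ * Y).trace = star (vec X) ⬝ᵥ vec Y := by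
    intro X Y
    simp only [Matrix.trace, Matrix.diag, Matrix.mul_apply, Matrix.conjTranspose_apply, dotProduct,
      Pi.star_apply, Fintype.sum_prod_type (f := fun x : (Q × (I × Q)) × I =>
        star (vec X x) * vec Y x), Fintype.sum_prod_type (f := fun x : Q × (I × Q) =>
        ∑ i, star (vec X (x, i)) * vec Y (x, i))]
    rw [Finset.sum_comm (s := (Finset.univ : Finset Q))]
    refine Finset.sum_congr rfl fun ν _ => ?_
    rw [Fintype.sum_prod_type, Finset.sum_comm]
  let amp : Matrix (I × Q) (I × Q) ℂ → Matrix ((Q × (I × Q)) × I) ((Q × (I × Q)) × I) ℂ :=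
    fun h => Matrix.of fun x y => if x.1.2 = y.1.2 then h (x.2, x.1.1) (y.2, y.1.1) else 0
  have hamp : ∀ h Y : Matrix (I × Q) (I × Q) ℂ, vec (h * Y) = amp h *ᵥ vec Y := by
    intro h Y
    ext ⟨⟨q, ν⟩, i⟩
    simp only [vec, amp, Matrix.mul_apply, Matrix.mulVec, dotProduct, Matrix.of_apply,
      Fintype.sum_prod_type (f := fun y : (Q × (I × Q)) × I =>
        (if ν = y.1.2 then h (i, q) (y.2, y.1.1) else 0) * Y (y.2, y.1.1) y.1.2),
      Fintype.sum_prod_type (f := fun x : Q × (I × Q) =>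
        ∑ j, (if ν = x.2 then h (i, q) (j, x.1) else 0) * Y (j, x.1) x.2)]
    simp only [ite_mul, zero_mul]
    rw [Fintype.sum_prod_type, Finset.sum_comm]
    refine Finset.sum_congr rfl fun q' _ => ?_
    rw [Finset.sum_comm]
    refine Finset.sum_congr rfl fun j _ => ?_
    rw [Finset.sum_ite_eq]
    simp
  have hampH : ∀ h, amp hᴴ = (amp h)ᴴ := by
    intro h
    ext x y
    simp only [amp, Matrix.of_apply, Matrix.conjTranspose_apply, apply_ite star, star_zero,
      eq_comm (a := x.1.2)]
  set ω : Matrix ((Q × (I × Q)) × I) ((Q × (I × Q)) × I) ℂ :=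
    Matrix.vecMulVec (vec C) (star (vec C)) with hω
  have hωpos : ω.PosSemidef := Matrix.posSemidef_vecMulVec_self_star _
  have hωtr : ∀ X, (X * ω).trace = star (vec C) ⬝ᵥ X *ᵥ vec C := by
    intro X
    rw [hω, Matrix.mul_vecMulVec, Matrix.trace_vecMulVec, dotProduct_comm]
  -- The amplitudes of the purification between `I` and everything else. The two reduced states are
  -- `Ψ * Ψᴴ` and the transpose of `Ψᴴ * Ψ`, so `Ψ` intertwines them, and functions of one can be
  -- moved to the other.
  let Ψ : Matrix I (Q × (I × Q)) ℂ := Matrix.of fun i x => C (i, x.1) x.2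
  have hΨ1 : ptr ρ = Ψ * Ψᴴ := by
    ext i j
    simp [ptr, hC, Ψ, Matrix.mul_apply, Fintype.sum_prod_type]
  have hΨ2 : (ptr ω)ᵀ = Ψᴴ * Ψ := by
    ext x y
    simp [ptr, hω, vec, Ψ, Matrix.mul_apply, Matrix.vecMulVec_apply, mul_comm]
  set F := cfc Real.log (ptr ρ) with hF
  set G := cfc Real.log (ptr ω) with hG
  have hFG : F * Ψ = Ψ * Gᵀ :=
    cfc_mul_eq_mul_cfc_transpose hρ.ptr.1 hωpos.ptr.1 (by rw [hΨ1, hΨ2, Matrix.mul_assoc]) _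
  have hFvec : vec (F ⊗ₖ (1 : Matrix Q Q ℂ) * C) = (G ⊗ₖ (1 : Matrix I I ℂ)) *ᵥ vec C := by
    ext ⟨x, i⟩
    rw [Matrix.kronecker_one_mulVec]
    have h1 := congrFun (congrFun hFG i) x
    refine Eq.trans ?_ (h1.trans ?_)
    · simp [vec, Ψ, Matrix.mul_apply, Fintype.sum_prod_type, Matrix.one_apply]
    · simp only [Matrix.mul_apply, Matrix.mulVec, dotProduct, Matrix.transpose_apply]
      exact Finset.sum_congr rfl fun y _ => mul_comm _ _
  have hFH : (F ⊗ₖ (1 : Matrix Q Q ℂ))ᴴ = F ⊗ₖ (1 : Matrix Q Q ℂ) := by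
    rw [Matrix.conjTranspose_kronecker, Matrix.conjTranspose_one, (Matrix.isHermitian_cfc _ _).eq]
  have hGH : (G ⊗ₖ (1 : Matrix I I ℂ))ᴴ = G ⊗ₖ (1 : Matrix I I ℂ) := by
    rw [Matrix.conjTranspose_kronecker, Matrix.conjTranspose_one, (Matrix.isHermitian_cfc _ _).eq]
  have hswap : (F ⊗ₖ (1 : Matrix Q Q ℂ) * (h * ρ - ρ * h)).trace =
      (G ⊗ₖ (1 : Matrix I I ℂ) * (amp h * ω - ω * amp h)).trace := by
    have e1 : (F ⊗ₖ (1 : Matrix Q Q ℂ) * (h * ρ)).trace =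
        (G ⊗ₖ (1 : Matrix I I ℂ) * (amp h * ω)).trace := by
      calc _ = (F ⊗ₖ (1 : Matrix Q Q ℂ) * h * C * Cᴴ).trace := by
            rw [hC]; simp only [Matrix.mul_assoc]
        _ = ((F ⊗ₖ (1 : Matrix Q Q ℂ) * C)ᴴ * (h * C)).trace := by
            rw [Matrix.trace_mul_comm, Matrix.conjTranspose_mul, hFH]
            simp only [Matrix.mul_assoc]
        _ = star (vec C) ⬝ᵥ (G ⊗ₖ (1 : Matrix I I ℂ) * amp h) *ᵥ vec C := by
            rw [hvec, hFvec, hamp, Matrix.star_mulVec, hGH, ← Matrix.dotProduct_mulVec,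
              Matrix.mulVec_mulVec]
        _ = _ := by rw [← hωtr, Matrix.mul_assoc]
    have e2 : (F ⊗ₖ (1 : Matrix Q Q ℂ) * (ρ * h)).trace =
        (G ⊗ₖ (1 : Matrix I I ℂ) * (ω * amp h)).trace := by
      calc _ = (Cᴴ * (h * (F ⊗ₖ (1 : Matrix Q Q ℂ) * C))).trace := by
            rw [hC, ← Matrix.mul_assoc, Matrix.trace_mul_comm, ← Matrix.mul_assoc,
              ← Matrix.mul_assoc, Matrix.trace_mul_comm]
            simp only [Matrix.mul_assoc]
        _ = star (vec C) ⬝ᵥ (amp h * G ⊗ₖ (1 : Matrix I I ℂ)) *ᵥ vec C := by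
            rw [hvec, hamp, hFvec, Matrix.mulVec_mulVec]
        _ = _ := by
            rw [← hωtr, ← Matrix.mul_assoc, Matrix.trace_mul_comm (G ⊗ₖ (1 : Matrix I I ℂ) * ω),
              ← Matrix.mul_assoc]
    rw [Matrix.mul_sub, Matrix.trace_sub, e1, e2, Matrix.mul_sub, Matrix.trace_sub]
  let eM : (Q × a) × (I × Q) ≃ (Q × (I × Q)) × a :=
    { toFun := fun x => ((x.1.1, x.2), x.1.2)
      invFun := fun x => ((x.1.1, x.2), x.1.2)
      left_inv := fun _ => rfl
      right_inv := fun _ => rfl }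
  set M' : Matrix ((Q × (I × Q)) × a) ((Q × (I × Q)) × a) ℂ :=
    (M ⊗ₖ (1 : Matrix (I × Q) (I × Q) ℂ)).submatrix eM.symm eM.symm with hM'
  have hM'norm : ‖M'‖ ≤ ‖M‖ :=
    (Matrix.l2_opNorm_submatrix_injective_le eM.symm.injective _).trans
      (Matrix.l2_opNorm_kronecker_one_le M)
  have hωtr1 : ω.trace = 1 := by
    rw [← trace_ptr, ← Matrix.trace_transpose, hΨ2, Matrix.trace_mul_comm, ← hΨ1, trace_ptr, htr]
  rw [hswap]
  -- After the exchange `I` is the environment, and the interaction acts only on its factor `a`; the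
  -- ancilla is an idle part of the new subsystem.
  refine (norm_trace_log_commutator_le_right (e.trans (Equiv.prodComm c a)) M' (amp h) ?_ hωpos
    hωtr1).trans ?_
  · rintro ⟨q, ν⟩ i ⟨q', ν'⟩ i'
    simp only [amp, Matrix.of_apply, hM, hM', Matrix.submatrix_apply, Matrix.kroneckerMap_apply,
      eM, Equiv.coe_fn_symm_mk, Matrix.one_apply, Equiv.trans_apply, Equiv.prodComm_apply,
      Prod.snd_swap, Prod.fst_swap, mul_ite, mul_one, mul_zero]
    split_ifs <;> rfl
  · have : 0 ≤ Real.log (Fintype.card a) := Real.log_natCast_nonneg _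
    gcongr

end Bipartite

/-! ### Differentiating the trace of a function of a positive matrix -/

section TraceDerivative

open scoped Matrix.Norms.L2Operator
open Matrix Filter Topology Asymptotics Polynomial

theorem isBigO_sq_of_deriv_eq_zero {φ : ℝ → ℝ} {x : ℝ} (h : ContDiffAt ℝ 2 φ x) (h0 : φ x = 0)
    (h1 : deriv φ x = 0) : φ =O[𝓝 x] fun y => (y - x) ^ 2 := by
  have hd : ∀ᶠ y in 𝓝 x, DifferentiableAt ℝ φ y := by
    filter_upwards [h.eventually (by simp)] with y hy
    exact hy.differentiableAt (by simp)
  have h2 : DifferentiableAt ℝ (deriv φ) x := by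
    have h3 : ContDiffAt ℝ 1 (fderiv ℝ φ) x := h.fderiv_right (by norm_num)
    have h4 : (fun y => fderiv ℝ φ y 1) = deriv φ := funext fun y => by simp
    rw [← h4]
    exact (h3.differentiableAt (by simp)).clm_apply (differentiableAt_const _)
  have h3 : deriv φ =O[𝓝 x] fun y => y - x := by
    have := h2.isBigO_sub
    simpa [h1] using this
  obtain ⟨C, hC⟩ := h3.bound
  obtain ⟨δ, hδ, hball⟩ := Metric.eventually_nhds_iff.1 (hd.and hC)
  refine IsBigO.of_bound C (Metric.eventually_nhds_iff.2 ⟨δ, hδ, fun y hy => ?_⟩)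
  have hsub : ∀ z ∈ Metric.closedBall x (dist y x), dist z x < δ := fun z hz =>
    (Metric.mem_closedBall.1 hz).trans_lt hy
  have hC0 : 0 ≤ C * ‖y - x‖ := (norm_nonneg _).trans (hball hy).2
  have hCb : ∀ z ∈ Metric.closedBall x (dist y x), ‖deriv φ z‖ ≤ C * ‖y - x‖ := by
    intro z hz
    rcases le_or_gt 0 C with hCn | hCn
    · refine (hball (hsub z hz)).2.trans ?_
      gcongr
      simpa [dist_eq_norm] using hz
    · have h4 := (norm_nonneg _).trans (hball (hsub z hz)).2
      have h5 : ‖z - x‖ = 0 := le_antisymm (by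
        by_contra h6
        exact absurd (mul_neg_of_neg_of_pos hCn (not_le.1 h6)) (not_lt.2 h4)) (norm_nonneg _)
      have h6 := (hball (hsub z hz)).2
      rw [h5, mul_zero] at h6
      exact h6.trans hC0
  have := (convex_closedBall x (dist y x)).norm_image_sub_le_of_norm_deriv_le
    (fun z hz => (hball (hsub z hz)).1) hCb (Metric.mem_closedBall_self dist_nonneg)
    (Metric.mem_closedBall.2 le_rfl)
  rw [h0, sub_zero] at this
  rw [norm_pow, sq, ← mul_assoc]
  exact this

/-- Hermite interpolation of values and first derivatives. -/
theorem exists_polynomial_eval_derivative_eq (S : Finset ℝ) (u v : ℝ → ℝ) :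
    ∃ p : ℝ[X], ∀ x ∈ S, p.eval x = u x ∧ (derivative p).eval x = v x := by
  induction S using Finset.induction_on with
  | empty => exact ⟨0, by simp⟩
  | insert a S ha ih =>
    obtain ⟨p, hp⟩ := ih
    set N : ℝ[X] := ∏ x ∈ S, (X - C x) with hN
    have hNa : N.eval a ≠ 0 := by
      rw [hN, eval_prod, Finset.prod_ne_zero_iff]
      intro x hx
      rw [eval_sub, eval_X, eval_C, sub_ne_zero]
      rintro rfl
      exact ha hx
    have hNx : ∀ x ∈ S, N.eval x = 0 := by
      intro x hx
      rw [hN, eval_prod]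
      exact Finset.prod_eq_zero hx (by simp)
    -- The correction is divisible by `N ^ 2` and leaves the data at the earlier nodes intact; `c`
    -- adjusts the value at `a` and `e` the slope.
    set c := (u a - p.eval a) / N.eval a ^ 2 with hc
    set e := (v a - (derivative p).eval a - c * (2 * N.eval a * (derivative N).eval a)) /
      N.eval a ^ 2 with he
    refine ⟨p + (C c + C e * (X - C a)) * N ^ 2, fun x hx => ?_⟩
    rcases Finset.mem_insert.1 hx with rfl | hx
    · simp only [eval_add, eval_mul, eval_pow, eval_C, eval_sub, eval_X, sub_self, mul_zero,
        add_zero, derivative_add, derivative_mul, derivative_C, derivative_sub, derivative_X,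
        derivative_pow, zero_mul, zero_add, sub_zero, mul_one, Nat.cast_ofNat,
        Nat.add_one_sub_one, pow_one]
      constructor
      · rw [hc]; field_simp; ring
      · have : e * N.eval x ^ 2 =
            v x - (derivative p).eval x - c * (2 * N.eval x * (derivative N).eval x) := by
          rw [he]; field_simp
        rw [this]; simp
    · simp [hp x hx, hNx x hx, derivative_pow, derivative_mul]

variable {n : Type*} [Fintype n] [DecidableEq n]

/-- In the derivative of a power, the factors surrounding `B'` recombine by cyclicity of the trace.
-/
theorem hasDerivAt_trace_aeval {B : ℝ → Matrix n n ℂ} {B' : Matrix n n ℂ} {t₀ : ℝ}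
    (hB : HasDerivAt B B' t₀) (p : ℝ[X]) :
    HasDerivAt (fun t => (aeval (B t) p).trace.re)
      ((aeval (B t₀) (derivative p) * B').trace.re) t₀ := by
  let T : Matrix n n ℂ →L[ℝ] ℝ :=
    (Complex.reLm ∘ₗ Matrix.traceLinearMap n ℝ ℂ).toContinuousLinearMap
  have hT : ∀ M, T M = M.trace.re := fun _ => rfl
  induction p using Polynomial.induction_on' with
  | add p q hp hq =>
    simpa only [map_add, derivative_add, Matrix.add_mul, Matrix.trace_add, Complex.add_re] using
      hp.fun_add hq
  | monomial k a =>
    have h1 : HasDerivAt (fun t => T (a • B t ^ k))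
        (T (a • ∑ i ∈ Finset.range k, B t₀ ^ (k.pred - i) * B' * B t₀ ^ i)) t₀ :=
      T.hasFDerivAt.comp_hasDerivAt t₀ ((hB.pow' k).const_smul a)
    simp only [aeval_monomial, derivative_monomial, Algebra.algebraMap_eq_smul_one,
      Matrix.smul_mul, Matrix.one_mul]
    refine h1.congr_deriv ?_
    rw [map_smul, map_sum]
    have h2 : ∀ i ∈ Finset.range k, T (B t₀ ^ (k.pred - i) * B' * B t₀ ^ i) =
        (B t₀ ^ (k - 1) * B').trace.re := by
      intro i hi
      have hi := Finset.mem_range.1 hi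
      rw [hT, Matrix.mul_assoc, Matrix.trace_mul_comm, Matrix.mul_assoc, ← pow_add,
        Matrix.trace_mul_comm, show i + (k.pred - i) = k - 1 by rw [Nat.pred_eq_sub_one]; omega]
    rw [Finset.sum_congr rfl h2]
    simp [mul_assoc]

theorem contDiff_trace_aeval {B : ℝ → Matrix n n ℂ} {m : WithTop ℕ∞} (hB : ContDiff ℝ m B)
    (p : ℝ[X]) : ContDiff ℝ m (fun t => (aeval (B t) p).trace.re) := by
  let T : Matrix n n ℂ →L[ℝ] ℝ :=
    (Complex.reLm ∘ₗ Matrix.traceLinearMap n ℝ ℂ).toContinuousLinearMap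
  refine T.contDiff.comp (f := fun t => aeval (B t) p) ?_
  simp only [aeval_eq_sum_range]
  exact ContDiff.sum fun i _ => (hB.pow i).const_smul _

theorem Matrix.IsHermitian.trace_aeval {M : Matrix n n ℂ} (hM : M.IsHermitian) (p : ℝ[X]) :
    (aeval M p).trace = ((∑ i, p.eval (hM.eigenvalues i) : ℝ) : ℂ) := by
  rw [← cfc_polynomial (R := ℝ) p M hM.isSelfAdjoint, hM.trace_cfc]

theorem isBigO_rpow_of_le_one {ψ : ℝ → ℝ} {l : Filter ℝ} {x : ℝ} (h : Tendsto ψ l (𝓝 x))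
    (hψ : ∀ᶠ y in l, 0 ≤ ψ y) : ψ =O[l] fun y => ψ y ^ (3 / 4 : ℝ) := by
  have h1 : (fun y => ψ y ^ (3 / 4 : ℝ) * ψ y ^ (1 / 4 : ℝ)) =O[l]
      fun y => ψ y ^ (3 / 4 : ℝ) * (1 : ℝ) :=
    (isBigO_refl _ _).mul ((h.rpow_const (Or.inr (by norm_num))).isBigO_one ℝ)
  simp only [mul_one] at h1
  refine h1.congr' ?_ EventuallyEq.rfl
  filter_upwards [hψ] with y hy
  rw [← Real.rpow_add_of_nonneg hy (by norm_num) (by norm_num)]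
  norm_num

/-- A polynomial interpolating `f` approximates it up to a power of a polynomial that vanishes
at the nodes. -/
theorem exists_abs_sub_eval_le {f : ℝ → ℝ}
    (hfO : f =O[𝓝[Set.Icc 0 1] 0] fun x => x ^ (3 / 4 : ℝ))
    (hfd : ∀ x, 0 < x → ContDiffAt ℝ 2 f x) (T : Finset ℝ) (hT : ∀ x ∈ T, 0 < x) (p : ℝ[X])
    (hp0 : p.eval 0 = 0) (hp : ∀ x ∈ T, p.eval x = f x ∧ (derivative p).eval x = deriv f x) :
    ∃ C : ℝ, 0 ≤ C ∧ ∀ x ∈ Set.Icc (0 : ℝ) 1,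
      |f x - p.eval x| ≤
        C * (X * ∏ μ ∈ T, (X - Polynomial.C μ) ^ 2 : ℝ[X]).eval x ^ (3 / 4 : ℝ) := by
  set ψ : ℝ[X] := X * ∏ μ ∈ T, (X - Polynomial.C μ) ^ 2 with hψ
  have hψe : ∀ x, ψ.eval x = x * ∏ μ ∈ T, (x - μ) ^ 2 := by
    intro x; simp [hψ, eval_prod]
  have hψ0 : ∀ x, 0 ≤ x → 0 ≤ ψ.eval x := by
    intro x hx
    rw [hψe]
    exact mul_nonneg hx (Finset.prod_nonneg fun _ _ => sq_nonneg _)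
  have hψnn : ∀ x, ∀ᶠ y in 𝓝[Set.Icc (0 : ℝ) 1] x, 0 ≤ ψ.eval y := fun x => by
    filter_upwards [self_mem_nhdsWithin] with y hy using hψ0 y hy.1
  have hψt : ∀ x, Tendsto (fun y => ψ.eval y) (𝓝[Set.Icc (0 : ℝ) 1] x) (𝓝 (ψ.eval x)) :=
    fun x => (ψ.continuous.tendsto x).mono_left nhdsWithin_le_nhds
  have hOψ : ∀ x, (fun y => ψ.eval y) =O[𝓝[Set.Icc (0 : ℝ) 1] x]
      fun y => ψ.eval y ^ (3 / 4 : ℝ) := fun x => isBigO_rpow_of_le_one (hψt x) (hψnn x)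
  have hdiv : ∀ (g r : ℝ → ℝ) (x : ℝ), Continuous r → r x ≠ 0 → (∀ y, ψ.eval y = g y * r y) →
      g =O[𝓝[Set.Icc (0 : ℝ) 1] x] fun y => ψ.eval y := by
    intro g r x hr hrx hg
    have h1 : (fun y => ψ.eval y * (r y)⁻¹) =O[𝓝 x] fun y => ψ.eval y * (1 : ℝ) :=
      (isBigO_refl _ _).mul ((hr.continuousAt.inv₀ hrx).tendsto.isBigO_one ℝ)
    simp only [mul_one] at h1
    refine (h1.congr' ?_ EventuallyEq.rfl).mono nhdsWithin_le_nhds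
    filter_upwards [hr.continuousAt.eventually_ne hrx] with y hy
    rw [hg, mul_assoc, mul_inv_cancel₀ hy, mul_one]
  have local_bound : ∀ x ∈ Set.Icc (0 : ℝ) 1, (fun y => f y - p.eval y) =O[𝓝[Set.Icc 0 1] x]
      fun y => ψ.eval y ^ (3 / 4 : ℝ) := by
    intro x hx
    -- Three kinds of points: at `0` the growth of `f` is matched by the simple zero of `ψ`; at a
    -- node the second-order contact is matched by its double zero; elsewhere `ψ` does not vanish.
    rcases hx.1.eq_or_lt with rfl | hx0
    · have hy : (fun y : ℝ => y) =O[𝓝[Set.Icc (0 : ℝ) 1] 0] fun y => ψ.eval y := by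
        refine hdiv (fun y => y) (fun y => ∏ μ ∈ T, (y - μ) ^ 2) 0 (by fun_prop) ?_ hψe
        rw [Finset.prod_ne_zero_iff]
        intro μ hμ
        have := (hT μ hμ).ne'
        simpa using this
      refine IsBigO.sub ?_ ?_
      · exact hfO.trans (hy.rpow (by norm_num) (hψnn 0))
      · have h1 := (p.differentiable.differentiableAt (x := (0 : ℝ))).isBigO_sub
        simp only [hp0, sub_zero] at h1
        exact (h1.mono nhdsWithin_le_nhds).trans (hy.trans (hOψ 0))
    · by_cases hxT : x ∈ T
      · have h1 : (fun y => f y - p.eval y) =O[𝓝 x] fun y => (y - x) ^ 2 := by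
          refine isBigO_sq_of_deriv_eq_zero ((hfd x hx0).sub (p.contDiff_aeval 2).contDiffAt)
            (by rw [(hp x hxT).1, sub_self]) ?_
          rw [deriv_fun_sub ((hfd x hx0).differentiableAt (by simp)) p.differentiableAt,
            Polynomial.deriv, (hp x hxT).2, sub_self]
        refine (h1.mono nhdsWithin_le_nhds).trans (IsBigO.trans ?_ (hOψ x))
        refine hdiv _ (fun y => y * ∏ μ ∈ T.erase x, (y - μ) ^ 2) x (by fun_prop) ?_ fun y => ?_
        · refine mul_ne_zero hx0.ne' (Finset.prod_ne_zero_iff.2 fun μ hμ => ?_)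
          have : x ≠ μ := (Finset.ne_of_mem_erase hμ).symm
          exact pow_ne_zero 2 (sub_ne_zero.2 this)
        · rw [hψe, ← Finset.mul_prod_erase T _ hxT]
          ring
      · have h1 : (fun y => f y - p.eval y) =O[𝓝[Set.Icc 0 1] x] fun _ => (1 : ℝ) :=
          ((((hfd x hx0).continuousAt.sub p.continuousAt).tendsto).mono_left
            nhdsWithin_le_nhds).isBigO_one ℝ
        refine h1.trans (IsBigO.trans ?_ (hOψ x))
        refine hdiv _ (fun y => ψ.eval y) x ψ.continuous ?_ fun y => (one_mul _).symm
        rw [hψe]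
        refine mul_ne_zero hx0.ne' (Finset.prod_ne_zero_iff.2 fun μ hμ => ?_)
        have : x ≠ μ := fun h => hxT (h ▸ hμ)
        exact pow_ne_zero 2 (sub_ne_zero.2 this)
  have := isCompact_Icc (a := (0 : ℝ)) (b := 1) |>.induction_on
    (p := fun s => ∃ C : ℝ, 0 ≤ C ∧ ∀ x ∈ s, 0 ≤ x →
      |f x - p.eval x| ≤ C * ψ.eval x ^ (3 / 4 : ℝ))
    ⟨0, le_rfl, by simp⟩ (fun s t hst ⟨C, hC, h⟩ => ⟨C, hC, fun x hx => h x (hst hx)⟩)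
    (fun s t ⟨C, hC, h⟩ ⟨C', hC', h'⟩ => ⟨C + C', by positivity, fun x hx hx0 => by
      have := Real.rpow_nonneg (hψ0 x hx0) (3 / 4)
      rcases hx with hx | hx
      · have := h x hx hx0; nlinarith
      · have := h' x hx hx0; nlinarith⟩)
    (fun x hx => by
      obtain ⟨C, hC, h⟩ := (local_bound x hx).exists_nonneg
      refine ⟨_, h.bound, C, hC, fun y hy hy0 => ?_⟩
      simpa [abs_of_nonneg (Real.rpow_nonneg (hψ0 y hy0) _)] using hy)
  obtain ⟨C, hC, h⟩ := this
  exact ⟨C, hC, fun x hx => h x hx hx.1⟩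

theorem Matrix.PosSemidef.eigenvalues_mem_Icc {M : Matrix n n ℂ} (hM : M.PosSemidef)
    (htr : M.trace = 1) (i : n) : hM.1.eigenvalues i ∈ Set.Icc (0 : ℝ) 1 := by
  refine ⟨hM.eigenvalues_nonneg i, ?_⟩
  have h1 : ∑ j, hM.1.eigenvalues j = 1 := by
    have := hM.1.trace_eq_sum_eigenvalues
    rw [htr] at this
    simpa using (congrArg Complex.re this).symm
  rw [← h1]
  exact Finset.single_le_sum (fun j _ => hM.eigenvalues_nonneg j) (Finset.mem_univ i)

/-- The derivative of `Tr f(B(t))` along a curve of density matrices, for functions `f` that are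
smooth away from `0`. At eigenvalues that vanish, the value of the derivative of `f` is
irrelevant. -/
theorem hasDerivAt_trace_cfc {B : ℝ → Matrix n n ℂ} (hB : ContDiff ℝ 2 B)
    (hpos : ∀ t, (B t).PosSemidef) (htr : ∀ t, (B t).trace = 1) {f g : ℝ → ℝ} (hf0 : f 0 = 0)
    (hfO : f =O[𝓝[Set.Icc 0 1] 0] fun x => x ^ (3 / 4 : ℝ))
    (hfd : ∀ x, 0 < x → ContDiffAt ℝ 2 f x) (hg : ∀ x, 0 < x → g x = deriv f x) (t₀ : ℝ) :
    HasDerivAt (fun t => (cfc f (B t)).trace.re) ((cfc g (B t₀) * deriv B t₀).trace.re) t₀ := by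
  classical
  have hA := hpos t₀
  set S : Finset ℝ := Finset.univ.image hA.1.eigenvalues with hS
  set T : Finset ℝ := S.filter fun x => 0 < x with hT
  -- The slope of `p` at `0` is set to `g 0`, so that `p'(B t₀)` is exactly `cfc g (B t₀)`.
  obtain ⟨p, hp⟩ := exists_polynomial_eval_derivative_eq (insert 0 T) f g
  have hp0 : p.eval 0 = 0 := by rw [(hp 0 (by simp)).1, hf0]
  have hST : ∀ i, hA.1.eigenvalues i ∈ insert 0 T := by
    intro i
    rcases (hA.eigenvalues_nonneg i).eq_or_lt with h | h
    · rw [← h]; simp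
    · exact Finset.mem_insert_of_mem (Finset.mem_filter.2 ⟨by simp [hS], h⟩)
  obtain ⟨C, hC, hbound⟩ := exists_abs_sub_eval_le hfO hfd T
    (fun x hx => (Finset.mem_filter.1 hx).2) p hp0 fun x hx => by
      rw [(hp x (Finset.mem_insert_of_mem hx)).1, (hp x (Finset.mem_insert_of_mem hx)).2,
        hg x (Finset.mem_filter.1 hx).2]
      exact ⟨rfl, rfl⟩
  set ψ : ℝ[X] := X * ∏ μ ∈ T, (X - Polynomial.C μ) ^ 2 with hψ
  have hψ0 : ∀ x, 0 ≤ x → 0 ≤ ψ.eval x := by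
    intro x hx
    simp only [hψ, eval_mul, eval_X, eval_prod, eval_pow, eval_sub, eval_C]
    exact mul_nonneg hx (Finset.prod_nonneg fun _ _ => sq_nonneg _)
  -- The control function: nonnegative along the curve and zero at `t₀`, hence of second order
  -- there. The error of replacing `f` by `p` is at most a multiple of `φ ^ (3 / 4)`, that is `O(|t
  -- - t₀| ^ (3 / 2))`, and has derivative zero. No perturbation theory of single eigenvalues is
  -- needed.
  set φ : ℝ → ℝ := fun t => (aeval (B t) ψ).trace.re with hφ
  have hφe : ∀ t, φ t = ∑ i, ψ.eval ((hpos t).1.eigenvalues i) := fun t => by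
    rw [hφ]
    simp only [(hpos t).1.trace_aeval, Complex.ofReal_re]
  have hφ0 : ∀ t, 0 ≤ φ t := fun t => by
    rw [hφe]
    exact Finset.sum_nonneg fun i _ => hψ0 _ ((hpos t).eigenvalues_nonneg i)
  have hφt₀ : φ t₀ = 0 := by
    rw [hφe]
    refine Finset.sum_eq_zero fun i _ => ?_
    simp only [hψ, eval_mul, eval_X, eval_prod, eval_pow, eval_sub, eval_C]
    rcases Finset.mem_insert.1 (hST i) with h | h
    · rw [h, zero_mul]
    · rw [Finset.prod_eq_zero h (by simp), mul_zero]
  have hφO : φ =O[𝓝 t₀] fun t => (t - t₀) ^ 2 := by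
    refine isBigO_sq_of_deriv_eq_zero (contDiff_trace_aeval hB ψ).contDiffAt hφt₀ ?_
    refine IsLocalMin.deriv_eq_zero (Eventually.of_forall fun t => ?_)
    rw [hφt₀]
    exact hφ0 t
  have hBd : HasDerivAt B (deriv B t₀) t₀ :=
    (hB.differentiable (by simp)).differentiableAt.hasDerivAt
  have hmain := hasDerivAt_trace_aeval hBd p
  have hcfcg : cfc g (B t₀) = aeval (B t₀) (derivative p) := by
    rw [← cfc_polynomial (R := ℝ) _ (B t₀) hA.1.isSelfAdjoint]
    refine cfc_congr fun x hx => ?_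
    rw [hA.1.spectrum_real_eq_range_eigenvalues] at hx
    obtain ⟨i, rfl⟩ := hx
    exact (hp _ (hST i)).2.symm
  have hdiff : HasDerivAt (fun t => (cfc f (B t)).trace.re - (aeval (B t) p).trace.re) 0 t₀ := by
    have heq : ∀ t, (cfc f (B t)).trace.re - (aeval (B t) p).trace.re =
        ∑ i, (f ((hpos t).1.eigenvalues i) - p.eval ((hpos t).1.eigenvalues i)) := by
      intro t
      rw [(hpos t).1.trace_cfc, (hpos t).1.trace_aeval, Complex.ofReal_re, Complex.ofReal_re,
        Finset.sum_sub_distrib]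
    have hle : ∀ t, |(cfc f (B t)).trace.re - (aeval (B t) p).trace.re| ≤
        (Fintype.card n * C) * φ t ^ (3 / 4 : ℝ) := by
      intro t
      rw [heq]
      refine (Finset.abs_sum_le_sum_abs _ _).trans ?_
      have : ∀ i ∈ (Finset.univ : Finset n),
          |f ((hpos t).1.eigenvalues i) - p.eval ((hpos t).1.eigenvalues i)| ≤
          C * φ t ^ (3 / 4 : ℝ) := by
        intro i _
        refine (hbound _ ((hpos t).eigenvalues_mem_Icc (htr t) i)).trans ?_
        have h0 := hψ0 _ ((hpos t).eigenvalues_nonneg i)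
        gcongr
        rw [hφe]
        exact Finset.single_le_sum (f := fun i => ψ.eval ((hpos t).1.eigenvalues i))
          (fun j _ => hψ0 _ ((hpos t).eigenvalues_nonneg j)) (Finset.mem_univ i)
      refine (Finset.sum_le_sum this).trans (le_of_eq ?_)
      simp [mul_assoc]
    have hzero : (cfc f (B t₀)).trace.re - (aeval (B t₀) p).trace.re = 0 := by
      rw [heq]
      exact Finset.sum_eq_zero fun i _ => by rw [(hp _ (hST i)).1, sub_self]
    rw [hasDerivAt_iff_isLittleO]
    simp only [hzero, sub_zero, smul_zero]
    have h1 : (fun t => (cfc f (B t)).trace.re - (aeval (B t) p).trace.re) =O[𝓝 t₀]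
        fun t => φ t ^ (3 / 4 : ℝ) := by
      refine IsBigO.of_bound (Fintype.card n * C) (Eventually.of_forall fun t => ?_)
      rw [Real.norm_eq_abs, Real.norm_of_nonneg (Real.rpow_nonneg (hφ0 t) _)]
      exact hle t
    have h2 : (fun t => φ t ^ (3 / 4 : ℝ)) =O[𝓝 t₀] fun t => ((t - t₀) ^ 2) ^ (3 / 4 : ℝ) :=
      hφO.rpow (by norm_num) (Eventually.of_forall fun t => sq_nonneg _)
    refine (h1.trans h2).trans_isLittleO ?_
    have h3 : (fun t : ℝ => |t - t₀| * |t - t₀| ^ (1 / 2 : ℝ)) =o[𝓝 t₀]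
        fun t => |t - t₀| * (1 : ℝ) := by
      refine (isBigO_refl _ _).mul_isLittleO ((isLittleO_one_iff ℝ).2 ?_)
      have : ContinuousAt (fun t : ℝ => |t - t₀| ^ (1 / 2 : ℝ)) t₀ :=
        (by fun_prop : ContinuousAt (fun t : ℝ => |t - t₀|) t₀).rpow_const (Or.inr (by norm_num))
      have h := this.tendsto
      simpa using h
    simp only [mul_one] at h3
    refine (h3.congr_left fun t => ?_).trans_isBigO (isBigO_abs_left.2 (isBigO_refl _ _))
    rw [← sq_abs, ← Real.rpow_natCast, ← Real.rpow_mul (abs_nonneg _)]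
    rcases (abs_nonneg (t - t₀)).eq_or_lt with h | h
    · rw [← h, zero_mul, Real.zero_rpow (by norm_num)]
    · nth_rw 1 [← Real.rpow_one |t - t₀|]
      rw [← Real.rpow_add h]
      norm_num
  have := hdiff.add hmain
  rw [zero_add] at this
  rw [hcfcg]
  refine this.congr_of_eventuallyEq (Eventually.of_forall fun t => ?_)
  simp

end TraceDerivative

/-! ### Operators on part of a set of qudits -/

section Qudits

open scoped Matrix.Norms.L2Operator Kronecker
open Matrix

variable {V : Type} {d : ℕ}

theorem SupportedOn.apply_eq {S : Set V} {M : QuditOp V d} (h : SupportedOn S M)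
    {σ τ σ' τ' : V → Fin d} (h1 : ∀ x ∈ S, σ x = σ' x) (h2 : ∀ x ∈ S, τ x = τ' x)
    (h3 : (∀ x, x ∉ S → σ x = τ x) ↔ ∀ x, x ∉ S → σ' x = τ' x) : M σ τ = M σ' τ' := by
  obtain ⟨K, hK1, hK2⟩ := h
  by_cases h4 : ∀ x, x ∉ S → σ x = τ x
  · rw [hK1 _ _ h4, hK1 _ _ (h3.1 h4)]
    congr 1
    · exact funext fun x => h1 x x.2
    · exact funext fun x => h2 x x.2
  · rw [hK2 _ _ h4, hK2 _ _ fun h5 => h4 (h3.2 h5)]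

theorem SupportedOn.apply_eq_zero {S : Set V} {M : QuditOp V d} (h : SupportedOn S M)
    {σ τ : V → Fin d} {x : V} (hx : x ∉ S) (hne : σ x ≠ τ x) : M σ τ = 0 := by
  obtain ⟨K, -, hK2⟩ := h
  exact hK2 _ _ fun h => hne (h x hx)

/-- The kernel on `S` is read off at configurations padded with `0` outside `S`; this is where `d ≠
0` is used. -/
theorem supportedOn_of_apply_eq [NeZero d] {S : Set V} {M : QuditOp V d}
    (h0 : ∀ σ τ : V → Fin d, ∀ x, x ∉ S → σ x ≠ τ x → M σ τ = 0)
    (h1 : ∀ σ τ σ' τ' : V → Fin d, (∀ x ∈ S, σ x = σ' x) → (∀ x ∈ S, τ x = τ' x) →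
      (∀ x, x ∉ S → σ x = τ x) → (∀ x, x ∉ S → σ' x = τ' x) → M σ τ = M σ' τ') :
    SupportedOn S M := by
  classical
  let ext : (S → Fin d) → V → Fin d := fun a x => if hx : x ∈ S then a ⟨x, hx⟩ else 0
  refine ⟨Matrix.of fun a b => M (ext a) (ext b), fun σ τ h => ?_, fun σ τ h => ?_⟩
  · refine h1 _ _ _ _ (fun x hx => ?_) (fun x hx => ?_) h fun x hx => ?_ <;> simp [ext, hx]
  · push Not at h
    obtain ⟨x, hx, hne⟩ := h
    exact h0 _ _ x hx hne

theorem supportedOn_univ [NeZero d] (M : QuditOp V d) : SupportedOn Set.univ M :=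
  supportedOn_of_apply_eq (fun _ _ x hx => (hx trivial).elim) fun σ τ σ' τ' h1 h2 _ _ => by
    rw [funext fun x => h1 x trivial, funext fun x => h2 x trivial]

theorem SupportedOn.mono [NeZero d] {S T : Set V} {M : QuditOp V d} (h : SupportedOn S M)
    (hST : S ⊆ T) : SupportedOn T M := by
  refine supportedOn_of_apply_eq (fun σ τ x hx => h.apply_eq_zero fun hS => hx (hST hS))
    fun σ τ σ' τ' h1 h2 h3 h4 => h.apply_eq (fun x hx => h1 x (hST hx))
      (fun x hx => h2 x (hST hx)) ⟨fun h5 x hx => ?_, fun h5 x hx => ?_⟩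
  · by_cases hxT : x ∈ T
    · rw [← h1 x hxT, ← h2 x hxT, h5 x hx]
    · exact h4 x hxT
  · by_cases hxT : x ∈ T
    · rw [h1 x hxT, h2 x hxT, h5 x hx]
    · exact h3 x hxT

theorem supportedOn_zero (S : Set V) : SupportedOn S (0 : QuditOp V d) :=
  ⟨0, fun _ _ _ => rfl, fun _ _ _ => rfl⟩

theorem SupportedOn.add {S : Set V} {M N : QuditOp V d} (hM : SupportedOn S M)
    (hN : SupportedOn S N) : SupportedOn S (M + N) := by
  obtain ⟨K, hK1, hK2⟩ := hM
  obtain ⟨L, hL1, hL2⟩ := hN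
  refine ⟨K + L, fun σ τ h => ?_, fun σ τ h => ?_⟩
  · rw [Matrix.add_apply, Matrix.add_apply, hK1 _ _ h, hL1 _ _ h]
  · rw [Matrix.add_apply, hK2 _ _ h, hL2 _ _ h, add_zero]

theorem SupportedOn.neg {S : Set V} {M : QuditOp V d} (hM : SupportedOn S M) :
    SupportedOn S (-M) := by
  obtain ⟨K, hK1, hK2⟩ := hM
  refine ⟨-K, fun σ τ h => ?_, fun σ τ h => ?_⟩
  · rw [Matrix.neg_apply, Matrix.neg_apply, hK1 _ _ h]
  · rw [Matrix.neg_apply, hK2 _ _ h, neg_zero]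

theorem SupportedOn.sub {S : Set V} {M N : QuditOp V d} (hM : SupportedOn S M)
    (hN : SupportedOn S N) : SupportedOn S (M - N) := by
  rw [sub_eq_add_neg]
  exact hM.add hN.neg

theorem SupportedOn.sum {ι : Type*} {S : Set V} (s : Finset ι) {M : ι → QuditOp V d}
    (h : ∀ i ∈ s, SupportedOn S (M i)) : SupportedOn S (∑ i ∈ s, M i) := by
  classical
  induction s using Finset.induction_on with
  | empty => exact supportedOn_zero S
  | insert a s ha ih =>
    rw [Finset.sum_insert ha]
    exact (h a (by simp)).add (ih fun i hi => h i (by simp [hi]))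

variable [DecidableEq V]

/-- Configurations of `A` and of its complement are the same as configurations of everything. -/
def glueEquiv (A : Finset V) (d : ℕ) :
    ({x // x ∈ A} → Fin d) × ({x // x ∉ A} → Fin d) ≃ (V → Fin d) where
  toFun p := glue A p.1 p.2
  invFun σ := (fun x => σ x, fun x => σ x)
  left_inv p := by
    ext x
    · simp [glue, x.2]
    · simp [glue, x.2]
  right_inv σ := by
    ext x
    simp [glue]

theorem glueEquiv_of_mem {A : Finset V} (p : ({x // x ∈ A} → Fin d) × ({x // x ∉ A} → Fin d))
    {x : V} (hx : x ∈ A) : glueEquiv A d p x = p.1 ⟨x, hx⟩ := by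
  simp [glueEquiv, glue, hx]

theorem glueEquiv_of_notMem {A : Finset V} (p : ({x // x ∈ A} → Fin d) × ({x // x ∉ A} → Fin d))
    {x : V} (hx : x ∉ A) : glueEquiv A d p x = p.2 ⟨x, hx⟩ := by
  simp [glueEquiv, glue, hx]

open Classical in
/-- The sites of `S` inside `A`. -/
noncomputable def sitesIn (A : Finset V) (S : Set V) : Finset V := A.filter (· ∈ S)

open Classical in
theorem card_config_in (A : Finset V) (S : Set V) (d : ℕ) :
    Fintype.card ({y : {x // x ∈ A} // y.1 ∈ S} → Fin d) = d ^ (sitesIn A S).card := by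
  rw [Fintype.card_fun, Fintype.card_fin]
  congr 1
  rw [← Fintype.card_coe]
  refine Fintype.card_congr ⟨fun y => ⟨y.1.1, ?_⟩, fun y => ⟨⟨y.1, ?_⟩, ?_⟩, fun _ => rfl,
    fun _ => rfl⟩
  · exact Finset.mem_filter.2 ⟨y.1.2, y.2⟩
  · have := y.2; simp only [sitesIn, Finset.mem_filter] at this; exact this.1
  · have := y.2; simp only [sitesIn, Finset.mem_filter] at this; exact this.2

variable [Fintype V]

theorem opNorm_eq (M : QuditOp V d) : opNorm M = ‖M‖ := rfl

theorem opNorm_nonneg (M : QuditOp V d) : 0 ≤ opNorm M := norm_nonneg _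

theorem opNorm_sub_le (M N : QuditOp V d) : opNorm (M - N) ≤ opNorm M + opNorm N :=
  norm_sub_le M N

theorem reduced_eq_ptr (A : Finset V) (M : QuditOp V d) :
    reduced A M = ptr (M.submatrix (glueEquiv A d) (glueEquiv A d)) := rfl

theorem trace_reduced (A : Finset V) (M : QuditOp V d) : (reduced A M).trace = M.trace := by
  rw [reduced_eq_ptr, trace_ptr, Matrix.trace_submatrix_equiv]

theorem posSemidef_reduced (A : Finset V) {M : QuditOp V d} (h : M.PosSemidef) :
    (reduced A M).PosSemidef := by
  rw [reduced_eq_ptr]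
  exact (h.submatrix _).ptr

open Classical in
/-- The sites of `S` outside `A`. -/
noncomputable def sitesOut (A : Finset V) (S : Set V) : Finset V := Aᶜ.filter (· ∈ S)

/-- The number of sites of `S` on the side of the boundary of `A` that has fewer of them. -/
noncomputable def cutSize (A : Finset V) (S : Set V) : ℕ :=
  min (sitesIn A S).card (sitesOut A S).card

open Classical in
theorem card_config_out (A : Finset V) (S : Set V) (d : ℕ) :
    Fintype.card ({y : {x // x ∉ A} // y.1 ∈ S} → Fin d) = d ^ (sitesOut A S).card := by
  rw [Fintype.card_fun, Fintype.card_fin]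
  congr 1
  rw [← Fintype.card_coe]
  refine Fintype.card_congr ⟨fun y => ⟨y.1.1, ?_⟩, fun y => ⟨⟨y.1, ?_⟩, ?_⟩, fun _ => rfl,
    fun _ => rfl⟩
  · exact Finset.mem_filter.2 ⟨Finset.mem_compl.2 y.1.2, y.2⟩
  · have := y.2; simp only [sitesOut, Finset.mem_filter, Finset.mem_compl] at this; exact this.1
  · have := y.2; simp only [sitesOut, Finset.mem_filter, Finset.mem_compl] at this; exact this.2

/-- The pairing of an operator `F` on `A` with the commutator of `h` and `ρ`. -/
noncomputable def commPairing (A : Finset V) (F : QuditOp {x // x ∈ A} d) (h ρ : QuditOp V d) : ℂ :=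
  (F * reduced A (h * ρ - ρ * h)).trace

theorem commPairing_eq (A : Finset V) (F : QuditOp {x // x ∈ A} d) (h ρ : QuditOp V d) :
    commPairing A F h ρ = (F ⊗ₖ (1 : QuditOp {x // x ∉ A} d) *
      (h.submatrix (glueEquiv A d) (glueEquiv A d) * ρ.submatrix (glueEquiv A d) (glueEquiv A d) -
        ρ.submatrix (glueEquiv A d) (glueEquiv A d) *
          h.submatrix (glueEquiv A d) (glueEquiv A d))).trace := by
  rw [trace_kronecker_one_mul, Matrix.submatrix_mul_equiv, Matrix.submatrix_mul_equiv]
  rfl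

theorem commPairing_sum {ι : Type*} (A : Finset V) (F : QuditOp {x // x ∈ A} d) (s : Finset ι)
    (h : ι → QuditOp V d) (ρ : QuditOp V d) :
    commPairing A F (∑ i ∈ s, h i) ρ = ∑ i ∈ s, commPairing A F (h i) ρ := by
  simp only [commPairing_eq]
  rw [← Matrix.trace_sum, ← Finset.mul_sum, Finset.sum_sub_distrib, ← Finset.sum_mul,
    ← Finset.mul_sum]
  have : (∑ i ∈ s, h i).submatrix (glueEquiv A d) (glueEquiv A d) =
      ∑ i ∈ s, (h i).submatrix (glueEquiv A d) (glueEquiv A d) := by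
    ext; simp [Matrix.sum_apply]
  rw [this]

section

variable [NeZero d]

open Classical in
/-- An operator supported on `S` as an operator on `A` and the rest of `S`. -/
theorem SupportedOn.exists_out {S : Set V} {h : QuditOp V d} (hS : SupportedOn S h) (A : Finset V) :
    ∃ M : Matrix (({x // x ∈ A} → Fin d) × ({y : {x // x ∉ A} // y.1 ∈ S} → Fin d))
        (({x // x ∈ A} → Fin d) × ({y : {x // x ∉ A} // y.1 ∈ S} → Fin d)) ℂ,
      ‖M‖ ≤ opNorm h ∧ ∀ i q i' q', h (glueEquiv A d (i, q)) (glueEquiv A d (i', q')) =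
        if (Equiv.piEquivPiSubtypeProd (fun y : {x // x ∉ A} => y.1 ∈ S) (fun _ => Fin d) q).2 =
            (Equiv.piEquivPiSubtypeProd (fun y : {x // x ∉ A} => y.1 ∈ S) (fun _ => Fin d) q').2
        then M (i, (Equiv.piEquivPiSubtypeProd (fun y : {x // x ∉ A} => y.1 ∈ S)
            (fun _ => Fin d) q).1)
          (i', (Equiv.piEquivPiSubtypeProd (fun y : {x // x ∉ A} => y.1 ∈ S) (fun _ => Fin d) q').1)
        else 0 := by
  set e := Equiv.piEquivPiSubtypeProd (fun y : {x // x ∉ A} => y.1 ∈ S) (fun _ => Fin d) with he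
  -- Freezing the sites outside both `A` and `S` at `0` loses nothing, because `h` acts trivially
  -- there, and a submatrix has no larger norm.
  let f : ({x // x ∈ A} → Fin d) × ({y : {x // x ∉ A} // y.1 ∈ S} → Fin d) → V → Fin d :=
    fun p => glueEquiv A d (p.1, e.symm (p.2, fun _ => 0))
  have hf : Function.Injective f := by
    intro p p' h
    have h1 := (glueEquiv A d).injective h
    rw [Prod.mk.injEq, e.symm.injective.eq_iff, Prod.mk.injEq] at h1
    exact Prod.ext h1.1 h1.2.1
  refine ⟨h.submatrix f f, Matrix.l2_opNorm_submatrix_injective_le hf h, fun i q i' q' => ?_⟩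
  split_ifs with hq
  · refine hS.apply_eq (fun x hx => ?_) (fun x hx => ?_) (forall₂_congr fun x hx => ?_)
    · by_cases hA : x ∈ A
      · simp [f, glueEquiv_of_mem, hA]
      · simp [f, glueEquiv_of_notMem, hA, he, hx]
    · by_cases hA : x ∈ A
      · simp [f, glueEquiv_of_mem, hA]
      · simp [f, glueEquiv_of_notMem, hA, he, hx]
    · by_cases hA : x ∈ A
      · simp [f, glueEquiv_of_mem, hA]
      · have := congrFun hq ⟨⟨x, hA⟩, hx⟩
        simp only [he, Equiv.piEquivPiSubtypeProd_apply] at this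
        simp [f, glueEquiv_of_notMem, hA, he, hx, this]
  · obtain ⟨⟨y, hy⟩, hne⟩ := Function.ne_iff.1 hq
    refine hS.apply_eq_zero hy ?_
    simpa [glueEquiv_of_notMem, y.2, he] using hne

open Classical in
/-- An operator supported on `S` as an operator on the complement of `A` and the rest of `S`. -/
theorem SupportedOn.exists_in {S : Set V} {h : QuditOp V d} (hS : SupportedOn S h) (A : Finset V) :
    ∃ M : Matrix (({x // x ∉ A} → Fin d) × ({y : {x // x ∈ A} // y.1 ∈ S} → Fin d))
        (({x // x ∉ A} → Fin d) × ({y : {x // x ∈ A} // y.1 ∈ S} → Fin d)) ℂ,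
      ‖M‖ ≤ opNorm h ∧ ∀ i q i' q', h (glueEquiv A d (i, q)) (glueEquiv A d (i', q')) =
        if (Equiv.piEquivPiSubtypeProd (fun y : {x // x ∈ A} => y.1 ∈ S) (fun _ => Fin d) i).2 =
            (Equiv.piEquivPiSubtypeProd (fun y : {x // x ∈ A} => y.1 ∈ S) (fun _ => Fin d) i').2
        then M (q, (Equiv.piEquivPiSubtypeProd (fun y : {x // x ∈ A} => y.1 ∈ S)
            (fun _ => Fin d) i).1)
          (q', (Equiv.piEquivPiSubtypeProd (fun y : {x // x ∈ A} => y.1 ∈ S) (fun _ => Fin d) i').1)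
        else 0 := by
  set e := Equiv.piEquivPiSubtypeProd (fun y : {x // x ∈ A} => y.1 ∈ S) (fun _ => Fin d) with he
  let f : ({x // x ∉ A} → Fin d) × ({y : {x // x ∈ A} // y.1 ∈ S} → Fin d) → V → Fin d :=
    fun p => glueEquiv A d (e.symm (p.2, fun _ => 0), p.1)
  have hf : Function.Injective f := by
    intro p p' h
    have h1 := (glueEquiv A d).injective h
    rw [Prod.mk.injEq, e.symm.injective.eq_iff, Prod.mk.injEq] at h1
    exact Prod.ext h1.2 h1.1.1
  refine ⟨h.submatrix f f, Matrix.l2_opNorm_submatrix_injective_le hf h, fun i q i' q' => ?_⟩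
  split_ifs with hq
  · refine hS.apply_eq (fun x hx => ?_) (fun x hx => ?_) (forall₂_congr fun x hx => ?_)
    · by_cases hA : x ∈ A
      · simp [f, glueEquiv_of_mem, hA, he, hx]
      · simp [f, glueEquiv_of_notMem, hA]
    · by_cases hA : x ∈ A
      · simp [f, glueEquiv_of_mem, hA, he, hx]
      · simp [f, glueEquiv_of_notMem, hA]
    · by_cases hA : x ∈ A
      · have := congrFun hq ⟨⟨x, hA⟩, hx⟩
        simp only [he, Equiv.piEquivPiSubtypeProd_apply] at this
        simp [f, glueEquiv_of_mem, hA, he, hx, this]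
      · simp [f, glueEquiv_of_notMem, hA]
  · obtain ⟨⟨y, hy⟩, hne⟩ := Function.ne_iff.1 hq
    refine hS.apply_eq_zero hy ?_
    simpa [glueEquiv_of_mem, y.2, he] using hne

/-- The small incremental entangling bound. -/
theorem norm_commPairing_log_le {S : Set V} {h : QuditOp V d} (hS : SupportedOn S h) (A : Finset V)
    {ρ : QuditOp V d} (hρ : IsDensityMatrix ρ) :
    ‖commPairing A (cfc Real.log (reduced A ρ)) h ρ‖ ≤
      36 * opNorm h * (cutSize A S * Real.log d) := by
  classical
  have hpos := hρ.1.submatrix (glueEquiv A d)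
  have htr : (ρ.submatrix (glueEquiv A d) (glueEquiv A d)).trace = 1 := by
    rw [Matrix.trace_submatrix_equiv, hρ.2]
  have hlog : 0 ≤ Real.log d := Real.log_natCast_nonneg d
  rw [commPairing_eq, reduced_eq_ptr]
  -- The entangling bound is available with the dimension of either side; the smaller one is taken.
  rcases le_total (sitesIn A S).card (sitesOut A S).card with hle | hle
  · obtain ⟨M, hM, hM'⟩ := hS.exists_in A
    have := norm_trace_log_commutator_le_left
      ((Equiv.piEquivPiSubtypeProd (fun y : {x // x ∈ A} => y.1 ∈ S) (fun _ => Fin d)).trans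
        (Equiv.prodComm _ _)) M (h.submatrix (glueEquiv A d) (glueEquiv A d)) hM' hpos htr
    rw [card_config_in, Nat.cast_pow, Real.log_pow] at this
    rw [cutSize, min_eq_left hle]
    refine this.trans ?_
    gcongr
  · obtain ⟨M, hM, hM'⟩ := hS.exists_out A
    have := norm_trace_log_commutator_le_right
      (Equiv.piEquivPiSubtypeProd (fun y : {x // x ∉ A} => y.1 ∈ S) (fun _ => Fin d))
      M (h.submatrix (glueEquiv A d) (glueEquiv A d)) hM' hpos htr
    rw [card_config_out, Nat.cast_pow, Real.log_pow] at this
    rw [cutSize, min_eq_right hle]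
    refine this.trans ?_
    gcongr

theorem norm_commPairing_rpow_le {α : ℝ} (hα : 1 < α) {S : Set V} {h : QuditOp V d}
    (hS : SupportedOn S h) (A : Finset V) {ρ : QuditOp V d} (hρ : IsDensityMatrix ρ) :
    ‖commPairing A (cfc (fun x : ℝ => x ^ (α - 1)) (reduced A ρ)) h ρ‖ ≤
      2 * d ^ (sitesOut A S).card * (cfc (fun x : ℝ => x ^ α) (reduced A ρ)).trace.re *
        opNorm h := by
  classical
  obtain ⟨M, hM, hM'⟩ := hS.exists_out A
  have := norm_trace_rpow_commutator_le_right hα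
    (Equiv.piEquivPiSubtypeProd (fun y : {x // x ∉ A} => y.1 ∈ S) (fun _ => Fin d))
    M (h.submatrix (glueEquiv A d) (glueEquiv A d)) hM' (hρ.1.submatrix (glueEquiv A d))
  rw [card_config_out, Nat.cast_pow] at this
  rw [commPairing_eq, reduced_eq_ptr]
  refine this.trans ?_
  have hT : 0 ≤ (cfc (fun x : ℝ => x ^ α) (ptr (ρ.submatrix (glueEquiv A d)
      (glueEquiv A d)))).trace.re := by
    have hp := (hρ.1.submatrix (glueEquiv A d)).ptr
    rw [hp.1.trace_cfc, Complex.ofReal_re]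
    exact Finset.sum_nonneg fun i _ => Real.rpow_nonneg (hp.eigenvalues_nonneg i) _
  gcongr

/-- Interactions outside of `A` do not contribute. -/
theorem commPairing_eq_zero_of_sitesIn {S : Set V} {h : QuditOp V d} (hS : SupportedOn S h)
    {A : Finset V} (hA : (sitesIn A S).card = 0) (F : QuditOp {x // x ∈ A} d) (ρ : QuditOp V d) :
    commPairing A F h ρ = 0 := by
  classical
  have hnot : ∀ x ∈ A, x ∉ S := by
    simpa [sitesIn, Finset.filter_eq_empty_iff] using hA
  set h' := h.submatrix (glueEquiv A d) (glueEquiv A d) with hh'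
  -- `h'` acts only on the complement of `A`, so it commutes with `F ⊗ 1` and the pairing vanishes
  -- by cyclicity.
  have hcomm : h' * F ⊗ₖ (1 : QuditOp {x // x ∉ A} d) = F ⊗ₖ (1 : QuditOp {x // x ∉ A} d) * h' := by
    have hK : h' = (1 : QuditOp {x // x ∈ A} d) ⊗ₖ
        (Matrix.of fun q q' => h' (fun _ => 0, q) (fun _ => 0, q')) := by
      ext ⟨i, q⟩ ⟨i', q'⟩
      rw [Matrix.kroneckerMap_apply, Matrix.one_apply]
      split_ifs with hi
      · subst hi
        rw [one_mul, Matrix.of_apply]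
        refine hS.apply_eq (fun x hx => ?_) (fun x hx => ?_) (forall₂_congr fun x hx => ?_)
        · have hxA : x ∉ A := fun hxA => hnot x hxA hx
          simp [glueEquiv_of_notMem, hxA]
        · have hxA : x ∉ A := fun hxA => hnot x hxA hx
          simp [glueEquiv_of_notMem, hxA]
        · by_cases hxA : x ∈ A
          · simp [glueEquiv_of_mem, hxA]
          · simp [glueEquiv_of_notMem, hxA]
      · obtain ⟨x, hx⟩ := Function.ne_iff.1 hi
        rw [zero_mul]
        refine hS.apply_eq_zero (hnot x x.2) ?_
        simpa [glueEquiv_of_mem, x.2] using hx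
    rw [hK, ← Matrix.mul_kronecker_mul, ← Matrix.mul_kronecker_mul]
    simp
  rw [commPairing_eq, Matrix.mul_sub, Matrix.trace_sub, ← Matrix.mul_assoc, ← hcomm,
    Matrix.mul_assoc, Matrix.trace_mul_comm h', Matrix.mul_assoc, sub_self]

/-- Interactions inside of `A` do not contribute. -/
theorem commPairing_eq_zero_of_sitesOut {S : Set V} {h : QuditOp V d} (hS : SupportedOn S h)
    {A : Finset V} (hA : (sitesOut A S).card = 0) (f : ℝ → ℝ) {ρ : QuditOp V d}
    (hρ : ρ.PosSemidef) : commPairing A (cfc f (reduced A ρ)) h ρ = 0 := by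
  classical
  have hnot : ∀ x, x ∉ A → x ∉ S := by
    simpa [sitesOut, Finset.filter_eq_empty_iff] using hA
  set h' := h.submatrix (glueEquiv A d) (glueEquiv A d) with hh'
  have hK : h' = (Matrix.of fun i i' => h' (i, fun _ => 0) (i', fun _ => 0)) ⊗ₖ
      (1 : QuditOp {x // x ∉ A} d) := by
    ext ⟨i, q⟩ ⟨i', q'⟩
    rw [Matrix.kroneckerMap_apply, Matrix.one_apply]
    split_ifs with hi
    · subst hi
      rw [mul_one, Matrix.of_apply]
      refine hS.apply_eq (fun x hx => ?_) (fun x hx => ?_) (forall₂_congr fun x hx => ?_)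
      · have hxA : x ∈ A := by_contra fun hxA => hnot x hxA hx
        simp [glueEquiv_of_mem, hxA]
      · have hxA : x ∈ A := by_contra fun hxA => hnot x hxA hx
        simp [glueEquiv_of_mem, hxA]
      · by_cases hxA : x ∈ A
        · simp [glueEquiv_of_mem, hxA]
        · simp [glueEquiv_of_notMem, hxA]
    · obtain ⟨x, hx⟩ := Function.ne_iff.1 hi
      rw [mul_zero]
      refine hS.apply_eq_zero (hnot x x.2) ?_
      simpa [glueEquiv_of_notMem, x.2] using hx
  have hherm : (reduced A ρ).IsHermitian := (posSemidef_reduced A hρ).1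
  -- An operator inside `A` does change `ρ_A`, but by a commutator with `ρ_A`, whose pairing with
  -- any function of `ρ_A` vanishes.
  have hcomm : cfc f (reduced A ρ) * reduced A ρ = reduced A ρ * cfc f (reduced A ρ) := by
    obtain ⟨p, hp, -⟩ := exists_polynomial_cfc_eq hherm hherm f
    rw [hp]
    simpa using congrArg (Polynomial.aeval (reduced A ρ)) (mul_comm p Polynomial.X)
  rw [commPairing_eq, trace_kronecker_one_mul, ← hh', hK, ptr_sub, ptr_kronecker_one_mul,
    ptr_mul_kronecker_one, ← reduced_eq_ptr, Matrix.mul_sub, Matrix.trace_sub, ← Matrix.mul_assoc,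
    Matrix.trace_mul_cycle, ← hcomm, ← Matrix.mul_assoc, sub_self]

end

end Qudits

/-! ### The rate of change of the entropy -/

section Rate

open scoped Matrix.Norms.L2Operator
open Matrix Filter Topology

variable {V : Type} [Fintype V] [DecidableEq V] {d : ℕ}

theorem evolve_eq (H ρ : QuditOp V d) (t : ℝ) :
    evolve H ρ t = NormedSpace.exp (t • (-(Complex.I • H))) * ρ *
      NormedSpace.exp (t • (Complex.I • H)) := by
  have : t • (Complex.I • H) = (Complex.I * t) • H := by
    rw [mul_comm, mul_smul]
    rfl
  rw [evolve, smul_neg, this, neg_smul]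

theorem contDiff_evolve (H ρ : QuditOp V d) : ContDiff ℝ 2 (evolve H ρ) := by
  have hexp : ∀ X : QuditOp V d, ContDiff ℝ 2 fun t : ℝ => NormedSpace.exp (t • X) := fun X =>
    contDiff_iff_contDiffAt.2 fun t => ContDiffAt.comp t
      (NormedSpace.exp_analytic (𝕂 := ℝ) (t • X)).contDiffAt (by fun_prop)
  have : evolve H ρ = fun t => NormedSpace.exp (t • (-(Complex.I • H))) * ρ *
      NormedSpace.exp (t • (Complex.I • H)) := funext (evolve_eq H ρ)
  rw [this]
  exact ((hexp _).mul contDiff_const).mul (hexp _)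

theorem hasDerivAt_evolve (H ρ : QuditOp V d) (t : ℝ) :
    HasDerivAt (evolve H ρ) ((-Complex.I) • (H * evolve H ρ t - evolve H ρ t * H)) t := by
  have : evolve H ρ = fun t => NormedSpace.exp (t • (-(Complex.I • H))) * ρ *
      NormedSpace.exp (t • (Complex.I • H)) := funext (evolve_eq H ρ)
  rw [this]
  have h1 := hasDerivAt_exp_smul_const' (𝕂 := ℝ) (-(Complex.I • H)) t
  have h2 := hasDerivAt_exp_smul_const (𝕂 := ℝ) (Complex.I • H) t
  refine ((h1.mul_const ρ).mul h2).congr_deriv ?_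
  simp only [smul_sub, neg_smul, Matrix.neg_mul, Matrix.smul_mul, Matrix.mul_smul, Matrix.mul_assoc]
  abel

theorem isDensityMatrix_evolve {H ρ : QuditOp V d} (hH : H.IsHermitian) (hρ : IsDensityMatrix ρ)
    (t : ℝ) : IsDensityMatrix (evolve H ρ t) := by
  have hct : NormedSpace.exp (t • (-(Complex.I • H))) =
      (NormedSpace.exp (t • (Complex.I • H)))ᴴ := by
    rw [← Matrix.exp_conjTranspose]
    congr 1
    rw [Matrix.conjTranspose_smul, Matrix.conjTranspose_smul, hH.eq]
    simp
  have hinv : NormedSpace.exp (t • (Complex.I • H)) * NormedSpace.exp (t • (-(Complex.I • H))) =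
      1 := by
    rw [← Matrix.exp_add_of_commute]
    · simp
    · rw [smul_neg]
      exact (Commute.refl _).neg_right
  refine ⟨?_, ?_⟩
  · rw [evolve_eq, hct]
    exact hρ.1.conjTranspose_mul_mul_same _
  · rw [evolve_eq, Matrix.trace_mul_comm, ← Matrix.mul_assoc, hinv, Matrix.one_mul, hρ.2]

/-- The partial trace as a continuous linear map. -/
noncomputable def reducedL (A : Finset V) (d : ℕ) :
    QuditOp V d →L[ℝ] QuditOp {x // x ∈ A} d :=
  LinearMap.toContinuousLinearMap
    { toFun := reduced A
      map_add' := fun M N => by ext; simp [reduced, Finset.sum_add_distrib]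
      map_smul' := fun c M => by ext; simp [reduced, Finset.mul_sum] }

theorem reduced_smul (A : Finset V) (c : ℂ) (M : QuditOp V d) :
    reduced A (c • M) = c • reduced A M := by
  ext
  simp [reduced, Finset.mul_sum]

theorem contDiff_reduced_evolve (H ρ : QuditOp V d) (A : Finset V) :
    ContDiff ℝ 2 fun t => reduced A (evolve H ρ t) :=
  (reducedL A d).contDiff.comp (contDiff_evolve H ρ)

theorem deriv_reduced_evolve (H ρ : QuditOp V d) (A : Finset V) (t : ℝ) :
    deriv (fun t => reduced A (evolve H ρ t)) t =
      (-Complex.I) • reduced A (H * evolve H ρ t - evolve H ρ t * H) := by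
  rw [← reduced_smul]
  exact ((reducedL A d).hasFDerivAt.comp_hasDerivAt t (hasDerivAt_evolve H ρ t)).deriv

theorem abs_re_neg_I_mul_le (z : ℂ) : |((-Complex.I) * z).re| ≤ ‖z‖ := by
  refine (Complex.abs_re_le_norm _).trans ?_
  simp

/-- The derivative of the trace of a function of the reduced density matrix. -/
theorem hasDerivAt_trace_cfc_reduced {H ρ : QuditOp V d} (hH : H.IsHermitian)
    (hρ : IsDensityMatrix ρ) (A : Finset V) {f g : ℝ → ℝ} (hf0 : f 0 = 0)
    (hfO : f =O[𝓝[Set.Icc 0 1] 0] fun x => x ^ (3 / 4 : ℝ))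
    (hfd : ∀ x, 0 < x → ContDiffAt ℝ 2 f x) (hg : ∀ x, 0 < x → g x = deriv f x) (t : ℝ) :
    HasDerivAt (fun t => (cfc f (reduced A (evolve H ρ t))).trace.re)
      ((-Complex.I) * commPairing A (cfc g (reduced A (evolve H ρ t))) H (evolve H ρ t)).re t := by
  have h := hasDerivAt_trace_cfc (contDiff_reduced_evolve H ρ A)
    (fun t => posSemidef_reduced A (isDensityMatrix_evolve hH hρ t).1)
    (fun t => by rw [trace_reduced, (isDensityMatrix_evolve hH hρ t).2]) hf0 hfO hfd hg t
  rw [deriv_reduced_evolve] at h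
  convert h using 2
  rw [commPairing, Matrix.mul_smul, Matrix.trace_smul, smul_eq_mul]

theorem trace_reduced_commutator (A : Finset V) (H ρ : QuditOp V d) :
    (reduced A (H * ρ - ρ * H)).trace = 0 := by
  rw [trace_reduced, Matrix.trace_sub, Matrix.trace_mul_comm, sub_self]

/-- The exponent `3 / 4` is below `1`, to absorb the logarithm, and above `1 / 2`, so that a
second-order quantity raised to it is still `o(t - t₀)` in `hasDerivAt_trace_cfc`. -/
theorem mul_log_isBigO :
    (fun x : ℝ => x * Real.log x) =O[𝓝[Set.Icc 0 1] 0] fun x => x ^ (3 / 4 : ℝ) := by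
  refine Asymptotics.IsBigO.of_bound 4 (eventually_mem_nhdsWithin.mono fun x hx => ?_)
  rcases hx.1.eq_or_lt with rfl | h0
  · simp
  have h1 := (Real.abs_log_mul_self_rpow_lt x (1 / 4) h0 hx.2 (by norm_num)).le
  have h2 : 0 ≤ x ^ (3 / 4 : ℝ) := Real.rpow_nonneg h0.le _
  have h3 : x * Real.log x = Real.log x * x ^ (1 / 4 : ℝ) * x ^ (3 / 4 : ℝ) := by
    rw [mul_assoc, ← Real.rpow_add h0]
    norm_num
    ring
  rw [h3, norm_mul, Real.norm_eq_abs, Real.norm_eq_abs (x ^ _), abs_of_nonneg h2]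
  exact mul_le_mul_of_nonneg_right (h1.trans_eq (by norm_num)) h2

theorem rpow_isBigO {α : ℝ} (hα : 1 < α) :
    (fun x : ℝ => x ^ α) =O[𝓝[Set.Icc 0 1] 0] fun x => x ^ (3 / 4 : ℝ) := by
  refine Asymptotics.IsBigO.of_bound 1 (eventually_mem_nhdsWithin.mono fun x hx => ?_)
  rw [one_mul, Real.norm_of_nonneg (Real.rpow_nonneg hx.1 _),
    Real.norm_of_nonneg (Real.rpow_nonneg hx.1 _)]
  rcases hx.1.eq_or_lt with rfl | h0
  · rw [Real.zero_rpow (by linarith), Real.zero_rpow (by norm_num)]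
  · exact Real.rpow_le_rpow_of_exponent_ge h0 hx.2 (by linarith)

theorem cfc_log_add_one {n : Type*} [Fintype n] [DecidableEq n] {B : Matrix n n ℂ}
    (hB : B.IsHermitian) : cfc (fun x : ℝ => Real.log x + 1) B = cfc Real.log B + 1 := by
  have hc : ∀ f : ℝ → ℝ, ContinuousOn f (spectrum ℝ B) := fun f =>
    Set.Finite.continuousOn (Matrix.finite_real_spectrum) f
  rw [cfc_add (a := B) Real.log (fun _ => 1) (hc _) (hc _), cfc_const_one ℝ B hB.isSelfAdjoint]

theorem trace_cfc_rpow_pos {n : Type*} [Fintype n] [DecidableEq n] {B : Matrix n n ℂ}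
    (hB : B.PosSemidef) (htr : B.trace = 1) (α : ℝ) :
    0 < (cfc (fun x : ℝ => x ^ α) B).trace.re := by
  rw [hB.1.trace_cfc, Complex.ofReal_re]
  have h : ∃ i, hB.1.eigenvalues i ≠ 0 := by
    by_contra! h
    have := hB.1.trace_eq_sum_eigenvalues
    simp [h, htr] at this
  obtain ⟨i, hi⟩ := h
  exact Finset.sum_pos' (fun j _ => Real.rpow_nonneg (hB.eigenvalues_nonneg j) _)
    ⟨i, Finset.mem_univ i, Real.rpow_pos_of_pos ((hB.eigenvalues_nonneg i).lt_of_ne' hi) _⟩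

theorem EntropyRateLE.mono {H ρ : QuditOp V d} {A : Finset V} {α B B' : ℝ}
    (h : EntropyRateLE H ρ A α B) (hB : B ≤ B') : EntropyRateLE H ρ A α B' :=
  fun t => ⟨(h t).1, (h t).2.trans hB⟩

variable [NeZero d]

/-- The constant in the derivative `log x + 1` pairs with a commutator of trace zero, and the rest
is linear in the Hamiltonian. The single pieces need not be Hermitian. -/
theorem entropyRateLE_one {ι : Type*} {s : Finset ι} {S : ι → Set V} {k : ι → QuditOp V d}
    (hS : ∀ j ∈ s, SupportedOn (S j) (k j)) (hH : (∑ j ∈ s, k j).IsHermitian) {ρ : QuditOp V d}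
    (hρ : IsDensityMatrix ρ) (A : Finset V) :
    EntropyRateLE (∑ j ∈ s, k j) ρ A 1 (∑ j ∈ s, 36 * opNorm (k j) *
      (cutSize A (S j) * Real.log d)) := by
  set H := ∑ j ∈ s, k j with hHdef
  intro t
  have hρt := isDensityMatrix_evolve hH hρ t
  have hder := (hasDerivAt_trace_cfc_reduced hH hρ A (f := fun x => x * Real.log x)
    (g := fun x => Real.log x + 1) (by simp) mul_log_isBigO
    (fun x hx => contDiffAt_id.mul (Real.contDiffAt_log.2 hx.ne'))
    (fun x hx => (Real.deriv_mul_log hx.ne').symm) t).neg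
  have hpair : commPairing A (cfc (fun x => Real.log x + 1) (reduced A (evolve H ρ t))) H
      (evolve H ρ t) = commPairing A (cfc Real.log (reduced A (evolve H ρ t))) H
      (evolve H ρ t) := by
    rw [cfc_log_add_one (posSemidef_reduced A hρt.1).1, commPairing, Matrix.add_mul,
      Matrix.trace_add, Matrix.one_mul, trace_reduced_commutator, add_zero, commPairing]
  have hfun : entropyAt H ρ A 1 = fun t =>
      -(cfc (fun x => x * Real.log x) (reduced A (evolve H ρ t))).trace.re :=
    funext fun t => by rw [entropyAt, renyiEntropy, if_pos rfl]
  rw [hfun]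
  refine ⟨hder.differentiableAt, ?_⟩
  have hd := hder.deriv
  simp only [Pi.neg_def] at hd
  rw [hd, abs_neg, hpair]
  refine (abs_re_neg_I_mul_le _).trans ?_
  rw [hHdef, commPairing_sum, ← hHdef]
  exact (norm_sum_le _ _).trans
    (Finset.sum_le_sum fun j hj => norm_commPairing_log_le (hS j hj) A hρt)

/-- The denominator `Tr ρ_A ^ α` of the logarithmic derivative cancels against the same factor in
the bound for one piece. Pieces on one side of the cut are removed beforehand, since that bound does
not vanish for them. -/
theorem entropyRateLE_renyi {α : ℝ} (hα : 1 < α) {ι : Type*} {s : Finset ι} {S : ι → Set V}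
    {k : ι → QuditOp V d} (hS : ∀ j ∈ s, SupportedOn (S j) (k j))
    (hH : (∑ j ∈ s, k j).IsHermitian) {ρ : QuditOp V d} (hρ : IsDensityMatrix ρ) (A : Finset V) :
    EntropyRateLE (∑ j ∈ s, k j) ρ A α (α / (α - 1) * ∑ j ∈ s,
      if cutSize A (S j) = 0 then 0
      else 2 * (d : ℝ) ^ (sitesOut A (S j)).card * opNorm (k j)) := by
  set H := ∑ j ∈ s, k j with hHdef
  intro t
  have hρt := isDensityMatrix_evolve hH hρ t
  have hder := hasDerivAt_trace_cfc_reduced hH hρ A (f := fun x : ℝ => x ^ α)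
    (g := fun x : ℝ => α * x ^ (α - 1)) (Real.zero_rpow (by linarith)) (rpow_isBigO hα)
    (fun x hx => Real.contDiffAt_rpow_const_of_ne hx.ne')
    (fun x hx => (Real.hasDerivAt_rpow_const (Or.inl hx.ne')).deriv.symm) t
  have hT := trace_cfc_rpow_pos (posSemidef_reduced A hρt.1)
    (by rw [trace_reduced, hρt.2]) α
  set T := (cfc (fun x : ℝ => x ^ α) (reduced A (evolve H ρ t))).trace.re with hTdef
  have hpair : commPairing A (cfc (fun x : ℝ => α * x ^ (α - 1)) (reduced A (evolve H ρ t))) H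
      (evolve H ρ t) =
      α * commPairing A (cfc (fun x : ℝ => x ^ (α - 1)) (reduced A (evolve H ρ t))) H
        (evolve H ρ t) := by
    have hc : ContinuousOn (fun x : ℝ => x ^ (α - 1)) (spectrum ℝ (reduced A (evolve H ρ t))) :=
      Set.Finite.continuousOn (Matrix.finite_real_spectrum) _
    rw [cfc_const_mul _ _ _ hc, commPairing, commPairing, Matrix.smul_mul, Matrix.trace_smul]
    rfl
  have hfun : entropyAt H ρ A α = fun t =>
      1 / (1 - α) * Real.log (cfc (fun x : ℝ => x ^ α) (reduced A (evolve H ρ t))).trace.re :=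
    funext fun t => by rw [entropyAt, renyiEntropy, if_neg hα.ne']
  have hd := (hder.log hT.ne').const_mul (1 / (1 - α))
  rw [hfun]
  refine ⟨hd.differentiableAt, ?_⟩
  rw [hd.deriv, hpair, abs_mul, ← hTdef, abs_div _ T, abs_of_pos hT, abs_div, abs_one,
    abs_of_neg (by linarith : 1 - α < 0), neg_sub, mul_left_comm, Complex.re_ofReal_mul, abs_mul,
    abs_of_pos (by linarith : 0 < α)]
  have hbound : |(-Complex.I * commPairing A (cfc (fun x : ℝ => x ^ (α - 1))
      (reduced A (evolve H ρ t))) H (evolve H ρ t)).re| ≤ T * ∑ j ∈ s,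
      if cutSize A (S j) = 0 then 0
      else 2 * (d : ℝ) ^ (sitesOut A (S j)).card * opNorm (k j) := by
    refine (abs_re_neg_I_mul_le _).trans ?_
    rw [hHdef, commPairing_sum, ← hHdef, Finset.mul_sum]
    refine (norm_sum_le _ _).trans (Finset.sum_le_sum fun j hj => ?_)
    split_ifs with h0
    · rw [mul_zero]
      rcases Nat.min_eq_zero_iff.1 h0 with h0 | h0
      · rw [commPairing_eq_zero_of_sitesIn (hS j hj) h0, norm_zero]
      · rw [commPairing_eq_zero_of_sitesOut (hS j hj) h0 _ hρt.1, norm_zero]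
    · refine (norm_commPairing_rpow_le hα (hS j hj) A hρt).trans_eq ?_
      rw [← hTdef]
      ring
  have h1 : 0 < α - 1 := by linarith
  calc _ = α / (α - 1) * (|(-Complex.I * commPairing A (cfc (fun x : ℝ => x ^ (α - 1))
      (reduced A (evolve H ρ t))) H (evolve H ρ t)).re| / T) := by ring
    _ ≤ _ := by
      refine mul_le_mul_of_nonneg_left ?_ (by positivity)
      rw [div_le_iff₀ hT, mul_comm _ T]
      exact hbound

end Rate

/-! ### Decomposing a Hamiltonian into contributions of single sites -/

section Restrict

open scoped Matrix.Norms.L2Operator Kronecker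

variable {V : Type} [DecidableEq V] {d : ℕ} [NeZero d]

/-- The compression `(1 ⊗ ⟨0|) M (1 ⊗ |0⟩) ⊗ 1` that makes `M` act trivially on the site `x`. -/
noncomputable def compressAt (x : V) : QuditOp V d →+ QuditOp V d where
  toFun M := Matrix.of fun σ τ =>
    if σ x = τ x then M (Function.update σ x 0) (Function.update τ x 0) else 0
  map_zero' := by ext; simp
  map_add' M N := by
    ext σ τ
    by_cases h : σ x = τ x <;> simp [h]

theorem compressAt_apply (x : V) (M : QuditOp V d) (σ τ : V → Fin d) : compressAt x M σ τ =
    if σ x = τ x then M (Function.update σ x 0) (Function.update τ x 0) else 0 := rfl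

theorem SupportedOn.compressAt {S : Set V} {M : QuditOp V d} (h : SupportedOn S M) (x : V) :
    SupportedOn (S \ {x}) (compressAt x M) := by
  refine supportedOn_of_apply_eq (fun σ τ y hy hne => ?_) fun σ τ σ' τ' h1 h2 h3 h4 => ?_
  · rw [compressAt_apply]
    split_ifs with hx
    · have hyx : y ≠ x := by
        rintro rfl
        exact hne hx
      refine h.apply_eq_zero (fun hyS => hy ⟨hyS, hyx⟩) ?_
      simpa [hyx] using hne
    · rfl
  · have hx : x ∉ S \ {x} := fun hx => hx.2 rfl
    rw [compressAt_apply, compressAt_apply, if_pos (h3 x hx), if_pos (h4 x hx)]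
    have hupd : ∀ υ υ' : V → Fin d, (∀ y ∈ S \ {x}, υ y = υ' y) → ∀ y ∈ S,
        Function.update υ x 0 y = Function.update υ' x 0 y := by
      intro υ υ' hυ y hy
      by_cases hyx : y = x
      · simp [hyx]
      · simpa [hyx] using hυ y ⟨hy, hyx⟩
    have hupd' : ∀ υ υ' : V → Fin d, (∀ y, y ∉ S \ {x} → υ y = υ' y) → ∀ y, y ∉ S →
        Function.update υ x 0 y = Function.update υ' x 0 y := by
      intro υ υ' hυ y hy
      by_cases hyx : y = x
      · simp [hyx]
      · simpa [hyx] using hυ y fun hy' => hy hy'.1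
    exact h.apply_eq (hupd _ _ h1) (hupd _ _ h2) ⟨fun _ => hupd' _ _ h4, fun _ => hupd' _ _ h3⟩

theorem compressAt_eq_self {x : V} {M : QuditOp V d} (h : SupportedOn {x}ᶜ M) :
    compressAt x M = M := by
  ext σ τ
  rw [compressAt_apply]
  split_ifs with hx
  · refine h.apply_eq (fun y hy => ?_) (fun y hy => ?_) ⟨fun _ y hy => ?_, fun _ y hy => ?_⟩
    · exact Function.update_of_ne hy _ _
    · exact Function.update_of_ne hy _ _
    · obtain rfl : y = x := by simpa using hy
      exact hx
    · obtain rfl : y = x := by simpa using hy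
      simp
  · exact (h.apply_eq_zero (x := x) (by simp) hx).symm

variable [Fintype V]

theorem opNorm_compressAt_le (x : V) (M : QuditOp V d) : opNorm (compressAt x M) ≤ opNorm M := by
  set e := Equiv.funSplitAt x (Fin d)
  let f : ({y // y ≠ x} → Fin d) → V → Fin d := fun r => e.symm (0, r)
  have hf : Function.Injective f := by
    intro r r' h
    exact (Prod.mk.inj (e.symm.injective h)).2
  have heq : compressAt x M = (M.submatrix f f ⊗ₖ (1 : Matrix (Fin d) (Fin d) ℂ)).submatrix
      (e.trans (Equiv.prodComm _ _)) (e.trans (Equiv.prodComm _ _)) := by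
    have hu : ∀ σ : V → Fin d, f (fun j => σ j) = Function.update σ x 0 := by
      intro σ
      ext y
      by_cases hy : y = x
      · subst hy; simp [f, e]
      · simp [f, e, hy]
    ext σ τ
    rw [compressAt_apply, Matrix.submatrix_apply, Matrix.kroneckerMap_apply, Matrix.one_apply]
    simp [hu, e]
  rw [opNorm_eq, opNorm_eq, heq]
  exact (Matrix.l2_opNorm_submatrix_injective_le (Equiv.injective _) _).trans
    ((Matrix.l2_opNorm_kronecker_one_le _).trans (Matrix.l2_opNorm_submatrix_injective_le hf _))

/-- Summing the `K x` would count interactions repeatedly; telescoping avoids this. If `Φ`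
compresses at all sites of `s`, adding a site `a` changes `H - Φ H` by `Φ (H - compressAt a H)`, and
there `H` may be replaced by the local operator `K a`. Compressions are contractions and do not
enlarge supports. -/
theorem exists_sum_of_compressAt {H : QuditOp V d} {K : V → QuditOp V d} {S : V → Set V}
    (hK : ∀ x, SupportedOn (S x) (K x))
    (hH : ∀ x, H - compressAt x H = K x - compressAt x (K x)) (s : Finset V) :
    ∃ (Φ : QuditOp V d →+ QuditOp V d) (J : V → QuditOp V d),
      (∀ M, opNorm (Φ M) ≤ opNorm M) ∧
      (∀ T M, SupportedOn T M → SupportedOn (T \ s) (Φ M)) ∧ H - Φ H = ∑ x ∈ s, J x ∧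
      ∀ x, SupportedOn (S x) (J x) ∧ opNorm (J x) ≤ 2 * opNorm (K x) := by
  induction s using Finset.induction_on with
  | empty =>
    refine ⟨AddMonoidHom.id _, fun _ => 0, fun _ => le_rfl, fun T M h => by simpa using h,
      by simp, fun x => ⟨supportedOn_zero _, ?_⟩⟩
    rw [opNorm_eq, norm_zero]
    have := opNorm_nonneg (K x)
    positivity
  | insert a s ha ih =>
    obtain ⟨Φ, J, hΦ, hΦS, hsum, hJ⟩ := ih
    refine ⟨Φ.comp (compressAt a), Function.update J a (Φ (K a - compressAt a (K a))),
      fun M => (hΦ _).trans (opNorm_compressAt_le a M), fun T M h => ?_, ?_, fun x => ?_⟩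
    · have := hΦS _ _ (h.compressAt a)
      rwa [Set.sdiff_sdiff, Set.singleton_union, ← Finset.coe_insert] at this
    · rw [Finset.sum_insert ha, Function.update_self, ← hH, map_sub, AddMonoidHom.comp_apply,
        Finset.sum_congr rfl fun x hx =>
          Function.update_of_ne (ne_of_mem_of_not_mem hx ha) _ J, ← hsum]
      abel
    · by_cases hx : x = a
      · subst hx
        rw [Function.update_self]
        refine ⟨(hΦS _ _ ((hK x).sub (((hK x).compressAt x).mono Set.sdiff_subset))).mono
          Set.sdiff_subset, (hΦ _).trans ?_⟩
        rw [two_mul]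
        exact (opNorm_sub_le _ _).trans (add_le_add le_rfl (opNorm_compressAt_le x _))
      · rw [Function.update_of_ne hx]
        exact hJ x

end Restrict

/-! ### Hamiltonians as finite sums, and finite range site by site -/

namespace Interaction

variable {V : Type} [Fintype V] [DecidableEq V] [MetricSpace V] {d : ℕ}

theorem hamiltonian_eq_sum (h : Interaction V d) {N : ℕ} (hN : ∀ i r, N ≤ r → h.term i r = 0) :
    h.hamiltonian = ∑ i, ∑ r ∈ Finset.range N, h.term i r := by
  refine Finset.sum_congr rfl fun i _ => finsum_eq_sum_of_support_subset _ fun r hr => ?_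
  by_contra hlt
  exact hr (hN i r (by simpa using hlt))

theorem exists_forall_term_eq_zero (h : Interaction V d) :
    ∃ N : ℕ, ∀ i r, N ≤ r → h.term i r = 0 := by
  have hb : ∀ i, ∃ n : ℕ, ∀ r, n ≤ r → h.term i r = 0 := fun i => by
    obtain ⟨n, hn⟩ := (h.finite_support i).bddAbove
    refine ⟨n + 1, fun r hr => ?_⟩
    by_contra hne
    have := hn hne
    omega
  choose n hn using hb
  exact ⟨∑ i, n i, fun i r hr =>
    hn i r ((Finset.single_le_sum (fun _ _ => Nat.zero_le _) (Finset.mem_univ i)).trans hr)⟩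

theorem hamiltonian_isHermitian (h : Interaction V d) : h.hamiltonian.IsHermitian := by
  obtain ⟨N, hN⟩ := h.exists_forall_term_eq_zero
  rw [h.hamiltonian_eq_sum hN, Matrix.IsHermitian, Matrix.conjTranspose_sum]
  refine Finset.sum_congr rfl fun i _ => ?_
  rw [Matrix.conjTranspose_sum]
  exact Finset.sum_congr rfl fun r _ => h.isHermitian i r

open Classical in
theorem actingOn_eq_sum (h : Interaction V d) {N : ℕ} (hN : ∀ i r, N ≤ r → h.term i r = 0)
    (x : V) : h.actingOn x =
      ∑ i, ∑ r ∈ Finset.range N, if ActsOn x (h.term i r) then h.term i r else 0 := by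
  refine Finset.sum_congr rfl fun i _ => finsum_eq_sum_of_support_subset _ fun r hr => ?_
  by_contra hlt
  refine hr ?_
  dsimp only
  rw [hN i r (by simpa using hlt), ite_self]

theorem centredAt_eq_sum (h : Interaction V d) {N : ℕ} (hN : ∀ i r, N ≤ r → h.term i r = 0)
    (x : V) : h.centredAt x = ∑ r ∈ Finset.range N, h.term x r := by
  refine finsum_eq_sum_of_support_subset _ fun r hr => ?_
  by_contra hlt
  exact hr (hN x r (by simpa using hlt))

variable [NeZero d]

/-- A term acting on `x` is centred within `R` of `x` and reaches at most `R` further. -/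
theorem supportedOn_actingOn (h : Interaction V d) {R : ℕ} (hR : h.FiniteRange R) (x : V) :
    SupportedOn (Metric.closedBall x ((2 * R : ℕ) : ℝ)) (h.actingOn x) := by
  classical
  rw [h.actingOn_eq_sum (fun i r hr => hR i r (Nat.lt_of_succ_le hr)) x]
  refine .sum _ fun i _ => .sum _ fun r hr => ?_
  split_ifs with hx
  · have hrR : (r : ℝ) ≤ R := by exact_mod_cast Nat.lt_succ_iff.1 (Finset.mem_range.1 hr)
    have hxi : x ∈ Metric.closedBall i (r : ℝ) := by
      by_contra hxi
      refine hx ((h.supportedOn i r).mono fun y hy => ?_)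
      rintro rfl
      exact hxi hy
    refine (h.supportedOn i r).mono (Metric.closedBall_subset_closedBall' ?_)
    rw [Metric.mem_closedBall, dist_comm] at hxi
    push_cast
    linarith
  · exact supportedOn_zero _

/-- Terms acting trivially on `x` are fixed by the compression and cancel. -/
theorem sub_compressAt_hamiltonian (h : Interaction V d) (x : V) :
    h.hamiltonian - compressAt x h.hamiltonian =
      h.actingOn x - compressAt x (h.actingOn x) := by
  classical
  obtain ⟨N, hN⟩ := h.exists_forall_term_eq_zero
  rw [h.hamiltonian_eq_sum hN, h.actingOn_eq_sum hN]
  simp only [map_sum, ← Finset.sum_sub_distrib]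
  refine Finset.sum_congr rfl fun i _ => Finset.sum_congr rfl fun r _ => ?_
  split_ifs with hx
  · rfl
  · rw [compressAt_eq_self (not_not.1 hx), map_zero, sub_self, sub_self]

/-- A finite-range Hamiltonian as a sum of one operator of bounded norm and range for each site,
up to a multiple of the identity. -/
theorem exists_site_decomposition (h : Interaction V d) {R : ℕ} (hR : h.FiniteRange R) {hbar : ℝ}
    (hn : h.SiteNormLE hbar) : ∃ J : Option V → QuditOp V d, h.hamiltonian = ∑ j, J j ∧
      SupportedOn ∅ (J none) ∧ ∀ x,
        SupportedOn (Metric.closedBall x ((2 * R : ℕ) : ℝ)) (J (some x)) ∧ opNorm (J (some x)) ≤ 2 * hbar := by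
  rcases hn with hn | hn
  · obtain ⟨Φ, J, -, hΦ, hsum, hJ⟩ := exists_sum_of_compressAt (h.supportedOn_actingOn hR)
      h.sub_compressAt_hamiltonian Finset.univ
    -- The remainder, compressed at every site, has empty support and will not contribute to the
    -- rate.
    refine ⟨fun j => j.elim (Φ h.hamiltonian) J, ?_, ?_, fun x => ⟨(hJ x).1, ?_⟩⟩
    · rw [Fintype.sum_option, ← sub_eq_iff_eq_add']
      exact hsum
    · simpa using hΦ Set.univ _ (supportedOn_univ h.hamiltonian)
    · exact (hJ x).2.trans (by linarith [hn x])
  -- Terms grouped by centre already partition the Hamiltonian; the radius `2 * R` and the factor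
  -- `2` only match the other case.
  · have hN : ∀ i r, R + 1 ≤ r → h.term i r = 0 := fun i r hr => hR i r (Nat.lt_of_succ_le hr)
    refine ⟨fun j => j.elim 0 h.centredAt, ?_, supportedOn_zero _, fun x => ⟨?_, ?_⟩⟩
    · rw [Fintype.sum_option]
      exact (zero_add _).symm
    · change SupportedOn _ (h.centredAt x)
      rw [h.centredAt_eq_sum hN]
      refine .sum _ fun r hr => (h.supportedOn x r).mono (Metric.closedBall_subset_closedBall ?_)
      have := Finset.mem_range.1 hr
      exact_mod_cast (by omega : r ≤ 2 * R)
    · have := opNorm_nonneg (h.centredAt x)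
      change opNorm (h.centredAt x) ≤ _
      linarith [hn x]

end Interaction

/-! ### Balls that straddle the boundary -/

section Cut

variable {V : Type} [Fintype V] [DecidableEq V]

/-- In the minimum, take the side opposite to `x`: each site of `S x` there forms a separated pair
with `x`. -/
theorem sum_cutSize_le_sepCount (A : Finset V) (S : V → Set V) :
    ∑ x, cutSize A (S x) ≤ sepCount A fun x y => y ∈ S x := by
  classical
  rw [sepCount, Finset.card_filter, Fintype.sum_prod_type]
  refine Finset.sum_le_sum fun x _ => ?_
  have hrow : (Finset.univ.filter fun y => y ∈ S x ∧ ¬ (x ∈ A ↔ y ∈ A)).card =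
      ∑ y, if y ∈ S x ∧ ¬ (x ∈ A ↔ y ∈ A) then 1 else 0 := Finset.card_filter _ _
  refine le_trans ?_ (hrow.trans (Finset.sum_congr rfl fun y _ => by congr)).le
  by_cases hx : x ∈ A
  · refine (min_le_right _ _).trans (Finset.card_le_card fun y hy => ?_)
    simp only [sitesOut, Finset.mem_filter, Finset.mem_compl] at hy
    simp [hx, hy.1, hy.2]
  · refine (min_le_left _ _).trans (Finset.card_le_card fun y hy => ?_)
    simp only [sitesIn, Finset.mem_filter] at hy
    simp [hx, hy.1, hy.2]

theorem card_sitesOut_le_outDeg (A : Finset V) (S : V → Set V) (x : V) :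
    (sitesOut A (S x)).card ≤ outDeg (fun x y => y ∈ S x) x := by
  classical
  refine Finset.card_le_card fun y hy => ?_
  simp only [sitesOut, Finset.mem_filter] at hy
  simpa using hy.2

theorem cutSize_empty (A : Finset V) : cutSize A ∅ = 0 := by
  simp [cutSize, sitesIn]

/-- On-site terms never straddle the cut, which is why power-law locality can leave them
unrestricted. -/
theorem cutSize_closedBall_zero [MetricSpace V] (A : Finset V) (x : V) :
    cutSize A (Metric.closedBall x ((0 : ℕ) : ℝ)) = 0 := by
  classical
  by_cases hx : x ∈ A
  · refine Nat.min_eq_zero_iff.2 (Or.inr ?_)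
    rw [Finset.card_eq_zero, sitesOut, Finset.filter_eq_empty_iff]
    rintro y hy h
    obtain rfl : y = x := by simpa using h
    exact Finset.mem_compl.1 hy hx
  · refine Nat.min_eq_zero_iff.2 (Or.inl ?_)
    rw [Finset.card_eq_zero, sitesIn, Finset.filter_eq_empty_iff]
    rintro y hy h
    obtain rfl : y = x := by simpa using h
    exact hx hy

end Cut

/-! ### From balls of the metric to lattice counts -/

namespace LatticePatch

/-- The constant bounding the number of sites in a ball of radius `r` by a multiple of `r ^ D`. -/
noncomputable def volumeConst (D m : ℕ) (κ : ℝ) : ℝ := m * (2 * max κ 1 + 2) ^ D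

/-- The constant bounding the number of pairs of sites at distance at most `r` that are separated
by a region by a multiple of `r ^ (D + 1)` times its boundary area. -/
noncomputable def cutConst (D m : ℕ) (κ : ℝ) : ℝ := (D * m + 2) * (2 * max κ 1 + 2) ^ (D + 1)

variable {D m : ℕ} {κ : ℝ}

theorem volumeConst_nonneg : 0 ≤ volumeConst D m κ := by
  have : 1 ≤ max κ 1 := le_max_right _ _
  unfold volumeConst
  positivity

theorem cutConst_pos : 0 < cutConst D m κ := by
  have : 1 ≤ max κ 1 := le_max_right _ _
  unfold cutConst
  positivity

variable {Λ : LatticePatch D m}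

/-- On a lattice without sites the norm bounds say nothing about the sign of `b`, but then the area
is zero. -/
theorem mul_boundaryArea_nonneg (A : Finset Λ.Site) {b : ℝ} (hb : Λ.Site → 0 ≤ b) :
    0 ≤ b * Λ.boundaryArea A := by
  rcases A.eq_empty_or_nonempty with rfl | ⟨x, -⟩
  · simp [boundaryArea]
  · exact mul_nonneg (hb x) (Nat.cast_nonneg _)

variable [MetricSpace Λ.Site]

/-- `κ` may be any real number; `max κ 1` makes the comparison monotone in the distance. -/
theorem gridDist_le_of_mem_closedBall
    (hκ : ∀ x y : Λ.Site, (Λ.gridDist x y : ℝ) ≤ κ * dist x y) {x y : Λ.Site} {r : ℕ}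
    (h : y ∈ Metric.closedBall x (r : ℝ)) : Λ.gridDist x y ≤ ⌊max κ 1 * r⌋₊ := by
  refine Nat.le_floor ((hκ x y).trans ?_)
  rw [Metric.mem_closedBall, dist_comm] at h
  exact (mul_le_mul_of_nonneg_right (le_max_left κ 1) dist_nonneg).trans
    (mul_le_mul_of_nonneg_left h (zero_le_one.trans (le_max_right κ 1)))

theorem two_mul_floor_add_two_le {r : ℕ} (hr : 1 ≤ r) :
    ((2 * ⌊max κ 1 * r⌋₊ + 2 : ℕ) : ℝ) ≤ (2 * max κ 1 + 2) * r := by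
  have h0 : 0 ≤ max κ 1 := zero_le_one.trans (le_max_right κ 1)
  have h1 := Nat.floor_le (mul_nonneg h0 r.cast_nonneg)
  have h2 : (1 : ℝ) ≤ r := by exact_mod_cast hr
  push_cast
  linarith

theorem sum_cutSize_le (hκ : ∀ x y : Λ.Site, (Λ.gridDist x y : ℝ) ≤ κ * dist x y)
    (A : Finset Λ.Site) (r : ℕ) :
    ∑ x, (cutSize A (Metric.closedBall x (r : ℝ)) : ℝ) ≤
      cutConst D m κ * r ^ (D + 1) * Λ.boundaryArea A := by
  rcases Nat.eq_zero_or_pos r with rfl | hr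
  · simp only [cutSize_closedBall_zero]
    simp
  have h1 : ∑ x, cutSize A (Metric.closedBall x (r : ℝ)) ≤
      (D * m + 2) * (2 * ⌊max κ 1 * r⌋₊ + 2) ^ (D + 1) * Λ.boundaryArea A :=
    (sum_cutSize_le_sepCount A _).trans
      ((sepCount_mono fun x y h => gridDist_le_of_mem_closedBall hκ h).trans
        (Λ.sepCount_gridDist_le A _))
  calc ∑ x, (cutSize A (Metric.closedBall x (r : ℝ)) : ℝ)
      ≤ (D * m + 2) * ((2 * ⌊max κ 1 * r⌋₊ + 2 : ℕ) : ℝ) ^ (D + 1) * Λ.boundaryArea A := by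
        exact_mod_cast h1
    _ ≤ (D * m + 2) * ((2 * max κ 1 + 2) * r) ^ (D + 1) * Λ.boundaryArea A := by
        gcongr
        exact two_mul_floor_add_two_le hr
    _ = _ := by rw [cutConst, mul_pow]; ring

theorem card_sitesOut_le (hκ : ∀ x y : Λ.Site, (Λ.gridDist x y : ℝ) ≤ κ * dist x y)
    (A : Finset Λ.Site) {r : ℕ} (hr : 1 ≤ r) (x : Λ.Site) :
    ((sitesOut A (Metric.closedBall x (r : ℝ))).card : ℝ) ≤ volumeConst D m κ * r ^ D := by
  have h1 : (sitesOut A (Metric.closedBall x (r : ℝ))).card ≤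
      (2 * ⌊max κ 1 * r⌋₊ + 2) ^ D * m :=
    (card_sitesOut_le_outDeg A (fun x => Metric.closedBall x (r : ℝ)) x).trans
      ((outDeg_mono x fun y h => gridDist_le_of_mem_closedBall hκ h).trans
        (Λ.outDeg_gridDist_le _ x))
  calc ((sitesOut A (Metric.closedBall x (r : ℝ))).card : ℝ)
      ≤ ((2 * ⌊max κ 1 * r⌋₊ + 2 : ℕ) : ℝ) ^ D * m := by exact_mod_cast h1
    _ ≤ ((2 * max κ 1 + 2) * r) ^ D * m := by
        gcongr
        exact two_mul_floor_add_two_le hr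
    _ = _ := by rw [volumeConst, mul_pow]; ring

theorem sum_mul_cutSize_le (hκ : ∀ x y : Λ.Site, (Λ.gridDist x y : ℝ) ≤ κ * dist x y)
    (A : Finset Λ.Site) (r : ℕ) {v : Λ.Site → ℝ} {b : ℝ} (hv : ∀ x, 0 ≤ v x ∧ v x ≤ b) :
    ∑ x, v x * cutSize A (Metric.closedBall x (r : ℝ)) ≤
      cutConst D m κ * r ^ (D + 1) * (b * Λ.boundaryArea A) := by
  rcases isEmpty_or_nonempty Λ.Site with _ | ⟨⟨x₀⟩⟩
  · have := mul_boundaryArea_nonneg A (b := b) fun x => isEmptyElim x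
    have := cutConst_pos (D := D) (m := m) (κ := κ)
    rw [Finset.univ_eq_empty, Finset.sum_empty]
    positivity
  have hb : 0 ≤ b := (hv x₀).1.trans (hv x₀).2
  calc _ ≤ ∑ x, b * (cutSize A (Metric.closedBall x (r : ℝ)) : ℝ) :=
        Finset.sum_le_sum fun x _ => mul_le_mul_of_nonneg_right (hv x).2 (Nat.cast_nonneg _)
    _ ≤ b * (cutConst D m κ * r ^ (D + 1) * Λ.boundaryArea A) := by
        rw [← Finset.mul_sum]
        exact mul_le_mul_of_nonneg_left (sum_cutSize_le hκ A r) hb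
    _ = _ := by ring

/-- A nonzero cut size is at least `1` and can be inserted as a factor. With the volume factor
bounded uniformly, the count of straddling pairs applies. -/
theorem sum_renyiWeight_le (hκ : ∀ x y : Λ.Site, (Λ.gridDist x y : ℝ) ≤ κ * dist x y)
    (A : Finset Λ.Site) (r : ℕ) {d : ℕ} (hd : 1 ≤ d) {v : Λ.Site → ℝ} {b : ℝ}
    (hv : ∀ x, 0 ≤ v x ∧ v x ≤ b) :
    (∑ x, if cutSize A (Metric.closedBall x (r : ℝ)) = 0 then 0
      else 2 * (d : ℝ) ^ (sitesOut A (Metric.closedBall x (r : ℝ))).card * v x) ≤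
      2 * (d : ℝ) ^ (volumeConst D m κ * r ^ D) *
        (cutConst D m κ * r ^ (D + 1) * (b * Λ.boundaryArea A)) := by
  have hd' : (1 : ℝ) ≤ d := by exact_mod_cast hd
  calc _ ≤ ∑ x, 2 * (d : ℝ) ^ (volumeConst D m κ * r ^ D) *
        (v x * cutSize A (Metric.closedBall x (r : ℝ))) := by
        refine Finset.sum_le_sum fun x _ => ?_
        split_ifs with h0
        · simp [h0]
        have hr : 1 ≤ r := by
          by_contra hr
          obtain rfl : r = 0 := by omega
          exact h0 (cutSize_closedBall_zero A x)
        have h1 : (1 : ℝ) ≤ cutSize A (Metric.closedBall x (r : ℝ)) := by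
          exact_mod_cast Nat.one_le_iff_ne_zero.2 h0
        rw [← mul_assoc]
        have hv0 := (hv x).1
        refine le_trans ?_ (le_mul_of_one_le_right (by positivity) h1)
        refine mul_le_mul_of_nonneg_right (mul_le_mul_of_nonneg_left ?_ zero_le_two) hv0
        rw [← Real.rpow_natCast]
        exact Real.rpow_le_rpow_of_exponent_le hd' (card_sitesOut_le hκ A hr x)
    _ ≤ _ := by
        rw [← Finset.mul_sum]
        exact mul_le_mul_of_nonneg_left (sum_mul_cutSize_le hκ A r hv) (by positivity)

end LatticePatch

/-! ### Area laws for the entanglement rate -/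

section AreaLaw

open LatticePatch

variable {D m : ℕ} {κ : ℝ} {Λ : LatticePatch D m} [MetricSpace Λ.Site] {d : ℕ}

theorem Interaction.exists_hamiltonian_eq_sum_product (h : Interaction Λ.Site d) :
    ∃ N : ℕ, h.hamiltonian = ∑ p ∈ Finset.univ ×ˢ Finset.range N, h.term p.1 p.2 := by
  obtain ⟨N, hN⟩ := h.exists_forall_term_eq_zero
  exact ⟨N, by rw [h.hamiltonian_eq_sum hN, Finset.sum_product]⟩

/-- Below the critical length, `(r / ξ) ^ D` is at least `c * log d * r ^ D`. As `c ≥ G + 1`, a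
factor `d ^ (-r ^ D)` is left over, and it is at most `2 ^ (-r)`; the remaining sum over `r` is thus
bounded independently of `d`. -/
theorem rpow_mul_exp_neg_le {D d : ℕ} (hD : 1 ≤ D) (hd : 2 ≤ d) {G c ξ : ℝ} (hG : G + 1 ≤ c)
    (hc : 0 < c) (hξ : 0 < ξ) (hξc : ξ < (1 / (c * Real.log d)) ^ (1 / (D : ℝ))) (r : ℕ) :
    (d : ℝ) ^ (G * r ^ D) * Real.exp (-((r : ℝ) / ξ) ^ (D : ℝ)) ≤ (1 / 2) ^ r := by
  have hd' : (2 : ℝ) ≤ d := by exact_mod_cast hd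
  have hlog2 : 0 < Real.log 2 := Real.log_pos one_lt_two
  have hlog : Real.log 2 ≤ Real.log d := Real.log_le_log two_pos hd'
  have hcl : 0 < c * Real.log d := mul_pos hc (hlog2.trans_le hlog)
  have hξD : ξ ^ D < 1 / (c * Real.log d) := by
    calc ξ ^ D < ((1 / (c * Real.log d)) ^ (1 / (D : ℝ))) ^ D :=
          pow_lt_pow_left₀ hξc hξ.le (by omega)
      _ = _ := by rw [one_div (D : ℝ), Real.rpow_inv_natCast_pow (by positivity) (by omega)]
  have hexp : c * Real.log d * r ^ D ≤ ((r : ℝ) / ξ) ^ (D : ℝ) := by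
    rw [Real.rpow_natCast, div_pow, le_div_iff₀ (by positivity)]
    rw [lt_div_iff₀ hcl] at hξD
    have : (0 : ℝ) ≤ (r : ℝ) ^ D := by positivity
    nlinarith
  have hrD : (r : ℝ) ≤ (r : ℝ) ^ D := by exact_mod_cast Nat.le_self_pow (by omega) r
  have hhalf : ((1 : ℝ) / 2) ^ r = Real.exp (-(r * Real.log 2)) := by
    rw [← Real.log_pow, Real.exp_neg, Real.exp_log (by positivity), one_div, inv_pow]
  rw [hhalf, Real.rpow_def_of_pos (by linarith), ← Real.exp_add, Real.exp_le_exp]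
  have h1 : (r : ℝ) * Real.log 2 ≤ r ^ D * Real.log d :=
    mul_le_mul hrD hlog hlog2.le (by positivity)
  have h2 : (G + 1) * (Real.log d * r ^ D) ≤ c * (Real.log d * r ^ D) :=
    mul_le_mul_of_nonneg_right hG (mul_nonneg (hlog2.le.trans hlog) (by positivity))
  linarith

variable [NeZero d]

theorem entropyRateLE_of_powerLawLocal
    (hκ : ∀ x y : Λ.Site, (Λ.gridDist x y : ℝ) ≤ κ * dist x y) {h : Interaction Λ.Site d}
    {w hbar M : ℝ} (hM : ∀ N : ℕ, ∑ r ∈ Finset.range N, (r : ℝ) ^ (D + 1) / (r : ℝ) ^ w ≤ M)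
    (hloc : h.PowerLawLocal w hbar) (A : Finset Λ.Site) {ρ : QuditOp Λ.Site d}
    (hρ : IsDensityMatrix ρ) : EntropyRateLE h.hamiltonian ρ A 1
      (36 * cutConst D m κ * M * Λ.boundaryArea A * hbar * Real.log d) := by
  obtain ⟨N, hN⟩ := h.exists_hamiltonian_eq_sum_product
  have hH := h.hamiltonian_isHermitian
  rw [hN] at hH ⊢
  refine (entropyRateLE_one (fun p _ => h.supportedOn p.1 p.2) hH hρ A).mono ?_
  have hb : 0 ≤ hbar * Λ.boundaryArea A := mul_boundaryArea_nonneg A fun x => by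
    simpa using (opNorm_nonneg _).trans (hloc x 1 le_rfl)
  have hC := cutConst_pos (D := D) (m := m) (κ := κ)
  have hlog : 0 ≤ Real.log d := Real.log_natCast_nonneg d
  rw [Finset.sum_product_right]
  calc _ ≤ ∑ r ∈ Finset.range N, 36 * cutConst D m κ * (hbar * Λ.boundaryArea A) * Real.log d *
        ((r : ℝ) ^ (D + 1) / (r : ℝ) ^ w) := by
        refine Finset.sum_le_sum fun r _ => ?_
        have hr : ∑ x, opNorm (h.term x r) * cutSize A (Metric.closedBall x (r : ℝ)) ≤
            cutConst D m κ * r ^ (D + 1) * (hbar / (r : ℝ) ^ w * Λ.boundaryArea A) := by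
          rcases Nat.eq_zero_or_pos r with rfl | hr
          · simp only [cutSize_closedBall_zero]
            simp
          · exact sum_mul_cutSize_le hκ A r fun x => ⟨opNorm_nonneg _, hloc x r hr⟩
        calc _ = 36 * Real.log d *
              ∑ x, opNorm (h.term x r) * cutSize A (Metric.closedBall x (r : ℝ)) := by
              rw [Finset.mul_sum]
              exact Finset.sum_congr rfl fun x _ => by ring
          _ ≤ _ := mul_le_mul_of_nonneg_left hr (by positivity)
          _ = _ := by ring
    _ ≤ 36 * cutConst D m κ * (hbar * Λ.boundaryArea A) * Real.log d * M := by
        rw [← Finset.mul_sum]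
        exact mul_le_mul_of_nonneg_left (hM N) (by positivity)
    _ = _ := by ring

theorem entropyRateLE_of_stretchedExpLocal (hD : 1 ≤ D)
    (hκ : ∀ x y : Λ.Site, (Λ.gridDist x y : ℝ) ≤ κ * dist x y) (hd : 2 ≤ d)
    {h : Interaction Λ.Site d} {c ξ hbar M : ℝ} (hc : volumeConst D m κ + 1 ≤ c) (hξ : 0 < ξ)
    (hξc : ξ < (1 / (c * Real.log d)) ^ (1 / (D : ℝ)))
    (hM : ∀ N : ℕ, ∑ r ∈ Finset.range N, (r : ℝ) ^ (D + 1) * (1 / 2) ^ r ≤ M)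
    (hloc : h.StretchedExpLocal D ξ hbar) (A : Finset Λ.Site) {ρ : QuditOp Λ.Site d}
    (hρ : IsDensityMatrix ρ) {α : ℝ} (hα : 1 < α) : EntropyRateLE h.hamiltonian ρ A α
      (α / (α - 1) * (2 * cutConst D m κ * M) * Λ.boundaryArea A * hbar) := by
  obtain ⟨N, hN⟩ := h.exists_hamiltonian_eq_sum_product
  have hH := h.hamiltonian_isHermitian
  rw [hN] at hH ⊢
  refine (entropyRateLE_renyi hα (fun p _ => h.supportedOn p.1 p.2) hH hρ A).mono ?_
  have hb : 0 ≤ hbar * Λ.boundaryArea A := mul_boundaryArea_nonneg A fun x =>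
    nonneg_of_mul_nonneg_left ((opNorm_nonneg _).trans (hloc x 0)) (Real.exp_pos _)
  have hC := cutConst_pos (D := D) (m := m) (κ := κ)
  have hG := volumeConst_nonneg (D := D) (m := m) (κ := κ)
  have hα' : 0 < α - 1 := by linarith
  calc _ ≤ α / (α - 1) * (2 * cutConst D m κ * (hbar * Λ.boundaryArea A) * M) := by
        refine mul_le_mul_of_nonneg_left ?_ (by positivity)
        rw [Finset.sum_product_right]
        calc _ ≤ ∑ r ∈ Finset.range N, 2 * cutConst D m κ * (hbar * Λ.boundaryArea A) *
              ((r : ℝ) ^ (D + 1) * (1 / 2) ^ r) := by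
              refine Finset.sum_le_sum fun r _ => ?_
              refine (sum_renyiWeight_le hκ A r (by omega)
                fun x => ⟨opNorm_nonneg _, hloc x r⟩).trans ?_
              calc _ = 2 * cutConst D m κ * (hbar * Λ.boundaryArea A) * r ^ (D + 1) *
                    ((d : ℝ) ^ (volumeConst D m κ * r ^ D) *
                      Real.exp (-((r : ℝ) / ξ) ^ (D : ℝ))) := by ring
                _ ≤ 2 * cutConst D m κ * (hbar * Λ.boundaryArea A) * r ^ (D + 1) * (1 / 2) ^ r :=
                    mul_le_mul_of_nonneg_left
                      (rpow_mul_exp_neg_le hD hd hc (by linarith) hξ hξc r) (by positivity)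
                _ = _ := by ring
          _ ≤ _ := by
              rw [← Finset.mul_sum]
              exact mul_le_mul_of_nonneg_left (hM N) (by positivity)
    _ = _ := by ring

theorem entropyRateLE_one_of_finiteRange
    (hκ : ∀ x y : Λ.Site, (Λ.gridDist x y : ℝ) ≤ κ * dist x y) {h : Interaction Λ.Site d}
    {R : ℕ} {hbar : ℝ} (hR : h.FiniteRange R) (hn : h.SiteNormLE hbar) (A : Finset Λ.Site)
    {ρ : QuditOp Λ.Site d} (hρ : IsDensityMatrix ρ) : EntropyRateLE h.hamiltonian ρ A 1
      (72 * cutConst D m κ * 2 ^ (D + 1) * (R : ℝ) ^ (D + 1) * Λ.boundaryArea A * hbar *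
        Real.log d) := by
  obtain ⟨J, hJ, hJ0, hJS⟩ := h.exists_site_decomposition hR hn
  have hH := h.hamiltonian_isHermitian
  rw [hJ] at hH ⊢
  refine (entropyRateLE_one (S := fun j => j.elim ∅ fun x => Metric.closedBall x ((2 * R : ℕ) : ℝ))
    (fun j _ => ?_) hH hρ A).mono ?_
  · cases j with
    | none => exact hJ0
    | some x => exact (hJS x).1
  have hlog : 0 ≤ Real.log d := Real.log_natCast_nonneg d
  rw [Fintype.sum_option]
  dsimp only [Option.elim]
  rw [cutSize_empty]
  calc _ = 36 * Real.log d * ∑ x, opNorm (J (some x)) *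
        cutSize A (Metric.closedBall x ((2 * R : ℕ) : ℝ)) := by
        rw [Finset.mul_sum, Nat.cast_zero, zero_mul, mul_zero, zero_add]
        exact Finset.sum_congr rfl fun x _ => by ring
    _ ≤ _ := mul_le_mul_of_nonneg_left
        (sum_mul_cutSize_le hκ A _ fun x => ⟨opNorm_nonneg _, (hJS x).2⟩) (by positivity)
    _ = _ := by push_cast; ring

theorem entropyRateLE_renyi_of_finiteRange
    (hκ : ∀ x y : Λ.Site, (Λ.gridDist x y : ℝ) ≤ κ * dist x y) (hd : 2 ≤ d)
    {h : Interaction Λ.Site d} {R : ℕ} {hbar c : ℝ} (hR : h.FiniteRange R)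
    (hn : h.SiteNormLE hbar) (hc : volumeConst D m κ * 2 ^ D + 1 ≤ 2 * c) (A : Finset Λ.Site)
    {ρ : QuditOp Λ.Site d} (hρ : IsDensityMatrix ρ) {α : ℝ} (hα : 1 < α) :
    EntropyRateLE h.hamiltonian ρ A α
      (4 * cutConst D m κ * 2 ^ (D + 1) / Real.log 2 * (α / (α - 1)) * R *
        (d : ℝ) ^ (2 * c * (R : ℝ) ^ D) * Λ.boundaryArea A * hbar * Real.log d) := by
  obtain ⟨J, hJ, hJ0, hJS⟩ := h.exists_site_decomposition hR hn
  have hH := h.hamiltonian_isHermitian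
  rw [hJ] at hH ⊢
  refine (entropyRateLE_renyi hα
    (S := fun j => j.elim ∅ fun x => Metric.closedBall x ((2 * R : ℕ) : ℝ))
    (fun j _ => ?_) hH hρ A).mono ?_
  · cases j with
    | none => exact hJ0
    | some x => exact (hJS x).1
  have hd' : (2 : ℝ) ≤ d := by exact_mod_cast hd
  have hd0 : (0 : ℝ) < d := by linarith
  have hlog2 : 0 < Real.log 2 := Real.log_pos one_lt_two
  have hlog : Real.log 2 ≤ Real.log d := Real.log_le_log two_pos hd'
  have hb : 0 ≤ 2 * hbar * Λ.boundaryArea A := mul_boundaryArea_nonneg A fun x =>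
    (opNorm_nonneg _).trans (hJS x).2
  have hC := cutConst_pos (D := D) (m := m) (κ := κ)
  have hα' : 0 < α - 1 := by linarith
  -- Of the boundary factor `R ^ (D + 1)` only `R` is kept in front; `R ^ D ≤ d ^ (R ^ D)` is moved
  -- into the exponential, at the cost of the `+ 1` in `hc`.
  have hpow : (d : ℝ) ^ (volumeConst D m κ * ((2 * R : ℕ) : ℝ) ^ D) * (R : ℝ) ^ D ≤
      (d : ℝ) ^ (2 * c * (R : ℝ) ^ D) := by
    have h1 : (R : ℝ) ^ D ≤ (d : ℝ) ^ ((R : ℝ) ^ D) := by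
      have h2 : R ^ D ≤ d ^ R ^ D := (Nat.lt_pow_self (by omega)).le
      rw [← Nat.cast_pow R D, Real.rpow_natCast]
      exact_mod_cast h2
    calc _ ≤ (d : ℝ) ^ (volumeConst D m κ * ((2 * R : ℕ) : ℝ) ^ D) * (d : ℝ) ^ ((R : ℝ) ^ D) :=
          mul_le_mul_of_nonneg_left h1 (by positivity)
      _ = (d : ℝ) ^ ((volumeConst D m κ * 2 ^ D + 1) * (R : ℝ) ^ D) := by
          rw [← Real.rpow_add hd0]
          push_cast
          congr 1
          ring
      _ ≤ _ := Real.rpow_le_rpow_of_exponent_le (by linarith)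
          (mul_le_mul_of_nonneg_right hc (by positivity))
  have hR0 : (0 : ℝ) ≤ R := R.cast_nonneg
  calc _ ≤ α / (α - 1) * (2 * (d : ℝ) ^ (volumeConst D m κ * ((2 * R : ℕ) : ℝ) ^ D) *
        (cutConst D m κ * ((2 * R : ℕ) : ℝ) ^ (D + 1) * (2 * hbar * Λ.boundaryArea A))) :=
        mul_le_mul_of_nonneg_left (by
          rw [Fintype.sum_option]
          exact (add_le_add (if_pos (cutSize_empty A)).le (sum_renyiWeight_le hκ A _ (by omega)
            fun x => ⟨opNorm_nonneg _, (hJS x).2⟩)).trans_eq (zero_add _)) (by positivity)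
    _ = 2 * cutConst D m κ * 2 ^ (D + 1) * (α / (α - 1)) * R * (2 * hbar * Λ.boundaryArea A) *
        ((d : ℝ) ^ (volumeConst D m κ * ((2 * R : ℕ) : ℝ) ^ D) * (R : ℝ) ^ D) := by
        push_cast
        ring
    _ ≤ 2 * cutConst D m κ * 2 ^ (D + 1) * (α / (α - 1)) * R * (2 * hbar * Λ.boundaryArea A) *
        (d : ℝ) ^ (2 * c * (R : ℝ) ^ D) := mul_le_mul_of_nonneg_left hpow (by positivity)
    -- The argument does not produce the factor `log d`; it is inserted at the price of `1 / log 2`.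
    _ ≤ 2 * cutConst D m κ * 2 ^ (D + 1) * (α / (α - 1)) * R * (2 * hbar * Λ.boundaryArea A) *
        (d : ℝ) ^ (2 * c * (R : ℝ) ^ D) * (Real.log d / Real.log 2) :=
        le_mul_of_one_le_right (by positivity) ((one_le_div hlog2).2 hlog)
    _ = _ := by ring

end AreaLaw

/-! ### Convergent sums and the choice of constants -/

theorem exists_forall_sum_range_pow_div_rpow_le {n : ℕ} {w : ℝ} (hw : n + 1 < w) :
    ∃ M > (0 : ℝ), ∀ N : ℕ, ∑ r ∈ Finset.range N, (r : ℝ) ^ n / (r : ℝ) ^ w ≤ M := by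
  have hs : Summable fun r : ℕ => (r : ℝ) ^ n / (r : ℝ) ^ w := by
    refine Summable.of_norm_bounded_eventually_nat
      (Real.summable_nat_rpow.2 (by linarith : (n : ℝ) - w < -1)) ?_
    filter_upwards [Filter.eventually_gt_atTop 0] with r hr
    have hr' : (0 : ℝ) < r := by exact_mod_cast hr
    rw [Real.rpow_sub hr', Real.rpow_natCast, Real.norm_of_nonneg (by positivity)]
  refine ⟨∑' r : ℕ, (r : ℝ) ^ n / (r : ℝ) ^ w + 1, ?_, fun N => ?_⟩
  · have : 0 ≤ ∑' r : ℕ, (r : ℝ) ^ n / (r : ℝ) ^ w := tsum_nonneg fun r => by positivity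
    linarith
  · linarith [hs.sum_le_tsum (Finset.range N) fun r _ => by positivity]

theorem exists_forall_sum_range_pow_mul_geometric_le (n : ℕ) :
    ∃ M > (0 : ℝ), ∀ N : ℕ, ∑ r ∈ Finset.range N, (r : ℝ) ^ n * (1 / 2) ^ r ≤ M := by
  have hs : Summable fun r : ℕ => (r : ℝ) ^ n * (1 / 2) ^ r :=
    summable_pow_mul_geometric_of_norm_lt_one n (by norm_num)
  refine ⟨∑' r : ℕ, (r : ℝ) ^ n * (1 / 2) ^ r + 1, ?_, fun N => ?_⟩
  · have : 0 ≤ ∑' r : ℕ, (r : ℝ) ^ n * (1 / 2) ^ r := tsum_nonneg fun r => by positivity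
    linarith
  · linarith [hs.sum_le_tsum (Finset.range N) fun r _ => by positivity]

theorem mainTheorem1 (D m : ℕ) (hD : 1 ≤ D) (κ : ℝ) :
    ∃ c₁ > (0 : ℝ), ∃ c' > (0 : ℝ), ∃ C₁ > (0 : ℝ), ∃ C₂ > (0 : ℝ),
      -- power-law local interactions, von Neumann entropy
      (∀ w : ℝ, 2 * (D : ℝ) + 1 < w → ∃ c > (0 : ℝ),
        ∀ (Λ : LatticePatch D m) [MetricSpace Λ.Site],
          (∀ x y : Λ.Site, (Λ.gridDist x y : ℝ) ≤ κ * dist x y) →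
        ∀ (d₀ : ℕ), 2 ≤ d₀ → ∀ (h : Interaction Λ.Site d₀) (hbar : ℝ),
          h.PowerLawLocal w hbar →
        ∀ (A : Finset Λ.Site) (ρ : QuditOp Λ.Site d₀), IsDensityMatrix ρ →
          EntropyRateLE h.hamiltonian ρ A 1 (c * Λ.boundaryArea A * hbar * Real.log d₀)) ∧
      -- (super)exponentially local interactions, Renyi entropies
      (∀ (Λ : LatticePatch D m) [MetricSpace Λ.Site],
          (∀ x y : Λ.Site, (Λ.gridDist x y : ℝ) ≤ κ * dist x y) →
        ∀ (d₀ : ℕ), 2 ≤ d₀ → ∀ (h : Interaction Λ.Site d₀) (ξ hbar : ℝ),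
          0 < ξ → ξ < (1 / (c₁ * Real.log d₀)) ^ (1 / (D : ℝ)) →
          h.StretchedExpLocal D ξ hbar →
        ∀ (A : Finset Λ.Site) (ρ : QuditOp Λ.Site d₀), IsDensityMatrix ρ →
        ∀ α : ℝ, 1 < α →
          EntropyRateLE h.hamiltonian ρ A α
            (α / (α - 1) * c' * Λ.boundaryArea A * hbar)) ∧
      -- finite-range interactions, all entropies
      (∀ (Λ : LatticePatch D m) [MetricSpace Λ.Site],
          (∀ x y : Λ.Site, (Λ.gridDist x y : ℝ) ≤ κ * dist x y) →
        ∀ (d₀ : ℕ), 2 ≤ d₀ → ∀ (h : Interaction Λ.Site d₀) (R : ℕ) (hbar : ℝ),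
          h.FiniteRange R → h.SiteNormLE hbar →
        ∀ (A : Finset Λ.Site) (ρ : QuditOp Λ.Site d₀), IsDensityMatrix ρ →
          EntropyRateLE h.hamiltonian ρ A 1
            (C₁ * (R : ℝ) ^ (D + 1) * Λ.boundaryArea A * hbar * Real.log d₀) ∧
          ∀ α : ℝ, 1 < α →
            EntropyRateLE h.hamiltonian ρ A α
              (C₂ * (α / (α - 1)) * R * (d₀ : ℝ) ^ (2 * c₁ * (R : ℝ) ^ D)
                * Λ.boundaryArea A * hbar * Real.log d₀)) := by
  have hG := LatticePatch.volumeConst_nonneg (D := D) (m := m) (κ := κ)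
  have hC := LatticePatch.cutConst_pos (D := D) (m := m) (κ := κ)
  have hlog2 : 0 < Real.log 2 := Real.log_pos one_lt_two
  have hG2 : LatticePatch.volumeConst D m κ ≤ LatticePatch.volumeConst D m κ * 2 ^ D :=
    le_mul_of_one_le_right hG (one_le_pow₀ one_le_two)
  obtain ⟨M, hM0, hM⟩ := exists_forall_sum_range_pow_mul_geometric_le (D + 1)
  -- A single `c₁` serves two purposes: the critical length needs `volumeConst + 1`, and the
  -- finite-range exponent needs half of this value, where `2 ^ D` stems from balls of radius `2 *
  -- R`. In `72` and `4`, a factor `2` is the norm `2 * hbar` of the site operators.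
  refine ⟨LatticePatch.volumeConst D m κ * 2 ^ D + 1, by positivity,
    2 * LatticePatch.cutConst D m κ * M, by positivity,
    72 * LatticePatch.cutConst D m κ * 2 ^ (D + 1), by positivity,
    4 * LatticePatch.cutConst D m κ * 2 ^ (D + 1) / Real.log 2, by positivity, ?_, ?_, ?_⟩
  · intro w hw
    have hD' : (1 : ℝ) ≤ D := by exact_mod_cast hD
    -- The sum of `r ^ (D + 1 - w)` converges for `w > D + 2`, which follows from `w > 2 * D + 1`
    -- because `D ≥ 1`.
    obtain ⟨M', hM0', hM'⟩ := exists_forall_sum_range_pow_div_rpow_le (n := D + 1) (w := w)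
      (by push_cast; linarith)
    refine ⟨36 * LatticePatch.cutConst D m κ * M', by positivity, ?_⟩
    intro Λ _ hκ d₀ hd h hbar hloc A ρ hρ
    have : NeZero d₀ := ⟨by omega⟩
    exact entropyRateLE_of_powerLawLocal hκ hM' hloc A hρ
  · intro Λ _ hκ d₀ hd h ξ hbar hξ hξc hloc A ρ hρ α hα
    have : NeZero d₀ := ⟨by omega⟩
    exact entropyRateLE_of_stretchedExpLocal hD hκ hd (by linarith) hξ hξc hM hloc A hρ hα
  · intro Λ _ hκ d₀ hd h R hbar hR hn A ρ hρ
    have : NeZero d₀ := ⟨by omega⟩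
    exact ⟨entropyRateLE_one_of_finiteRange hκ hR hn A hρ, fun α hα =>
      entropyRateLE_renyi_of_finiteRange hκ hd hR hn (by linarith) A hρ hα⟩
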